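/- Let $\mathbf k$ be an algebraically closed field, let $s>2$ and $m$ be integers, and let $\Lambda=\mathbf k\langle x_1,\dots,x_m\rangle/(f_1,f_2)$, where $f_1,f_2$ are two linearly independent homogeneous elements of degree $s$ of the free algebra ($\deg x_i=1$). Let $\Lambda^!=\mathbf k\langle x_1^*,\dots,x_m^*\rangle/I^!$ be the $s$-homogeneous dual of $\Lambda$, where $I^!$ is the ideal generated by all $g\in\mathbf k\langle x_1^*,\dots,x_m^*\rangle_s\cong(\mathbf k\langle x_1,\dots,x_m\rangle_s)^*$ with $g(f_1)=g(f_2)=0$ (the monomials in the $x_i^*$ being dual to the monomials in the $x_i$). Put $A=(\Lambda^!)^{(s)}=\bigoplus_{n\ge0}A_n$ with $A_n=\Lambda^!_{sn}$, and $M=(\Lambda^!)^{(s,1)}=\bigoplus_{n\ge0}M_n$ with $M_n=\Lambda^!_{sn+1}$. For a graded space $U$ with finite-dimensional components write $\mathcal H_U(t)=\sum_{i\ge0}(\dim_{\mathbf k}U_i)t^i\in\mathbb Z[[t]]$. The generalized Koszul complex $\cdots\to K_3\xrightarrow{d_2}K_2\xrightarrow{d_1}K_1\xrightarrow{d_0}K_0$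 of $\Lambda$ has the terms $K_{2n}=A_n^*\otimes_{\mathbf k}\Lambda$ and $K_{2n+1}=M_n^*\otimes_{\mathbf k}\Lambda$ and the differentials $$d_{2n}(\xi\otimes a)=\sum_{i=1}^m\xi(-\cdot x_i^*)\otimes x_ia,\qquad d_{2n+1}(\xi\otimes a)=\sum_{w}\xi(-\cdot x_w^*)\otimes x_wa,$$ where $w$ runs over the words $i_1\cdots i_{s-1}$ of length $s-1$ and $x_w=x_{i_1}\cdots x_{i_{s-1}}$, $x_w^*=x_{i_1}^*\cdots x_{i_{s-1}}^*$. The algebra $\Lambda$ is called $s$-Koszul if, for every $i\ge0$, the graded space $\mathrm{Ext}^i_\Lambda(\mathbf k,\mathbf k)$ (for graded right $\Lambda$-modules, $\mathbf k=\Lambda/\bigoplus_{j>0}\Lambda_j$) is concentrated in degree $-\chi_s(i)$, where $\chi_s(i)=\frac{is}2$ for even $i$ and $\chi_s(i)=\frac{(i-1)s}2+1$ for odd $i$. Then the following three conditions are equivalent: 1. $\Lambda$ is $s$-Koszul; 2. the generalized Koszul complex of $\Lambda$ is exact in the second term, i.e. $\operatorname{Ker}d_1=\operatorname{Im}d_2$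 in $K_2$; 3. $\big(\mathcal H_A(t^s)-t\,\mathcal H_M(t^s)\big)\,\mathcal H_\Lambda(t)=1$ in $\mathbb Z[[t]]$. -/

import Mathlib

open scoped TensorProduct

universe u

noncomputable section

namespace HomogAlg

section Free

variable (k : Type u) [Field k] (m : ℕ)

/-- The free algebra `k⟨x₁, …, x_m⟩`, with generators indexed by `Fin m`. -/
abbrev Free : Type u := FreeAlgebra k (Fin m)

variable {m}

/-- The monomial `x_{w 0} x_{w 1} ⋯ x_{w (n-1)}`. -/
def mono {n : ℕ} (w : Fin n → Fin m) : Free k m :=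
  (List.ofFn fun i => FreeAlgebra.ι k (w i)).prod

variable (m)

/-- The degree `n` component of `k⟨x₁, …, x_m⟩` for the grading `deg x_i = 1`. -/
def homog (n : ℕ) : Submodule k (Free k m) :=
  Submodule.span k (Set.range fun w : Fin n → Fin m => mono k w)

end Free

variable {k : Type u} [Field k] {m : ℕ}

/-- The value on `f ∈ k⟨x₁, …, x_m⟩` of `g ∈ k⟨x₁*, …, x_m*⟩`, where the monomials in the `x_i*`
are regarded as the dual family of the monomials in the `x_i`. The generator `x_i*` of the
second free algebra is again represented by the generator with index `i`. -/
def pair (g f : Free k m) : k :=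
  ((FreeAlgebra.basisFreeMonoid k (Fin m)).repr g).sum
    fun w c => c * (FreeAlgebra.basisFreeMonoid k (Fin m)).repr f w

section Quotient

variable (R : Submodule k (Free k m))

/-- The algebra `k⟨x₁, …, x_m⟩/(R)`. -/
abbrev QuotAlg : Type u := (TwoSidedIdeal.span (R : Set (Free k m))).ringCon.Quotient

/-- The projection `k⟨x₁, …, x_m⟩ → k⟨x₁, …, x_m⟩/(R)`. -/
def proj : Free k m →ₐ[k] QuotAlg R :=
  RingCon.mkₐ k (TwoSidedIdeal.span (R : Set (Free k m))).ringCon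

/-- The degree `n` component of `k⟨x₁, …, x_m⟩/(R)` (for `R` spanned by homogeneous elements). -/
def comp (n : ℕ) : Submodule k (QuotAlg R) := (homog k m n).map (proj R).toLinearMap

end Quotient

/-- The space of relations of the `s`-homogeneous dual of `k⟨x₁, …, x_m⟩/(R)`, `R` being a space of
elements of degree `s`: the elements of degree `s` of `k⟨x₁*, …, x_m*⟩` vanishing on `R`. -/
def dualRel (s : ℕ) (R : Submodule k (Free k m)) : Submodule k (Free k m) where
  carrier := {g | g ∈ homog k m s ∧ ∀ f ∈ R, pair g f = 0}
  zero_mem' := ⟨zero_mem _, fun f _ => by simp [pair]⟩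
  add_mem' := by
    rintro a b ⟨ha, ha'⟩ ⟨hb, hb'⟩
    refine ⟨add_mem ha hb, fun f hf => ?_⟩
    have h : pair (a + b) f = pair a f + pair b f := by
      unfold pair
      rw [map_add]
      exact Finsupp.sum_add_index' (by simp) (by intros; ring)
    rw [h, ha' f hf, hb' f hf, add_zero]
  smul_mem' := by
    rintro c a ⟨ha, ha'⟩
    refine ⟨Submodule.smul_mem _ c ha, fun f hf => ?_⟩
    have h : pair (c • a) f = c * pair a f := by
      unfold pair
      rw [map_smul, Finsupp.sum_smul_index (by simp), Finsupp.mul_sum]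
      exact Finsupp.sum_congr fun _ _ => by ring
    rw [h, ha' f hf, mul_zero]

theorem mono_mul {p q : ℕ} (v : Fin p → Fin m) (w : Fin q → Fin m) :
    mono k v * mono k w = mono k (Fin.append v w) := by
  unfold mono
  rw [← List.prod_append, ← List.ofFn_fin_append]
  congr 2
  funext i
  refine Fin.addCases (fun j => ?_) (fun j => ?_) i <;> simp

theorem homog_mul {p q : ℕ} {a b : Free k m} (ha : a ∈ homog k m p) (hb : b ∈ homog k m q) :
    a * b ∈ homog k m (p + q) := by
  have h : homog k m p * homog k m q ≤ homog k m (p + q) := by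
    unfold homog
    rw [Submodule.span_mul_span, Submodule.span_le]
    rintro _ ⟨_, ⟨v, rfl⟩, _, ⟨w, rfl⟩, rfl⟩
    exact Submodule.subset_span ⟨Fin.append v w, (mono_mul v w).symm⟩
  exact h (Submodule.mul_mem_mul ha hb)

theorem comp_mul (R : Submodule k (Free k m)) {p q : ℕ} {a b : QuotAlg R}
    (ha : a ∈ comp R p) (hb : b ∈ comp R q) : a * b ∈ comp R (p + q) := by
  obtain ⟨a, ha, rfl⟩ := ha
  obtain ⟨b, hb, rfl⟩ := hb
  exact ⟨a * b, homog_mul ha hb, map_mul (proj R) a b⟩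

theorem proj_mono_mem (R : Submodule k (Free k m)) {n : ℕ} (w : Fin n → Fin m) :
    proj R (mono k w) ∈ comp R n :=
  ⟨mono k w, Submodule.subset_span ⟨w, rfl⟩, rfl⟩

section Hilbert

variable {B : Type u} [Ring B] [Algebra k B]

/-- The components of the `(r,t)`-Veronese bimodule of a graded algebra `⨁ 𝒜 n`; for `t = 0` these
are the components of the `r`-Veronese ring. All products are those of the algebra. -/
def veronese (𝒜 : ℕ → Submodule k B) (r t i : ℕ) : Submodule k B := 𝒜 (r * i + t)

/-- The Hilbert series `∑ (dim 𝒜 i) tⁱ`. -/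
def hilbertSeries (𝒜 : ℕ → Submodule k B) : PowerSeries ℤ :=
  PowerSeries.mk fun n => (Module.finrank k (𝒜 n) : ℤ)

end Hilbert

section Koszul

variable (s : ℕ) (R : Submodule k (Free k m))

/-- The components of `A = (Λ^!)^{(s)}`, where `Λ = k⟨x₁, …, x_m⟩/(R)`. -/
abbrev A (n : ℕ) : Submodule k (QuotAlg (dualRel s R)) := veronese (comp (dualRel s R)) s 0 n

/-- The components of `M = (Λ^!)^{(s,1)}`, where `Λ = k⟨x₁, …, x_m⟩/(R)`. -/
abbrev M (n : ℕ) : Submodule k (QuotAlg (dualRel s R)) := veronese (comp (dualRel s R)) s 1 n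

/-- For `p + l = q`, the map `(Λ^!_q)^* ⊗ Λ → (Λ^!_p)^* ⊗ Λ` which is the composite of the dual
`(Λ^!_q)^* → (Λ^!_p)^* ⊗ ((Λ^!_1)^*)^{⊗ l}` of the multiplication map with the identification
`(Λ^!_1)^* = Λ_1` and the multiplication `Λ_1^{⊗ l} ⊗ Λ → Λ`. In terms of monomials,
`ξ ⊗ a ↦ ∑_w ξ(- · x_w*) ⊗ x_w a`, the sum being over the words `w` of length `l`. -/
def koszulMap (p l q : ℕ) (h : p + l = q) :
    Module.Dual k (comp (dualRel s R) q) ⊗[k] QuotAlg R →ₗ[k]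
      Module.Dual k (comp (dualRel s R) p) ⊗[k] QuotAlg R :=
  ∑ w : Fin l → Fin m,
    TensorProduct.map
      ((LinearMap.mulRight k (proj (dualRel s R) (mono k w))).restrict
        (p := comp (dualRel s R) p) (q := comp (dualRel s R) q)
        fun _ ha => h ▸ comp_mul _ ha (proj_mono_mem _ w)).dualMap
      (LinearMap.mulLeft k (proj R (mono k w)))

/-- The term `K_{2n} = A_n^* ⊗ Λ` of the generalized Koszul complex. -/
abbrev KEven (n : ℕ) : Type u := Module.Dual k (A s R n) ⊗[k] QuotAlg R

/-- The term `K_{2n+1} = M_n^* ⊗ Λ` of the generalized Koszul complex. -/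
abbrev KOdd (n : ℕ) : Type u := Module.Dual k (M s R n) ⊗[k] QuotAlg R

/-- The differential `d_{2n} : K_{2n+1} → K_{2n}`. -/
def dEven (n : ℕ) : KOdd s R n →ₗ[k] KEven s R n :=
  koszulMap s R (s * n + 0) 1 (s * n + 1) rfl

variable {s} in
/-- The differential `d_{2n+1} : K_{2n+2} → K_{2n+1}`. -/
def dOdd (hs : 1 ≤ s) (n : ℕ) : KEven s R (n + 1) →ₗ[k] KOdd s R n :=
  koszulMap s R (s * n + 1) (s - 1) (s * (n + 1) + 0) (by rw [Nat.mul_succ]; omega)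

variable {s} in
/-- Exactness of `K_3 → K_2 → K_1`. -/
def KoszulExactAtTwo (hs : 1 ≤ s) : Prop :=
  Function.Exact (dEven s R 1) (dOdd R hs 0)

end Koszul

section Ext

variable (R : Submodule k (Free k m))

/-- The ideal `J(Λ) = ⨁_{i > 0} Λ_i`, as a right ideal of `Λ = k⟨x₁, …, x_m⟩/(R)`. Right modules
are modules over the opposite ring. -/
def J : Submodule (QuotAlg R)ᵐᵒᵖ (QuotAlg R) :=
  Submodule.span (QuotAlg R)ᵐᵒᵖ {a | ∃ n, 0 < n ∧ a ∈ comp R n}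

/-- The right `Λ`-module `k = Λ/J(Λ)`, concentrated in degree `0`. -/
abbrev Triv : Type u := QuotAlg R ⧸ J R

/-- A projective resolution of `k` in the category of `ℤ`-graded right `Λ`-modules. -/
structure GradedProjRes where
  P : ℕ → Type u
  [addCommGroup : ∀ i, AddCommGroup (P i)]
  [module : ∀ i, Module (QuotAlg R)ᵐᵒᵖ (P i)]
  gr : ∀ i, ℤ → AddSubgroup (P i)
  isInternal : ∀ i, DirectSum.IsInternal (gr i)
  smul_mem : ∀ i (n : ℕ) (j : ℤ) (a : QuotAlg R) (p : P i), a ∈ comp R n → p ∈ gr i j →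
    MulOpposite.op a • p ∈ gr i (j + n)
  projective : ∀ i, Module.Projective (QuotAlg R)ᵐᵒᵖ (P i)
  d : ∀ i, P (i + 1) →ₗ[(QuotAlg R)ᵐᵒᵖ] P i
  d_mem : ∀ i (j : ℤ) (p : P (i + 1)), p ∈ gr (i + 1) j → d i p ∈ gr i j
  ε : P 0 →ₗ[(QuotAlg R)ᵐᵒᵖ] Triv R
  ε_degree : ∀ (j : ℤ) (p : P 0), j ≠ 0 → p ∈ gr 0 j → ε p = 0
  ε_surjective : Function.Surjective ε
  exact_zero : Function.Exact (d 0) ε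
  exact_succ : ∀ i, Function.Exact (d (i + 1)) (d i)

attribute [instance] GradedProjRes.addCommGroup GradedProjRes.module

namespace GradedProjRes

variable {R} (Q : GradedProjRes R)

/-- The `Λ`-linear maps `P_i → k` that are homogeneous of degree `e`. As `k` is concentrated in
degree `0`, these are the maps that vanish on every component of `P_i` of degree `j ≠ -e`. -/
def cochains (i : ℕ) (e : ℤ) : AddSubgroup (Q.P i →ₗ[(QuotAlg R)ᵐᵒᵖ] Triv R) where
  carrier := {φ | ∀ (j : ℤ) (p : Q.P i), j ≠ -e → p ∈ Q.gr i j → φ p = 0}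
  zero_mem' := fun _ _ _ _ => rfl
  add_mem' := fun ha hb j p hj hp => by
    rw [LinearMap.add_apply, ha j p hj hp, hb j p hj hp, add_zero]
  neg_mem' := fun ha j p hj hp => by
    rw [LinearMap.neg_apply, ha j p hj hp, neg_zero]

/-- The map `Hom_Λ(P_i, k) → Hom_Λ(P_{i+1}, k)` induced by the differential. -/
def coboundary (i : ℕ) :
    (Q.P i →ₗ[(QuotAlg R)ᵐᵒᵖ] Triv R) →+ (Q.P (i + 1) →ₗ[(QuotAlg R)ᵐᵒᵖ] Triv R) where
  toFun φ := φ.comp (Q.d i)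
  map_zero' := LinearMap.zero_comp _
  map_add' _ _ := LinearMap.add_comp _ _ _

/-- The cocycles of degree `e` in `Hom_Λ(P_i, k)`. -/
def cocycles (i : ℕ) (e : ℤ) : AddSubgroup (Q.P i →ₗ[(QuotAlg R)ᵐᵒᵖ] Triv R) :=
  Q.cochains i e ⊓ (Q.coboundary i).ker

/-- The coboundaries of degree `e` in `Hom_Λ(P_i, k)`. -/
def coboundaries : (i : ℕ) → (e : ℤ) → AddSubgroup (Q.P i →ₗ[(QuotAlg R)ᵐᵒᵖ] Triv R)
  | 0, _ => ⊥
  | i + 1, e => (Q.cochains i e).map (Q.coboundary i)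

/-- The degree `e` component of `Ext_Λ^i(k, k)`, computed by the resolution `Q`. -/
abbrev ExtComp (i : ℕ) (e : ℤ) : Type u :=
  Q.cocycles i e ⧸ (Q.coboundaries i e).addSubgroupOf (Q.cocycles i e)

end GradedProjRes

/-- The function `χ_s`: `χ_s(i) = is/2` for `i` even and `χ_s(i) = (i-1)s/2 + 1` for `i` odd. -/
def chi (s i : ℕ) : ℕ := if Even i then i / 2 * s else (i - 1) / 2 * s + 1

/-- `Λ = k⟨x₁, …, x_m⟩/(R)` is `s`-Koszul: for every `i`, the graded space `Ext_Λ^i(k, k)` is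
concentrated in degree `-χ_s(i)`. Up to isomorphism the components of `Ext` do not depend on the
graded projective resolution from which they are computed. -/
def IsSKoszul (s : ℕ) : Prop :=
  ∃ Q : GradedProjRes R, ∀ (i : ℕ) (e : ℤ), e ≠ -(chi s i : ℤ) → Subsingleton (Q.ExtComp i e)

end Ext

end HomogAlg

end

/-! Let V be the span of the generators, R the span of the two relations, and W_n the intersection
of the spaces V^i R V^j with i + s + j = n (all of V^n if n < s). The pairing of monomials
identifies W_n with the dual of Λ^!_n (`exists_dualBasis`), and the generalized Koszul complex
becomes a complex of free modules whose differentials are matrices expressing a basis of W_q through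
one of W_p (`coordEquiv_koszulMap`). Its homology is k at K_0 and zero at K_1, by the presentation
of Λ.

Everything rests on the property `KData.Determined`: exactness at K_2 in internal degrees below n
forces exactness at K_3, K_4, … in degree n. Granting it, exactness at K_2 makes the complex a
resolution whose i-th term is generated in degree χ_s(i). So Λ is s-Koszul, and Euler
characteristics give the Hilbert series identity. Conversely, given that identity, induction on n
works: in degree n the Euler characteristic sees only the homology at K_2, which must vanish.
Finally, if Λ is s-Koszul, a cycle of K_2 of least degree n that is not a boundary has n > s + 1 and
yields a map from the second syzygies to k of degree -n. Vanishing of Ext^3 in that degree extends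
the map to K_2, where it kills all elements of degree n, a contradiction
(`exactAt_one_of_isSKoszul`).

To prove `Determined`, the relations are classified by RV ∩ VR (`classification`). If this is zero,
the complex stops at K_2. If R is spanned by vh and hu with overlap vhu, or if the overlap is one
tensor of rank two on both sides, then W_{s+2} = 0 and only injectivity of K_3 → K_2 is at stake.
Otherwise the spaces W_n come from a `Ladder`: they are spanned by the entries of e N^{n-1} for a
matrix N of linear forms, and from K_3 on the differentials alternate between N and N^{s-1};
exactness at K_2 propagates formally.

The rank two overlap is the delicate case. A nonzero kernel element of K_3 → K_2 is a socle element
of some degree d. Lower exactness then extends linear forms to module maps, which forces an algebra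
on two generators to vanish above degree d (`cz_eq_bot_of_socle`). Its Hilbert polynomial P would
satisfy (1 - 2t + 2t^s - t^{s+1})P = 1 - β_d t^{s+1+d}, whose value and derivative at t = 1 are
incompatible when s > 2 (`false_of_hilbert`). -/

noncomputable section

namespace HomogAlg

/-! ### Contractions in the free algebra -/

section Contraction

variable {k : Type u} [Field k] {m : ℕ}

/-- The augmentation `k⟨x₁, …, x_m⟩ → k`. -/
abbrev aug : Free k m →ₐ[k] k := FreeAlgebra.algebraMapInv

/-- The algebra map whose matrix entries are the augmentation, the left contraction along `ξ`
and the identity. -/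
def lconMat (ξ : Fin m → k) : Free k m →ₐ[k] Matrix (Fin 2) (Fin 2) (Free k m) :=
  FreeAlgebra.lift k fun i => !![0, algebraMap k _ (ξ i); 0, FreeAlgebra.ι k i]

/-- The algebra map whose matrix entries are the identity, the right contraction along `ξ`
and the augmentation. -/
def rconMat (ξ : Fin m → k) : Free k m →ₐ[k] Matrix (Fin 2) (Fin 2) (Free k m) :=
  FreeAlgebra.lift k fun i => !![FreeAlgebra.ι k i, algebraMap k _ (ξ i); 0, 0]

/-- Left contraction along the functional `x_i ↦ ξ i`. -/
def lcon (ξ : Fin m → k) : Free k m →ₗ[k] Free k m where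
  toFun a := lconMat ξ a 0 1
  map_add' a b := by simp
  map_smul' c a := by simp

/-- Right contraction along the functional `x_i ↦ ξ i`. -/
def rcon (ξ : Fin m → k) : Free k m →ₗ[k] Free k m where
  toFun a := rconMat ξ a 0 1
  map_add' a b := by simp
  map_smul' c a := by simp

theorem aug_ι (i : Fin m) : aug (FreeAlgebra.ι k i) = 0 := by
  simp [aug, FreeAlgebra.algebraMapInv]

/-- The triangular shape turns multiplicativity of `lconMat` into the twisted Leibniz rule
`lcon_mul`, without any choice of monomials. -/
theorem lconMat_apply (ξ : Fin m → k) (a : Free k m) :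
    lconMat ξ a = !![algebraMap k _ (aug a), lcon ξ a; 0, a] := by
  induction a using FreeAlgebra.induction with
  | grade0 r =>
    have h : aug (algebraMap k (Free k m) r) = r := by simp
    ext i j
    fin_cases i <;> fin_cases j <;> simp [lcon, Matrix.algebraMap_matrix_apply]
  | grade1 i =>
    ext a b
    fin_cases a <;> fin_cases b <;> simp [lcon, lconMat, aug_ι]
  | mul a b ha hb =>
    have hc : lcon ξ (a * b) = (lconMat ξ a * lconMat ξ b) 0 1 := by rw [← map_mul]; rfl
    rw [hc, map_mul, ha, hb]
    ext i j
    fin_cases i <;> fin_cases j <;> simp [Matrix.mul_apply, Fin.sum_univ_two]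
  | add a b ha hb =>
    rw [map_add, ha, hb]
    ext i j
    fin_cases i <;> fin_cases j <;> simp

theorem rconMat_apply (ξ : Fin m → k) (a : Free k m) :
    rconMat ξ a = !![a, rcon ξ a; 0, algebraMap k _ (aug a)] := by
  induction a using FreeAlgebra.induction with
  | grade0 r =>
    have h : aug (algebraMap k (Free k m) r) = r := by simp
    ext i j
    fin_cases i <;> fin_cases j <;> simp [rcon, Matrix.algebraMap_matrix_apply]
  | grade1 i =>
    ext a b
    fin_cases a <;> fin_cases b <;> simp [rcon, rconMat, aug_ι]
  | mul a b ha hb =>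
    have hc : rcon ξ (a * b) = (rconMat ξ a * rconMat ξ b) 0 1 := by rw [← map_mul]; rfl
    rw [hc, map_mul, ha, hb]
    ext i j
    fin_cases i <;> fin_cases j <;> simp [Matrix.mul_apply, Fin.sum_univ_two]
  | add a b ha hb =>
    rw [map_add, ha, hb]
    ext i j
    fin_cases i <;> fin_cases j <;> simp

theorem lcon_mul (ξ : Fin m → k) (a b : Free k m) :
    lcon ξ (a * b) = lcon ξ a * b + aug a • lcon ξ b := by
  have hc : lcon ξ (a * b) = (lconMat ξ a * lconMat ξ b) 0 1 := by rw [← map_mul]; rfl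
  rw [hc, lconMat_apply, lconMat_apply]
  simp [Matrix.mul_apply, Fin.sum_univ_two, Algebra.smul_def, add_comm]

theorem rcon_mul (ξ : Fin m → k) (a b : Free k m) :
    rcon ξ (a * b) = a * rcon ξ b + aug b • rcon ξ a := by
  have hc : rcon ξ (a * b) = (rconMat ξ a * rconMat ξ b) 0 1 := by rw [← map_mul]; rfl
  rw [hc, rconMat_apply, rconMat_apply]
  simp [Matrix.mul_apply, Fin.sum_univ_two, Algebra.smul_def, Algebra.commutes]

theorem lcon_ι (ξ : Fin m → k) (i : Fin m) :
    lcon ξ (FreeAlgebra.ι k i) = algebraMap k _ (ξ i) := by simp [lcon, lconMat]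

theorem rcon_ι (ξ : Fin m → k) (i : Fin m) :
    rcon ξ (FreeAlgebra.ι k i) = algebraMap k _ (ξ i) := by simp [rcon, rconMat]

theorem lcon_algebraMap (ξ : Fin m → k) (r : k) :
    lcon ξ (algebraMap k (Free k m) r) = 0 := by
  simp [lcon, Matrix.algebraMap_matrix_apply]

theorem rcon_algebraMap (ξ : Fin m → k) (r : k) :
    rcon ξ (algebraMap k (Free k m) r) = 0 := by
  simp [rcon, Matrix.algebraMap_matrix_apply]

theorem lcon_ι_mul (ξ : Fin m → k) (i : Fin m) (a : Free k m) :
    lcon ξ (FreeAlgebra.ι k i * a) = ξ i • a := by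
  rw [lcon_mul, lcon_ι, aug_ι, zero_smul, add_zero, Algebra.smul_def]

theorem rcon_mul_ι (ξ : Fin m → k) (i : Fin m) (a : Free k m) :
    rcon ξ (a * FreeAlgebra.ι k i) = ξ i • a := by
  rw [rcon_mul, rcon_ι, aug_ι, zero_smul, add_zero, Algebra.smul_def, Algebra.commutes]

/-- The coefficient of the letter `i` on the left. -/
abbrev lc (i : Fin m) : Free k m →ₗ[k] Free k m := lcon (Pi.single i 1)

/-- The coefficient of the letter `i` on the right. -/
abbrev rc (i : Fin m) : Free k m →ₗ[k] Free k m := rcon (Pi.single i 1)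

/-- The augmentation ideal is a free right module on the generators, and the `lc i` are its
coordinates. -/
theorem eq_sum_lc (a : Free k m) :
    a = algebraMap k _ (aug a) + ∑ i, FreeAlgebra.ι k i * lc i a := by
  induction a using FreeAlgebra.induction with
  | grade0 r =>
    have h : aug (algebraMap k (Free k m) r) = r := by simp
    simp [lc, lcon_algebraMap]
  | grade1 j =>
    simp [lc, lcon_ι, aug_ι, Pi.single_apply]
  | mul a b ha hb =>
    simp only [lc, lcon_mul, mul_add, Finset.sum_add_distrib, ← mul_assoc, ← Finset.sum_mul,
      mul_smul_comm, ← Finset.smul_sum, map_mul]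
    conv_lhs => rw [ha, add_mul]
    conv_lhs => lhs; rw [hb]
    simp only [Algebra.smul_def, mul_add]
    abel
  | add a b ha hb =>
    conv_lhs => rw [ha, hb]
    simp only [map_add, mul_add, Finset.sum_add_distrib]
    abel

theorem eq_sum_rc (a : Free k m) :
    a = algebraMap k _ (aug a) + ∑ i, rc i a * FreeAlgebra.ι k i := by
  induction a using FreeAlgebra.induction with
  | grade0 r =>
    have h : aug (algebraMap k (Free k m) r) = r := by simp
    simp [rc, rcon_algebraMap]
  | grade1 j =>
    simp [rc, rcon_ι, aug_ι, Pi.single_apply]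
  | mul a b ha hb =>
    simp only [rc, rcon_mul, add_mul, Finset.sum_add_distrib, mul_assoc, ← Finset.mul_sum,
      smul_mul_assoc, ← Finset.smul_sum, map_mul]
    conv_lhs => rw [hb, mul_add]
    conv_lhs => lhs; rw [ha]
    rw [add_mul]
    simp only [Algebra.smul_def]
    rw [Algebra.commutes (aug b) (∑ i, rc i a * FreeAlgebra.ι k i)]
    abel
  | add a b ha hb =>
    conv_lhs => rw [ha, hb]
    simp only [map_add, add_mul, Finset.sum_add_distrib]
    abel

theorem mono_zero (w : Fin 0 → Fin m) : mono k w = 1 := by simp [mono]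

theorem mono_succ {n : ℕ} (w : Fin (n + 1) → Fin m) :
    mono k w = FreeAlgebra.ι k (w 0) * mono k (fun i => w i.succ) := by
  simp [mono, List.ofFn_succ]

theorem mono_succ_last {n : ℕ} (w : Fin (n + 1) → Fin m) :
    mono k w = mono k (fun i => w i.castSucc) * FreeAlgebra.ι k (w (Fin.last n)) := by
  unfold mono
  rw [List.ofFn_succ', List.concat_eq_append, List.prod_append, List.prod_singleton]

theorem mono_mem {n : ℕ} (w : Fin n → Fin m) : mono k w ∈ homog k m n :=
  Submodule.subset_span ⟨w, rfl⟩

theorem homog_zero : homog k m 0 = Submodule.span k {1} := by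
  unfold homog
  congr 1
  ext a
  simp [mono_zero]

theorem ι_mem (i : Fin m) : FreeAlgebra.ι k i ∈ homog k m 1 := by
  simpa [mono] using mono_mem (k := k) (fun _ : Fin 1 => i)

theorem homog_one : homog k m 1 = Submodule.span k (Set.range (FreeAlgebra.ι k)) := by
  unfold homog
  congr 1
  ext a
  constructor
  · rintro ⟨w, rfl⟩; exact ⟨w 0, by simp [mono]⟩
  · rintro ⟨i, rfl⟩; exact ⟨fun _ => i, by simp [mono]⟩

theorem algebraMap_mem_homog (c : k) : algebraMap k (Free k m) c ∈ homog k m 0 := by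
  rw [homog_zero, Submodule.mem_span_singleton]
  exact ⟨c, by rw [Algebra.smul_def, mul_one]⟩

theorem one_mem_homog : (1 : Free k m) ∈ homog k m 0 := by
  simpa using algebraMap_mem_homog (1 : k)

theorem eq_algebraMap_of_mem_homog_zero {a : Free k m} (ha : a ∈ homog k m 0) :
    a = algebraMap k _ (aug a) := by
  rw [homog_zero, Submodule.mem_span_singleton] at ha
  obtain ⟨c, rfl⟩ := ha
  rw [Algebra.smul_def, mul_one, AlgHom.commutes]; rfl

theorem aug_eq_zero_of_mem {n : ℕ} (hn : n ≠ 0) {a : Free k m} (ha : a ∈ homog k m n) :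
    aug a = 0 := by
  have : homog k m n ≤ LinearMap.ker (aug (k := k) (m := m)).toLinearMap := by
    unfold homog
    rw [Submodule.span_le]
    rintro _ ⟨w, rfl⟩
    obtain ⟨n, rfl⟩ := Nat.exists_eq_succ_of_ne_zero hn
    change aug (mono k w) = 0
    rw [mono_succ, map_mul, aug_ι, zero_mul]
  exact this ha

theorem lcon_mem (ξ : Fin m → k) {n : ℕ} {a : Free k m} (ha : a ∈ homog k m (n + 1)) :
    lcon ξ a ∈ homog k m n := by
  have : homog k m (n + 1) ≤ (homog k m n).comap (lcon ξ) := by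
    conv_lhs => unfold homog
    rw [Submodule.span_le]
    rintro _ ⟨w, rfl⟩
    change lcon ξ (mono k w) ∈ homog k m n
    rw [mono_succ, lcon_ι_mul]
    exact Submodule.smul_mem _ _ (mono_mem _)
  exact this ha

theorem rcon_mem (ξ : Fin m → k) {n : ℕ} {a : Free k m} (ha : a ∈ homog k m (n + 1)) :
    rcon ξ a ∈ homog k m n := by
  have : homog k m (n + 1) ≤ (homog k m n).comap (rcon ξ) := by
    conv_lhs => unfold homog
    rw [Submodule.span_le]
    rintro _ ⟨w, rfl⟩
    change rcon ξ (mono k w) ∈ homog k m n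
    rw [mono_succ_last, rcon_mul_ι]
    exact Submodule.smul_mem _ _ (mono_mem _)
  exact this ha

theorem eq_sum_lc_of_mem {n : ℕ} {a : Free k m} (ha : a ∈ homog k m (n + 1)) :
    a = ∑ i, FreeAlgebra.ι k i * lc i a := by
  conv_lhs => rw [eq_sum_lc a, aug_eq_zero_of_mem n.succ_ne_zero ha, map_zero, zero_add]

theorem eq_sum_rc_of_mem {n : ℕ} {a : Free k m} (ha : a ∈ homog k m (n + 1)) :
    a = ∑ i, rc i a * FreeAlgebra.ι k i := by
  conv_lhs => rw [eq_sum_rc a, aug_eq_zero_of_mem n.succ_ne_zero ha, map_zero, zero_add]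

theorem homog_mul_homog (p q : ℕ) : homog k m p * homog k m q = homog k m (p + q) := by
  unfold homog
  rw [Submodule.span_mul_span]
  congr 1
  ext a
  constructor
  · rintro ⟨_, ⟨v, rfl⟩, _, ⟨w, rfl⟩, rfl⟩
    exact ⟨Fin.append v w, (mono_mul v w).symm⟩
  · rintro ⟨w, rfl⟩
    refine ⟨_, ⟨fun i => w (Fin.castAdd q i), rfl⟩, _, ⟨fun i => w (Fin.natAdd p i), rfl⟩, ?_⟩
    exact (mono_mul _ _).trans (by rw [Fin.append_castAdd_natAdd])

theorem homog_one_pow (n : ℕ) : homog k m 1 ^ n = homog k m n := by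
  induction n with
  | zero => rw [pow_zero, homog_zero, Submodule.one_eq_span]
  | succ n ih => rw [pow_succ, ih, homog_mul_homog]

instance (n : ℕ) : Module.Finite k (homog k m n) :=
  Module.Finite.span_of_finite k (Set.finite_range _)

section Functional

variable (φ : Free k m →ₗ[k] k)

/-- Left contraction along the restriction of a functional to the span of the generators. -/
abbrev lcf : Free k m →ₗ[k] Free k m := lcon fun i => φ (FreeAlgebra.ι k i)

/-- Right contraction along the restriction of a functional to the span of the generators. -/
abbrev rcf : Free k m →ₗ[k] Free k m := rcon fun i => φ (FreeAlgebra.ι k i)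

theorem lcf_mul {v : Free k m} (hv : v ∈ homog k m 1) (a : Free k m) :
    lcf φ (v * a) = φ v • a := by
  rw [homog_one] at hv
  induction hv using Submodule.span_induction with
  | mem _ h => obtain ⟨i, rfl⟩ := h; rw [lcon_ι_mul]
  | zero => simp
  | add x y _ _ hx hy => rw [add_mul, map_add, hx, hy, map_add, add_smul]
  | smul c x _ hx => rw [smul_mul_assoc, map_smul, hx, map_smul, smul_assoc]

theorem rcf_mul {v : Free k m} (hv : v ∈ homog k m 1) (a : Free k m) :
    rcf φ (a * v) = φ v • a := by
  rw [homog_one] at hv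
  induction hv using Submodule.span_induction with
  | mem _ h => obtain ⟨i, rfl⟩ := h; rw [rcon_mul_ι]
  | zero => simp
  | add x y _ _ hx hy => rw [mul_add, map_add, hx, hy, map_add, add_smul]
  | smul c x _ hx => rw [mul_smul_comm, map_smul, hx, map_smul, smul_assoc]

theorem lcf_mul_of_mem {n : ℕ} {a : Free k m} (ha : a ∈ homog k m (n + 1)) (b : Free k m) :
    lcf φ (a * b) = lcf φ a * b := by
  rw [lcon_mul, aug_eq_zero_of_mem n.succ_ne_zero ha, zero_smul, add_zero]

theorem rcf_mul_of_mem {n : ℕ} {b : Free k m} (hb : b ∈ homog k m (n + 1)) (a : Free k m) :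
    rcf φ (a * b) = a * rcf φ b := by
  rw [rcon_mul, aug_eq_zero_of_mem n.succ_ne_zero hb, zero_smul, add_zero]

end Functional

/-- A linearly independent finite family has a dual family of functionals. -/
theorem exists_dual_family {E : Type*} [AddCommGroup E] [Module k E] {ι : Type*} [DecidableEq ι]
    {v : ι → E} (hv : LinearIndependent k v) :
    ∃ φ : ι → E →ₗ[k] k, ∀ i j, φ i (v j) = if i = j then 1 else 0 := by
  classical
  choose φ hφ using fun i => LinearMap.exists_extend ((Finsupp.lapply i).comp hv.repr)
  refine ⟨φ, fun i j => ?_⟩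
  have h1 := LinearMap.congr_fun (hφ i) ⟨v j, Submodule.subset_span ⟨j, rfl⟩⟩
  rw [LinearMap.comp_apply, Submodule.subtype_apply] at h1
  rw [h1, LinearMap.comp_apply, hv.repr_eq_single j _ rfl, Finsupp.lapply_apply,
    Finsupp.single_apply]
  simp [eq_comm]

/-- Left contraction of elements of degree `p` along a functional. -/
def wcon : ℕ → (Free k m →ₗ[k] k) → (Free k m →ₗ[k] Free k m)
  | 0, φ => φ 1 • LinearMap.id
  | p + 1, φ => ∑ i, (wcon p (φ.comp (LinearMap.mulLeft k (FreeAlgebra.ι k i)))).comp (lc i)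

theorem wcon_mul {p : ℕ} (φ : Free k m →ₗ[k] k) {a : Free k m} (ha : a ∈ homog k m p)
    (b : Free k m) : wcon p φ (a * b) = φ a • b := by
  have key : ∀ (w : Fin p → Fin m), wcon p φ (mono k w * b) = φ (mono k w) • b := by
    clear ha
    induction p generalizing φ with
    | zero => intro w; simp [wcon, mono_zero]
    | succ p ih =>
      intro w
      rw [mono_succ, wcon, LinearMap.sum_apply, Finset.sum_eq_single (w 0)]
      · rw [LinearMap.comp_apply, mul_assoc, lcon_ι_mul, Pi.single_eq_same, one_smul, ih]; rfl
      · intro i _ hi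
        rw [LinearMap.comp_apply, mul_assoc, lcon_ι_mul, Pi.single_eq_of_ne hi.symm, zero_smul,
          map_zero]
      · simp
  unfold homog at ha
  induction ha using Submodule.span_induction with
  | mem _ h => obtain ⟨w, rfl⟩ := h; exact key w
  | zero => simp
  | add x y _ _ hx hy => rw [add_mul, map_add, hx, hy, map_add, add_smul]
  | smul c x _ hx => rw [smul_mul_assoc, map_smul, hx, map_smul, smul_assoc]

/-- Linear independence over the field of elements of one degree upgrades to right independence over
the free algebra: contraction along a dual family reads off each coefficient. -/
theorem eq_zero_of_sum_mul_eq_zero {p r : ℕ} {b : Fin r → Free k m} (hb : LinearIndependent k b)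
    (hbp : ∀ i, b i ∈ homog k m p) {t : Fin r → Free k m} (h : ∑ i, b i * t i = 0) (i : Fin r) :
    t i = 0 := by
  obtain ⟨φ, hφ⟩ := exists_dual_family hb
  have := congrArg (wcon p (φ i)) h
  rw [map_sum, map_zero] at this
  simpa [wcon_mul _ (hbp _), hφ] using this

theorem mem_of_sum_mul_mem {p r : ℕ} {b : Fin r → Free k m} (hb : LinearIndependent k b)
    (hbp : ∀ i, b i ∈ homog k m p) {N : Submodule k (Free k m)} {t : Fin r → Free k m}
    (h : ∑ i, b i * t i ∈ homog k m p * N) (i : Fin r) : t i ∈ N := by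
  obtain ⟨φ, hφ⟩ := exists_dual_family hb
  have h1 : homog k m p * N ≤ N.comap (wcon p (φ i)) := by
    rw [Submodule.mul_le]
    intro a ha n hn
    rw [Submodule.mem_comap, wcon_mul _ ha]
    exact N.smul_mem _ hn
  have := h1 h
  rw [Submodule.mem_comap, map_sum] at this
  simpa [wcon_mul _ (hbp _), hφ] using this

theorem exists_sum_of_mem_span_mul {r : ℕ} {b : Fin r → Free k m} {N : Submodule k (Free k m)}
    {a : Free k m} (ha : a ∈ Submodule.span k (Set.range b) * N) :
    ∃ t : Fin r → Free k m, (∀ i, t i ∈ N) ∧ a = ∑ i, b i * t i := by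
  induction ha using Submodule.mul_induction_on' with
  | mem_mul_mem x hx n hn =>
    obtain ⟨c, rfl⟩ := (Submodule.mem_span_range_iff_exists_fun k).1 hx
    refine ⟨fun i => c i • n, fun i => N.smul_mem _ hn, ?_⟩
    simp [Finset.sum_mul]
  | add x _ y _ hx hy =>
    obtain ⟨t, ht, rfl⟩ := hx
    obtain ⟨t', ht', rfl⟩ := hy
    exact ⟨fun i => t i + t' i, fun i => N.add_mem (ht i) (ht' i), by
      simp [mul_add, Finset.sum_add_distrib]⟩

end Contraction

/-! ### The monomial pairing -/

section Pairing

variable {k : Type u} [Field k] {m : ℕ}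

/-- `pair` as a bilinear map. -/
def pairB : Free k m →ₗ[k] Free k m →ₗ[k] k :=
  LinearMap.mk₂ k pair
    (fun a b f => by
      unfold pair
      rw [map_add]
      exact Finsupp.sum_add_index' (by simp) (by intros; ring))
    (fun c a f => by
      unfold pair
      rw [map_smul, Finsupp.sum_smul_index (by simp), smul_eq_mul, Finsupp.mul_sum]
      exact Finsupp.sum_congr fun _ _ => by ring)
    (fun a f g => by
      unfold pair
      rw [map_add, ← Finsupp.sum_add]
      exact Finsupp.sum_congr fun _ _ => by rw [Finsupp.add_apply]; ring)
    (fun c a f => by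
      unfold pair
      rw [map_smul, smul_eq_mul, Finsupp.mul_sum]
      exact Finsupp.sum_congr fun _ _ => by rw [Finsupp.smul_apply, smul_eq_mul]; ring)

theorem pairB_apply (g f : Free k m) : pairB g f = pair g f := rfl

/-- The monomial given by a list of letters. -/
def lmono (l : List (Fin m)) : Free k m := (l.map (FreeAlgebra.ι k)).prod

theorem basisFreeMonoid_apply (l : FreeMonoid (Fin m)) :
    FreeAlgebra.basisFreeMonoid k (Fin m) l = lmono l.toList := by
  have : FreeAlgebra.basisFreeMonoid k (Fin m) l =
      FreeAlgebra.equivMonoidAlgebraFreeMonoid.symm (MonoidAlgebra.single l 1) := by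
    simp [FreeAlgebra.basisFreeMonoid, MonoidAlgebra.coeffLinearEquiv]
  rw [this, AlgEquiv.symm_apply_eq]
  unfold lmono
  rw [map_list_prod, List.map_map]
  clear this
  induction l using FreeMonoid.recOn with
  | one => simp [MonoidAlgebra.one_def]
  | of_mul x xs ih =>
    rw [FreeMonoid.toList_mul, List.map_append, List.prod_append, ← ih]
    simp [FreeAlgebra.equivMonoidAlgebraFreeMonoid, MonoidAlgebra.single_mul_single]

theorem pair_lmono (l l' : List (Fin m)) :
    pair (lmono l : Free k m) (lmono l') = if l = l' then 1 else 0 := by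
  have h := basisFreeMonoid_apply (k := k) (FreeMonoid.ofList l)
  have h' := basisFreeMonoid_apply (k := k) (FreeMonoid.ofList l')
  rw [FreeMonoid.toList_ofList] at h h'
  classical
  unfold pair
  rw [← h, ← h', Module.Basis.repr_self, Module.Basis.repr_self,
    Finsupp.sum_single_index (by simp), one_mul, Finsupp.single_apply]
  simp [eq_comm]

theorem mono_eq_lmono {n : ℕ} (w : Fin n → Fin m) : mono k w = lmono (List.ofFn w) := by
  simp [mono, lmono, Function.comp_def]

theorem span_lmono : Submodule.span k (Set.range (lmono : List (Fin m) → Free k m)) = ⊤ := by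
  rw [eq_top_iff, ← (FreeAlgebra.basisFreeMonoid k (Fin m)).span_eq, Submodule.span_le]
  rintro _ ⟨l, rfl⟩
  rw [basisFreeMonoid_apply]
  exact Submodule.subset_span ⟨_, rfl⟩

theorem linearMap_ext_lmono {E : Type*} [AddCommGroup E] [Module k E] {f g : Free k m →ₗ[k] E}
    (h : ∀ l, f (lmono l) = g (lmono l)) : f = g :=
  LinearMap.ext_on_range span_lmono h

/-- Adjointness of multiplication by a letter and contraction; it moves ideals of the dual algebra
to contraction-stable families of subspaces. -/
theorem pair_ι_mul (i : Fin m) (g f : Free k m) :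
    pair (FreeAlgebra.ι k i * g) f = pair g (lc i f) := by
  have : pairB.comp (LinearMap.mulLeft k (FreeAlgebra.ι k i)) = (pairB (k := k)).compl₂ (lc i) := by
    refine linearMap_ext_lmono fun l => linearMap_ext_lmono fun l' => ?_
    change pair (lmono (i :: l)) (lmono l') = pair (lmono l) (lc i (lmono l'))
    rw [pair_lmono]
    cases l' with
    | nil =>
      have : lc i (lmono [] : Free k m) = 0 := by simpa [lmono] using lcon_algebraMap _ (1 : k)
      rw [this, ← pairB_apply, map_zero]; simp
    | cons j l' =>
      have : lc i (lmono (j :: l') : Free k m) = (Pi.single i 1 : Fin m → k) j • lmono l' :=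
        lcon_ι_mul _ _ _
      rw [this, ← pairB_apply, map_smul, pairB_apply, pair_lmono]
      by_cases hij : i = j <;> simp [hij, eq_comm]
  exact LinearMap.congr_fun (LinearMap.congr_fun this g) f

theorem pair_mul_ι (i : Fin m) (g f : Free k m) :
    pair (g * FreeAlgebra.ι k i) f = pair g (rc i f) := by
  have : pairB.comp (LinearMap.mulRight k (FreeAlgebra.ι k i)) =
      (pairB (k := k)).compl₂ (rc i) := by
    refine linearMap_ext_lmono fun l => linearMap_ext_lmono fun l' => ?_
    have hl : (lmono l * FreeAlgebra.ι k i : Free k m) = lmono (l ++ [i]) := by simp [lmono]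
    change pair (lmono l * FreeAlgebra.ι k i) (lmono l') = pair (lmono l) (rc i (lmono l'))
    rw [hl, pair_lmono]
    induction l' using List.reverseRecOn with
    | nil =>
      have : rc i (lmono [] : Free k m) = 0 := by simpa [lmono] using rcon_algebraMap _ (1 : k)
      rw [this, ← pairB_apply, map_zero]; simp
    | append_singleton l' j =>
      have hl' : (lmono (l' ++ [j]) : Free k m) = lmono l' * FreeAlgebra.ι k j := by simp [lmono]
      rw [hl', rcon_mul_ι, ← pairB_apply, map_smul, pairB_apply, pair_lmono]
      by_cases hij : i = j <;> simp [hij, eq_comm]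
  exact LinearMap.congr_fun (LinearMap.congr_fun this g) f

theorem pair_mono {n : ℕ} (u w : Fin n → Fin m) :
    pair (mono k u) (mono k w) = if u = w then 1 else 0 := by
  rw [mono_eq_lmono, mono_eq_lmono, pair_lmono]
  simp [List.ofFn_inj]

theorem pair_eq_zero {p q : ℕ} (h : p ≠ q) {g f : Free k m} (hg : g ∈ homog k m p)
    (hf : f ∈ homog k m q) : pair g f = 0 := by
  have h1 : homog k m p ≤ LinearMap.ker ((pairB (k := k) (m := m)).flip f) := by
    unfold homog
    rw [Submodule.span_le]
    rintro _ ⟨u, rfl⟩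
    have h2 : homog k m q ≤ LinearMap.ker (pairB (mono k u)) := by
      unfold homog
      rw [Submodule.span_le]
      rintro _ ⟨w, rfl⟩
      change pair (mono k u) (mono k w) = 0
      rw [mono_eq_lmono, mono_eq_lmono, pair_lmono, if_neg]
      intro h3
      exact h (by simpa using congrArg List.length h3)
    exact h2 hf
  exact h1 hg

theorem eq_sum_pair {n : ℕ} {f : Free k m} (hf : f ∈ homog k m n) :
    f = ∑ w : Fin n → Fin m, pair (mono k w) f • mono k w := by
  have : homog k m n ≤ LinearMap.eqLocus LinearMap.id
      (∑ w : Fin n → Fin m, (pairB (mono k w)).smulRight (mono k w)) := by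
    conv_lhs => unfold homog
    rw [Submodule.span_le]
    rintro _ ⟨u, rfl⟩
    change mono k u = _
    simp [pairB_apply, pair_mono, LinearMap.sum_apply]
  simpa [LinearMap.sum_apply, pairB_apply] using this hf

theorem eqOn_homog {E : Type*} [AddCommGroup E] [Module k E] {n : ℕ} {F G : Free k m →ₗ[k] E}
    (h : ∀ w : Fin n → Fin m, F (mono k w) = G (mono k w)) {a : Free k m}
    (ha : a ∈ homog k m n) : F a = G a :=
  LinearMap.eqOn_span (s := Set.range fun w : Fin n → Fin m => mono k w)
    (by rintro _ ⟨w, rfl⟩; exact h w) ha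

theorem pair_mul {p q : ℕ} {g b h t : Free k m} (hg : g ∈ homog k m p) (hb : b ∈ homog k m p)
    (hh : h ∈ homog k m q) (ht : t ∈ homog k m q) :
    pair (g * h) (b * t) = pair g b * pair h t := by
  have key : ∀ (v v' : Fin p → Fin m) (w w' : Fin q → Fin m),
      pair (mono k v * mono k w) (mono k v' * mono k w') =
        pair (mono k v) (mono k v') * pair (mono k w) (mono k w') := by
    intro v v' w w'
    rw [mono_mul, mono_mul, pair_mono, pair_mono, pair_mono]
    by_cases hv : v = v'
    · by_cases hw : w = w'
      · simp [hv, hw]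
      · rw [if_neg, if_neg hw, mul_zero]
        intro h
        exact hw (funext fun i => by simpa using congrFun h (Fin.natAdd p i))
    · rw [if_neg, if_neg hv, zero_mul]
      intro h
      exact hv (funext fun i => by simpa using congrFun h (Fin.castAdd q i))
  have h1 : ∀ (v v' : Fin p → Fin m) (w : Fin q → Fin m),
      pair (mono k v * mono k w) (mono k v' * t) =
        pair (mono k v) (mono k v') * pair (mono k w) t := fun v v' w =>
    eqOn_homog (F := (pairB (mono k v * mono k w)).comp (LinearMap.mulLeft k (mono k v')))
      (G := pair (mono k v) (mono k v') • pairB (mono k w)) (fun w' => key v v' w w') ht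
  have h2 : ∀ (v v' : Fin p → Fin m), pair (mono k v * h) (mono k v' * t) =
        pair (mono k v) (mono k v') * pair h t := fun v v' =>
    eqOn_homog (F := (pairB.flip (mono k v' * t)).comp (LinearMap.mulLeft k (mono k v)))
      (G := pair (mono k v) (mono k v') • pairB.flip t) (fun w => h1 v v' w) hh
  have h3 : ∀ (v : Fin p → Fin m), pair (mono k v * h) (b * t) =
        pair (mono k v) b * pair h t := fun v =>
    eqOn_homog (F := (pairB (mono k v * h)).comp (LinearMap.mulRight k t))
      (G := (pairB (mono k v)).smulRight (pair h t)) (fun v' => h2 v v') hb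
  exact eqOn_homog (F := (pairB.flip (b * t)).comp (LinearMap.mulRight k h))
      (G := (pairB.flip b).smulRight (pair h t)) (fun v => h3 v) hg

theorem exists_pair_eq (φ : Free k m →ₗ[k] k) (n : ℕ) :
    ∃ g ∈ homog k m n, ∀ f ∈ homog k m n, pair g f = φ f := by
  refine ⟨∑ w : Fin n → Fin m, φ (mono k w) • mono k w,
    Submodule.sum_mem _ fun w _ => Submodule.smul_mem _ _ (mono_mem w), fun f hf => ?_⟩
  conv_rhs => rw [eq_sum_pair hf]
  simp only [← pairB_apply, map_sum, LinearMap.sum_apply, map_smul, LinearMap.smul_apply,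
    smul_eq_mul, mul_comm]

/-- The pairing is perfect in each degree, so a subspace equals its double annihilator. -/
theorem mem_of_forall_pair_eq_zero {n : ℕ} {N : Submodule k (Free k m)} (hN : N ≤ homog k m n)
    {f : Free k m} (hf : f ∈ homog k m n)
    (h : ∀ g ∈ homog k m n, (∀ f' ∈ N, pair g f' = 0) → pair g f = 0) : f ∈ N := by
  by_contra hfN
  obtain ⟨φ, hφ, hN'⟩ := Submodule.exists_le_ker_of_notMem hfN
  obtain ⟨g, hg, hgφ⟩ := exists_pair_eq φ n
  refine hφ ?_
  rw [← hgφ f hf]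
  exact h g hg fun f' hf' => by rw [hgφ f' (hN hf')]; exact hN' hf'

end Pairing

end HomogAlg

end

noncomputable section

namespace HomogAlg

/-! ### Quotients of the free algebra -/

section QuotientAlgebra

variable {k : Type u} [Field k] {m : ℕ} (R : Submodule k (Free k m))

theorem proj_surjective : Function.Surjective (proj R) :=
  RingCon.mkₐ_surjective (α := k) _

variable {R}

theorem proj_eq_zero_iff {a : Free k m} :
    proj R a = 0 ↔ a ∈ TwoSidedIdeal.span (R : Set (Free k m)) := by
  rw [← map_zero (proj R)]
  exact (RingCon.eq _).trans (TwoSidedIdeal.mem_iff _ _).symm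

theorem proj_eq_zero_of_mem {a : Free k m} (ha : a ∈ R) : proj R a = 0 :=
  proj_eq_zero_iff.2 (TwoSidedIdeal.subset_span ha)

/-- The algebra map out of `k⟨x₁, …, x_m⟩/(R)` induced by an algebra map vanishing on `R`. -/
def liftQ {B : Type*} [Ring B] [Algebra k B] (F : Free k m →ₐ[k] B) (h : ∀ f ∈ R, F f = 0) :
    QuotAlg R →ₐ[k] B :=
  RingCon.liftₐ _ F (by
    have h1 : TwoSidedIdeal.span (R : Set (Free k m)) ≤ TwoSidedIdeal.ker F.toRingHom :=
      TwoSidedIdeal.span_le.2 fun f hf => (TwoSidedIdeal.mem_ker _).2 (h f hf)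
    intro x y hxy
    rw [TwoSidedIdeal.rel_iff] at hxy
    have := (TwoSidedIdeal.mem_ker _).1 (h1 hxy)
    rw [map_sub, sub_eq_zero] at this
    exact this)

theorem liftQ_proj {B : Type*} [Ring B] [Algebra k B] (F : Free k m →ₐ[k] B)
    (h : ∀ f ∈ R, F f = 0) (a : Free k m) : liftQ F h (proj R a) = F a := rfl

theorem proj_mem_comp {n : ℕ} {a : Free k m} (ha : a ∈ homog k m n) : proj R a ∈ comp R n :=
  ⟨a, ha, rfl⟩

instance (n : ℕ) : Module.Finite k (comp R n) := by unfold comp; infer_instance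

end QuotientAlgebra

/-! ### The grading of the quotient -/

section Grading

variable {k : Type u} [Field k] {m s : ℕ} {R : Submodule k (Free k m)}

/-- The algebra map multiplying each generator by the variable of a polynomial ring. -/
def degHom (R : Submodule k (Free k m)) : Free k m →ₐ[k] Polynomial (QuotAlg R) :=
  FreeAlgebra.lift k fun i => Polynomial.C (proj R (FreeAlgebra.ι k i)) * Polynomial.X

theorem degHom_mono {n : ℕ} (w : Fin n → Fin m) :
    degHom R (mono k w) = Polynomial.C (proj R (mono k w)) * Polynomial.X ^ n := by
  induction n with
  | zero => simp [mono_zero]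
  | succ n ih =>
    rw [mono_succ, map_mul, ih, map_mul, map_mul, degHom, FreeAlgebra.lift_ι_apply, pow_succ',
      mul_assoc, mul_assoc]
    congr 1
    rw [← mul_assoc, ← mul_assoc, Polynomial.X_mul_C]

theorem degHom_of_mem {n : ℕ} {a : Free k m} (ha : a ∈ homog k m n) :
    degHom R a = Polynomial.monomial n (proj R a) := by
  let G : Free k m →ₗ[k] Polynomial (QuotAlg R) :=
    { toFun := fun a => Polynomial.monomial n (proj R a)
      map_add' := fun a b => by rw [map_add, map_add]
      map_smul' := fun c a => by rw [map_smul, RingHom.id_apply, Polynomial.smul_monomial] }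
  refine eqOn_homog (F := (degHom R).toLinearMap) (G := G) (fun w => ?_) ha
  exact (degHom_mono w).trans (Polynomial.C_mul_X_pow_eq_monomial)

/-- The map sending a homogeneous element `a` of degree `n` to `a tⁿ`. -/
def grHom (hR : R ≤ homog k m s) : QuotAlg R →ₐ[k] Polynomial (QuotAlg R) :=
  liftQ (degHom R) fun f hf => by
    -- Since the relations are homogeneous, substituting a scaled generator only multiplies them by
    -- a power of the variable, so they still vanish.
    rw [degHom_of_mem (hR hf), proj_eq_zero_of_mem hf, map_zero]

/-- The homogeneous component of degree `j`. -/
def hz (hR : R ≤ homog k m s) (j : ℤ) : QuotAlg R →ₗ[k] QuotAlg R where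
  toFun a := if 0 ≤ j then (grHom hR a).coeff j.toNat else 0
  map_add' a b := by split_ifs <;> simp
  map_smul' c a := by split_ifs <;> simp

/-- The homogeneous components, indexed by the integers. -/
def cz (R : Submodule k (Free k m)) (j : ℤ) : Submodule k (QuotAlg R) :=
  -- Zero in negative degrees, so that shifts by `chi s i` need no truncated subtraction.
  if 0 ≤ j then comp R j.toNat else ⊥

theorem cz_natCast (n : ℕ) : cz R (n : ℤ) = comp R n := by simp [cz]

theorem cz_of_neg {j : ℤ} (hj : j < 0) : cz R j = ⊥ := by simp [cz, hj]

theorem cz_zero : cz R 0 = comp R 0 := cz_natCast 0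

instance (j : ℤ) : Module.Finite k (cz R j) := by
  by_cases hj : 0 ≤ j
  · lift j to ℕ using hj
    rw [cz_natCast]; infer_instance
  · rw [cz_of_neg (by omega)]; infer_instance

theorem proj_mem_cz {n : ℕ} {a : Free k m} (ha : a ∈ homog k m n) : proj R a ∈ cz R n := by
  rw [cz_natCast]; exact proj_mem_comp ha

theorem hz_proj (hR : R ≤ homog k m s) {n : ℕ} {a : Free k m} (ha : a ∈ homog k m n) (j : ℤ) :
    hz hR j (proj R a) = if (n : ℤ) = j then proj R a else 0 := by
  change (if 0 ≤ j then (degHom R a).coeff j.toNat else 0) = _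
  rw [degHom_of_mem ha, Polynomial.coeff_monomial]
  by_cases hj : 0 ≤ j
  · lift j to ℕ using hj
    simp
  · rw [if_neg hj, if_neg]
    omega

theorem hz_of_mem (hR : R ≤ homog k m s) {i : ℤ} {a : QuotAlg R} (ha : a ∈ cz R i) (j : ℤ) :
    hz hR j a = if i = j then a else 0 := by
  by_cases hi : 0 ≤ i
  · lift i to ℕ using hi
    rw [cz_natCast] at ha
    obtain ⟨a, ha, rfl⟩ := ha
    exact hz_proj hR ha j
  · rw [cz_of_neg (by omega), Submodule.mem_bot] at ha
    simp [ha]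

theorem hz_of_mem_self (hR : R ≤ homog k m s) {i : ℤ} {a : QuotAlg R} (ha : a ∈ cz R i) :
    hz hR i a = a := by rw [hz_of_mem hR ha, if_pos rfl]

theorem mul_mem_cz {i j : ℤ} {a b : QuotAlg R} (ha : a ∈ cz R i) (hb : b ∈ cz R j) :
    a * b ∈ cz R (i + j) := by
  by_cases hi : 0 ≤ i
  · by_cases hj : 0 ≤ j
    · lift i to ℕ using hi
      lift j to ℕ using hj
      rw [cz_natCast] at ha hb
      rw [← Nat.cast_add, cz_natCast]
      exact comp_mul R ha hb
    · rw [cz_of_neg (by omega), Submodule.mem_bot] at hb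
      rw [hb, mul_zero]; exact zero_mem _
  · rw [cz_of_neg (by omega), Submodule.mem_bot] at ha
    rw [ha, zero_mul]; exact zero_mem _

/-- Every element is a sum of homogeneous elements. -/
theorem span_comp : ⨆ n, comp R n = ⊤ := by
  rw [eq_top_iff]
  rintro a -
  obtain ⟨a, rfl⟩ := proj_surjective R a
  have h : (⊤ : Submodule k (Free k m)) ≤ (⨆ n, comp R n).comap (proj R).toLinearMap := by
    rw [← span_lmono, Submodule.span_le]
    rintro _ ⟨l, rfl⟩
    have : (lmono l : Free k m) = mono k l.get := by rw [mono_eq_lmono, List.ofFn_get]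
    rw [this]
    exact Submodule.mem_iSup_of_mem l.length (proj_mono_mem R _)
  exact h trivial

theorem homogeneous_induction {p : QuotAlg R → Prop} (a : QuotAlg R)
    (mem : ∀ (n : ℕ) (x : QuotAlg R), x ∈ comp R n → p x) (zero : p 0)
    (add : ∀ x y, p x → p y → p (x + y)) : p a := by
  have ha : a ∈ ⨆ n, comp R n := by rw [span_comp]; trivial
  exact Submodule.iSup_induction _ (motive := p) ha mem zero add

theorem hz_mem (hR : R ≤ homog k m s) (j : ℤ) (a : QuotAlg R) : hz hR j a ∈ cz R j := by
  induction a using homogeneous_induction with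
  | mem n x hx =>
    rw [← cz_natCast] at hx
    rw [hz_of_mem hR hx]
    split_ifs with h
    · exact h ▸ hx
    · exact zero_mem _
  | zero => rw [map_zero]; exact zero_mem _
  | add x y hx hy => rw [map_add]; exact add_mem hx hy

/-- Stated for all larger index sets so that the finitely many coordinates of a vector can share
one. -/
theorem exists_hz_sum (hR : R ≤ homog k m s) (a : QuotAlg R) :
    ∃ S : Finset ℤ, ∀ S' : Finset ℤ, S ⊆ S' →
      (∀ j ∉ S, hz hR j a = 0) ∧ ∑ j ∈ S', hz hR j a = a := by
  induction a using homogeneous_induction with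
  | mem n x hx =>
    rw [← cz_natCast] at hx
    refine ⟨{(n : ℤ)}, fun S' hS' => ⟨fun j hj => ?_, ?_⟩⟩
    · rw [hz_of_mem hR hx, if_neg]; simpa [eq_comm] using hj
    · simp_rw [hz_of_mem hR hx]
      rw [Finset.sum_ite_eq, if_pos (hS' (Finset.mem_singleton_self _))]
  | zero => exact ⟨∅, fun S' _ => by simp⟩
  | add x y hx hy =>
    obtain ⟨S, hS⟩ := hx
    obtain ⟨S', hS'⟩ := hy
    refine ⟨S ∪ S', fun S'' h => ⟨fun j hj => ?_, ?_⟩⟩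
    · rw [Finset.mem_union, not_or] at hj
      rw [map_add, (hS S subset_rfl).1 j hj.1, (hS' S' subset_rfl).1 j hj.2, add_zero]
    · simp_rw [map_add]
      rw [Finset.sum_add_distrib, (hS S'' (Finset.union_subset_left h)).2,
        (hS' S'' (Finset.union_subset_right h)).2]

theorem hz_mul_left (hR : R ≤ homog k m s) {i : ℤ} {h : QuotAlg R} (hh : h ∈ cz R i) (j : ℤ)
    (a : QuotAlg R) : hz hR j (h * a) = h * hz hR (j - i) a := by
  induction a using homogeneous_induction with
  | mem n x hx =>
    rw [← cz_natCast] at hx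
    rw [hz_of_mem hR (mul_mem_cz hh hx), hz_of_mem hR hx]
    by_cases hn : i + n = j
    · rw [if_pos hn, if_pos (by omega)]
    · rw [if_neg hn, if_neg (by omega), mul_zero]
  | zero => simp
  | add x y hx hy => rw [mul_add, map_add, hx, hy, map_add, mul_add]

theorem hz_mul_right (hR : R ≤ homog k m s) {i : ℤ} {h : QuotAlg R} (hh : h ∈ cz R i) (j : ℤ)
    (a : QuotAlg R) : hz hR j (a * h) = hz hR (j - i) a * h := by
  induction a using homogeneous_induction with
  | mem n x hx =>
    rw [← cz_natCast] at hx
    rw [hz_of_mem hR (mul_mem_cz hx hh), hz_of_mem hR hx]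
    by_cases hn : n + i = j
    · rw [if_pos hn, if_pos (by omega)]
    · rw [if_neg hn, if_neg (by omega), zero_mul]
  | zero => simp
  | add x y hx hy => rw [add_mul, map_add, hx, hy, map_add, add_mul]

theorem exists_algebraMap_of_mem_cz_zero {a : QuotAlg R} (ha : a ∈ cz R 0) :
    ∃ c : k, a = algebraMap k _ c := by
  rw [cz_zero] at ha
  obtain ⟨a, ha, rfl⟩ := ha
  exact ⟨aug a, by
    conv_lhs => rw [eq_algebraMap_of_mem_homog_zero ha]
    exact (proj R).commutes _⟩

theorem algebraMap_mem_cz (c : k) : algebraMap k (QuotAlg R) c ∈ cz R 0 := by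
  rw [cz_zero]
  exact ⟨algebraMap k _ c, algebraMap_mem_homog c, (proj R).commutes c⟩

theorem one_mem_cz : (1 : QuotAlg R) ∈ cz R 0 := by simpa using algebraMap_mem_cz (R := R) 1

/-- The augmentation of `k⟨x₁, …, x_m⟩/(R)`. -/
def augQ (hs : s ≠ 0) (hR : R ≤ homog k m s) : QuotAlg R →ₐ[k] k :=
  liftQ aug fun _ hf => aug_eq_zero_of_mem hs (hR hf)

theorem augQ_of_mem (hs : s ≠ 0) (hR : R ≤ homog k m s) {j : ℤ} (hj : j ≠ 0) {a : QuotAlg R}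
    (ha : a ∈ cz R j) : augQ hs hR a = 0 := by
  by_cases h : 0 ≤ j
  · lift j to ℕ using h
    rw [cz_natCast] at ha
    obtain ⟨a, ha, rfl⟩ := ha
    exact (liftQ_proj _ _ _).trans (aug_eq_zero_of_mem (by exact_mod_cast hj) ha)
  · rw [cz_of_neg (by omega), Submodule.mem_bot] at ha
    rw [ha, map_zero]

end Grading

/-! ### The presentation as the start of the resolution -/

section Presentation

variable {k : Type u} [Field k] {m s r : ℕ} {R : Submodule k (Free k m)} {f : Fin r → Free k m}

/-- The kernel of the first differential of the minimal resolution. -/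
theorem exists_of_proj_eq_zero (hs : s ≠ 0) (hf : ∀ j, f j ∈ homog k m s)
    (hR : R = Submodule.span k (Set.range f)) {a : Free k m} (ha : proj R a = 0) :
    aug a = 0 ∧ ∃ c : Fin r → QuotAlg R, ∀ i, proj R (lc i a) = ∑ j, proj R (lc i (f j)) * c j := by
  rw [proj_eq_zero_iff] at ha
  induction ha using TwoSidedIdeal.span_induction with
  | mem x hx =>
    rw [SetLike.mem_coe, hR, Submodule.mem_span_range_iff_exists_fun] at hx
    obtain ⟨c, rfl⟩ := hx
    refine ⟨?_, fun j => algebraMap k _ (c j), fun i => ?_⟩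
    · rw [map_sum]
      exact Finset.sum_eq_zero fun j _ => by rw [map_smul, aug_eq_zero_of_mem hs (hf j), smul_zero]
    · rw [map_sum, map_sum]
      refine Finset.sum_congr rfl fun j _ => ?_
      rw [map_smul, map_smul, Algebra.smul_def, Algebra.commutes]
  | zero => exact ⟨map_zero _, 0, by simp⟩
  | add x y _ _ hx hy =>
    obtain ⟨hx, c, hc⟩ := hx
    obtain ⟨hy, d, hd⟩ := hy
    refine ⟨by rw [map_add, hx, hy, add_zero], c + d, fun i => ?_⟩
    rw [map_add, map_add, hc, hd]
    simp [mul_add, Finset.sum_add_distrib]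
  | neg x _ hx =>
    obtain ⟨hx, c, hc⟩ := hx
    refine ⟨by rw [map_neg, hx, neg_zero], -c, fun i => ?_⟩
    rw [map_neg, map_neg, hc]
    simp
  | left_absorb b x hx' hx =>
    obtain ⟨hx, c, hc⟩ := hx
    refine ⟨by rw [map_mul, hx, mul_zero], fun j => aug b • c j, fun i => ?_⟩
    -- The Leibniz term containing `x` itself dies in the quotient; only a scalar multiple of the
    -- coefficients of `x` is left.
    rw [lcon_mul, map_add, map_mul, proj_eq_zero_iff.2 hx', mul_zero, zero_add, map_smul, hc,
      Finset.smul_sum]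
    simp
  | right_absorb b x _ hx =>
    obtain ⟨hx, c, hc⟩ := hx
    refine ⟨by rw [map_mul, hx, zero_mul], fun j => c j * proj R b, fun i => ?_⟩
    rw [lcon_mul, hx, zero_smul, add_zero, map_mul, hc, Finset.sum_mul]
    simp [mul_assoc]

theorem lc_sum_ι_mul (t : Fin m → Free k m) (i : Fin m) :
    lc i (∑ l, FreeAlgebra.ι k l * t l) = t i := by
  rw [map_sum, Finset.sum_eq_single i]
  · rw [lcon_ι_mul]; simp
  · intro l _ hl
    rw [lcon_ι_mul, Pi.single_eq_of_ne hl, zero_smul]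
  · simp

/-- Exactness at K_1: a syzygy of the generators lifts to an element of the ideal, whose left
coefficients are combinations of those of the relations. -/
theorem exists_of_sum_ι_mul_eq_zero (hs : s ≠ 0) (hf : ∀ j, f j ∈ homog k m s)
    (hR : R = Submodule.span k (Set.range f)) {a : Fin m → QuotAlg R}
    (ha : ∑ i, proj R (FreeAlgebra.ι k i) * a i = 0) :
    ∃ c : Fin r → QuotAlg R, ∀ i, a i = ∑ j, proj R (lc i (f j)) * c j := by
  choose t ht using fun i => proj_surjective R (a i)
  have h : proj R (∑ i, FreeAlgebra.ι k i * t i) = 0 := by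
    rw [map_sum, ← ha]
    simp [ht]
  obtain ⟨-, c, hc⟩ := exists_of_proj_eq_zero hs hf hR h
  refine ⟨c, fun i => ?_⟩
  rw [← hc, lc_sum_ι_mul, ht]

theorem le_homog_of_eq_span (hf : ∀ j, f j ∈ homog k m s)
    (hR : R = Submodule.span k (Set.range f)) : R ≤ homog k m s := by
  rw [hR, Submodule.span_le]
  rintro _ ⟨j, rfl⟩
  exact hf j

theorem eq_zero_of_lc {n : ℕ} {a : Free k m} (ha : a ∈ homog k m (n + 1)) (h : ∀ i, lc i a = 0) :
    a = 0 := by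
  rw [eq_sum_lc_of_mem ha]
  exact Finset.sum_eq_zero fun i _ => by rw [h i, mul_zero]

theorem eq_zero_of_proj_eq_zero (hs : s ≠ 0) (hf : ∀ j, f j ∈ homog k m s)
    (hR : R = Submodule.span k (Set.range f)) {n : ℕ} (hn : n < s) {a : Free k m}
    (ha : a ∈ homog k m n) (h : proj R a = 0) : a = 0 := by
  have hRs := le_homog_of_eq_span hf hR
  induction n generalizing a with
  | zero =>
    rw [eq_algebraMap_of_mem_homog_zero ha, (exists_of_proj_eq_zero hs hf hR h).1, map_zero]
  | succ n ih =>
    obtain ⟨-, c, hc⟩ := exists_of_proj_eq_zero hs hf hR h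
    refine eq_zero_of_lc ha fun i => ih (by omega) (lcon_mem _ ha) ?_
    rw [← hz_of_mem_self hRs (proj_mem_cz (R := R) (lcon_mem (Pi.single i 1) ha)),
      hc, map_sum]
    obtain ⟨s, rfl⟩ := Nat.exists_eq_succ_of_ne_zero hs
    refine Finset.sum_eq_zero fun j _ => ?_
    rw [hz_mul_left hRs (proj_mem_cz (lcon_mem _ (hf j)))]
    -- The relations now have degree `s + 1`, their coefficients degree `s`, so the relevant
    -- component of `c j` has the negative degree `n - s`.
    have := hz_mem hRs ((n : ℤ) - s) (c j)
    rw [cz_of_neg (by omega), Submodule.mem_bot] at this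
    rw [this, mul_zero]

/-- In degree `s` the coefficients `c j` matter only through their scalar parts. The element and the
corresponding combination of relations have contractions that agree in the quotient, hence agree, as
nothing is killed in degree `s - 1`. -/
theorem mem_of_proj_eq_zero (hs : s ≠ 0) (hf : ∀ j, f j ∈ homog k m s)
    (hR : R = Submodule.span k (Set.range f)) {a : Free k m}
    (ha : a ∈ homog k m s) (h : proj R a = 0) : a ∈ R := by
  have hRs := le_homog_of_eq_span hf hR
  obtain ⟨s, rfl⟩ := Nat.exists_eq_succ_of_ne_zero hs
  obtain ⟨-, c, hc⟩ := exists_of_proj_eq_zero hs hf hR h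
  choose d hd using fun j => exists_algebraMap_of_mem_cz_zero (hz_mem hRs 0 (c j))
  have hfR : ∀ j, f j ∈ R := fun j => by rw [hR]; exact Submodule.subset_span ⟨j, rfl⟩
  have key : a - ∑ j, d j • f j = 0 := by
    have hmem : a - ∑ j, d j • f j ∈ homog k m (s + 1) :=
      sub_mem ha (Submodule.sum_mem _ fun j _ => Submodule.smul_mem _ _ (hf j))
    refine eq_zero_of_lc hmem fun i =>
      eq_zero_of_proj_eq_zero hs hf hR (Nat.lt_succ_self s) (lcon_mem _ hmem) ?_
    rw [map_sub, map_sub,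
      ← hz_of_mem_self hRs (proj_mem_cz (R := R) (lcon_mem (Pi.single i 1) ha)),
      hc, map_sum, map_sum, map_sum, sub_eq_zero]
    refine Finset.sum_congr rfl fun j _ => ?_
    rw [hz_mul_left hRs (proj_mem_cz (lcon_mem _ (hf j))),
      sub_self, hd, map_smul, map_smul, Algebra.smul_def, Algebra.commutes]
  rw [sub_eq_zero] at key
  rw [key]
  exact Submodule.sum_mem _ fun j _ => Submodule.smul_mem _ _ (hfR j)

end Presentation

end HomogAlg

end

noncomputable section

namespace HomogAlg

/-! ### The spaces W as duals of the dual algebra; the complex in matrix form -/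

section Duality

variable {k : Type u} [Field k] {m : ℕ}

/-- The spaces `⋂ V^i R V^j` with `i + j = n`. -/
def Wup (R : Submodule k (Free k m)) : ℕ → Submodule k (Free k m)
  | 0 => R
  | n + 1 => Wup R n * homog k m 1 ⊓ homog k m 1 * Wup R n

/-- The space `⋂ V^i R V^j` with `i + s + j = n`; it is dual to the degree `n` component of the
`s`-homogeneous dual of `k⟨x₁, …, x_m⟩/(R)`. -/
def W (s : ℕ) (R : Submodule k (Free k m)) (n : ℕ) : Submodule k (Free k m) :=
  if n < s then homog k m n else Wup R (n - s)

variable {s : ℕ} {R : Submodule k (Free k m)}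

theorem W_of_lt {n : ℕ} (h : n < s) : W s R n = homog k m n := by simp [W, h]

theorem W_self : W s R s = R := by simp [W, Wup]

theorem W_succ {n : ℕ} (h : s ≤ n) :
    W s R (n + 1) = W s R n * homog k m 1 ⊓ homog k m 1 * W s R n := by
  simp only [W, show ¬ n + 1 < s by omega, show ¬ n < s by omega, if_false]
  rw [show n + 1 - s = (n - s) + 1 by omega, Wup]

theorem W_le_homog (hR : R ≤ homog k m s) (n : ℕ) : W s R n ≤ homog k m n := by
  rcases lt_or_ge n s with h | h
  · rw [W_of_lt h]
  · induction n, h using Nat.le_induction with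
    | base => rwa [W_self]
    | succ n h ih =>
      rw [W_succ h, ← homog_mul_homog n 1]
      exact inf_le_left.trans (mul_le_mul_left ih _)

theorem W_succ_le (hR : R ≤ homog k m s) (n : ℕ) : W s R (n + 1) ≤ W s R n * homog k m 1 := by
  rcases lt_or_ge n s with h | h
  · rw [W_of_lt h, homog_mul_homog]
    exact W_le_homog hR _
  · rw [W_succ h]; exact inf_le_left

theorem W_succ_le' (hR : R ≤ homog k m s) (n : ℕ) : W s R (n + 1) ≤ homog k m 1 * W s R n := by
  rcases lt_or_ge n s with h | h
  · rw [W_of_lt h, homog_mul_homog, add_comm 1]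
    exact W_le_homog hR _
  · rw [W_succ h]; exact inf_le_right

theorem W_add_le (hR : R ≤ homog k m s) (p l : ℕ) : W s R (p + l) ≤ W s R p * homog k m l := by
  induction l with
  | zero => rw [homog_zero, ← Submodule.one_eq_span, mul_one, add_zero]
  | succ l ih =>
    rw [← homog_mul_homog, ← mul_assoc]
    exact (W_succ_le hR (p + l)).trans (mul_le_mul_left ih _)

/-- This inclusion is what makes consecutive differentials compose to zero: the composite matrix has
entries in R. -/
theorem W_add_self_le (hR : R ≤ homog k m s) (p : ℕ) : W s R (p + s) ≤ homog k m p * R := by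
  induction p with
  | zero => rw [homog_zero, ← Submodule.one_eq_span, one_mul, zero_add, W_self]
  | succ p ih =>
    rw [show p + 1 + s = (p + s) + 1 by ring, add_comm p 1, ← homog_mul_homog, mul_assoc]
    exact (W_succ_le' hR (p + s)).trans (mul_le_mul_right ih _)

theorem lcon_mem_of_mem_mul (ξ : Fin m → k) {N : Submodule k (Free k m)} {f : Free k m}
    (hf : f ∈ homog k m 1 * N) : lcon ξ f ∈ N := by
  have : homog k m 1 * N ≤ N.comap (lcon ξ) := by
    rw [homog_one, Submodule.mul_le]
    intro v hv n hn
    rw [Submodule.mem_comap, lcon_mul]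
    rw [← homog_one] at hv
    rw [aug_eq_zero_of_mem one_ne_zero hv, zero_smul, add_zero,
      eq_algebraMap_of_mem_homog_zero (lcon_mem ξ hv), ← Algebra.smul_def]
    exact N.smul_mem _ hn
  exact this hf

theorem rcon_mem_of_mem_mul (ξ : Fin m → k) {N : Submodule k (Free k m)} {f : Free k m}
    (hf : f ∈ N * homog k m 1) : rcon ξ f ∈ N := by
  have : N * homog k m 1 ≤ N.comap (rcon ξ) := by
    rw [Submodule.mul_le]
    intro n hn v hv
    rw [Submodule.mem_comap, rcon_mul]
    rw [aug_eq_zero_of_mem one_ne_zero hv, zero_smul, add_zero,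
      eq_algebraMap_of_mem_homog_zero (rcon_mem ξ hv), ← Algebra.commutes, ← Algebra.smul_def]
    exact N.smul_mem _ hn
  exact this hf

theorem mem_mul_homog_one {N : Submodule k (Free k m)} {n : ℕ} {f : Free k m}
    (hf : f ∈ homog k m (n + 1)) (h : ∀ i, rc i f ∈ N) : f ∈ N * homog k m 1 := by
  rw [eq_sum_rc_of_mem hf]
  exact Submodule.sum_mem _ fun i _ => Submodule.mul_mem_mul (h i) (ι_mem i)

theorem mem_homog_one_mul {N : Submodule k (Free k m)} {n : ℕ} {f : Free k m}
    (hf : f ∈ homog k m (n + 1)) (h : ∀ i, lc i f ∈ N) : f ∈ homog k m 1 * N := by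
  rw [eq_sum_lc_of_mem hf]
  exact Submodule.sum_mem _ fun i _ => Submodule.mul_mem_mul (ι_mem i) (h i)

/-- The annihilator of all the spaces `W s R n` is a two-sided ideal, because these spaces are
stable under contraction on either side. -/
theorem pair_mul_eq_zero_of_forall {b g : Free k m} (hR : R ≤ homog k m s)
    (hg : ∀ n, ∀ f ∈ W s R n, pair g f = 0) :
    (∀ n, ∀ f ∈ W s R n, pair (b * g) f = 0) ∧ ∀ n, ∀ f ∈ W s R n, pair (g * b) f = 0 := by
  have h0 : ∀ (ξ : Fin m → k) (f : Free k m), f ∈ W s R 0 → lcon ξ f = 0 ∧ rcon ξ f = 0 := by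
    intro ξ f hf
    rw [eq_algebraMap_of_mem_homog_zero (W_le_homog hR 0 hf)]
    exact ⟨lcon_algebraMap _ _, rcon_algebraMap _ _⟩
  induction b using FreeAlgebra.induction generalizing g with
  | grade0 c =>
    rw [← Algebra.commutes, ← Algebra.smul_def]
    refine ⟨?_, ?_⟩ <;>
    · intro n f hf
      rw [← pairB_apply, map_smul, LinearMap.smul_apply, pairB_apply, hg n f hf, smul_zero]
  | grade1 i =>
    refine ⟨fun n f hf => ?_, fun n f hf => ?_⟩
    · rw [pair_ι_mul]
      cases n with
      | zero => rw [(h0 _ f hf).1, ← pairB_apply, map_zero]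
      | succ n => exact hg n _ (lcon_mem_of_mem_mul _ (W_succ_le' hR n hf))
    · rw [pair_mul_ι]
      cases n with
      | zero => rw [(h0 _ f hf).2, ← pairB_apply, map_zero]
      | succ n => exact hg n _ (rcon_mem_of_mem_mul _ (W_succ_le hR n hf))
  | mul a b ha hb =>
    exact ⟨by rw [mul_assoc]; exact (ha (hb hg).1).1, by rw [← mul_assoc]; exact (hb (ha hg).2).2⟩
  | add a b ha hb =>
    refine ⟨fun n f hf => ?_, fun n f hf => ?_⟩
    · rw [add_mul, ← pairB_apply, map_add, LinearMap.add_apply, pairB_apply, pairB_apply,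
        (ha hg).1 n f hf, (hb hg).1 n f hf, add_zero]
    · rw [mul_add, ← pairB_apply, map_add, LinearMap.add_apply, pairB_apply, pairB_apply,
        (ha hg).2 n f hf, (hb hg).2 n f hf, add_zero]

theorem pair_eq_zero_of_mem_W (hR : R ≤ homog k m s) {g : Free k m}
    (hg : proj (dualRel s R) g = 0) : ∀ n, ∀ f ∈ W s R n, pair g f = 0 := by
  rw [proj_eq_zero_iff] at hg
  induction hg using TwoSidedIdeal.span_induction with
  | mem x hx =>
    intro n f hf
    by_cases hn : s = n
    · subst hn
      rw [W_self] at hf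
      exact hx.2 f hf
    · exact pair_eq_zero hn hx.1 (W_le_homog hR n hf)
  | zero => intro n f _; rw [← pairB_apply]; simp
  | add x y _ _ hx hy =>
    intro n f hf
    rw [← pairB_apply, map_add, LinearMap.add_apply, pairB_apply, pairB_apply, hx n f hf,
      hy n f hf, add_zero]
  | neg x _ hx =>
    intro n f hf
    rw [← pairB_apply, map_neg, LinearMap.neg_apply, pairB_apply, hx n f hf, neg_zero]
  | left_absorb b x _ hx => exact (pair_mul_eq_zero_of_forall hR hx).1
  | right_absorb b x _ hx => exact (pair_mul_eq_zero_of_forall hR hx).2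

/-- Above degree `s`, products of the dual ideal with letters stay in the ideal, so both kinds of
contractions of `f` satisfy the hypothesis one degree lower. Degree `s` is the double annihilator
property. -/
theorem mem_W_of_forall_pair (hR : R ≤ homog k m s) {n : ℕ} {f : Free k m} (hf : f ∈ homog k m n)
    (h : ∀ g ∈ homog k m n, proj (dualRel s R) g = 0 → pair g f = 0) : f ∈ W s R n := by
  rcases lt_or_ge n s with hn | hn
  · rwa [W_of_lt hn]
  · induction n, hn using Nat.le_induction generalizing f with
    | base =>
      rw [W_self]
      refine mem_of_forall_pair_eq_zero hR hf fun g hg hgR => h g hg ?_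
      exact proj_eq_zero_of_mem (show g ∈ dualRel s R from ⟨hg, hgR⟩)
    | succ n hn ih =>
      rw [W_succ hn]
      refine ⟨mem_mul_homog_one hf fun i => ih (rcon_mem _ hf) fun g hg hg0 => ?_,
        mem_homog_one_mul hf fun i => ih (lcon_mem _ hf) fun g hg hg0 => ?_⟩
      · rw [← pair_mul_ι]
        exact h _ (homog_mul hg (ι_mem i)) (by rw [map_mul, hg0, zero_mul])
      · rw [← pair_ι_mul]
        exact h _ (by rw [add_comm]; exact homog_mul (ι_mem i) hg) (by rw [map_mul, hg0, mul_zero])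

theorem eq_zero_of_forall_pair {n : ℕ} {f : Free k m} (hf : f ∈ homog k m n)
    (h : ∀ g ∈ homog k m n, pair g f = 0) : f = 0 := by
  rw [eq_sum_pair hf]
  exact Finset.sum_eq_zero fun w _ => by rw [h _ (mono_mem w), zero_smul]

/-- `W s R n` is exactly the annihilator of the degree `n` part of the dual ideal, hence it is the
dual of the quotient. -/
theorem exists_dualBasis (hR : R ≤ homog k m s) {n r : ℕ} {b : Fin r → Free k m}
    (hb : LinearIndependent k b) (hspan : Submodule.span k (Set.range b) = W s R n) :
    ∃ β : Module.Basis (Fin r) k (Module.Dual k (comp (dualRel s R) n)),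
      ∀ i (g : Free k m) (hg : g ∈ homog k m n),
        β i ⟨proj (dualRel s R) g, proj_mem_comp hg⟩ = pair g (b i) := by
  have hbW : ∀ i, b i ∈ W s R n := fun i => by
    rw [← hspan]; exact Submodule.subset_span ⟨i, rfl⟩
  let π : homog k m n →ₗ[k] comp (dualRel s R) n :=
    (proj (dualRel s R)).toLinearMap.restrict fun a ha => proj_mem_comp ha
  have hπ : Function.Surjective π := by
    rintro ⟨_, g, hg, rfl⟩
    exact ⟨⟨g, hg⟩, rfl⟩
  -- An arbitrary section: two lifts differ by an element of the dual ideal, which pairs to zero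
  -- with `W s R n`.
  obtain ⟨σ, hσ⟩ := LinearMap.exists_rightInverse_of_surjective π (LinearMap.range_eq_top.2 hπ)
  let ψ : Fin r → Module.Dual k (comp (dualRel s R) n) := fun i =>
    ((pairB.flip (b i)).comp (Submodule.subtype _)).comp σ
  have hψ : ∀ i (g : Free k m) (hg : g ∈ homog k m n),
      ψ i ⟨proj (dualRel s R) g, proj_mem_comp hg⟩ = pair g (b i) := by
    intro i g hg
    have h1 : π (σ (π ⟨g, hg⟩)) = π ⟨g, hg⟩ := LinearMap.congr_fun hσ _
    have h2 : proj (dualRel s R) ((σ (π ⟨g, hg⟩) : Free k m) - g) = 0 := by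
      rw [map_sub, sub_eq_zero]
      exact congrArg Subtype.val h1
    have h3 := pair_eq_zero_of_mem_W hR h2 n _ (hbW i)
    rw [← pairB_apply, map_sub, LinearMap.sub_apply, sub_eq_zero] at h3
    exact h3
  have hli : LinearIndependent k ψ := by
    rw [Fintype.linearIndependent_iff]
    intro c hc
    refine Fintype.linearIndependent_iff.1 hb c ?_
    refine eq_zero_of_forall_pair (n := n)
      (Submodule.sum_mem _ fun i _ => Submodule.smul_mem _ _ (W_le_homog hR n (hbW i)))
      fun g hg => ?_
    have := LinearMap.congr_fun hc ⟨proj (dualRel s R) g, proj_mem_comp hg⟩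
    simp only [LinearMap.sum_apply, LinearMap.smul_apply, hψ _ g hg, LinearMap.zero_apply] at this
    rw [← pairB_apply, map_sum, ← this]
    simp [pairB_apply]
  have hsp : ⊤ ≤ Submodule.span k (Set.range ψ) := by
    rintro θ -
    obtain ⟨f, hf, hm⟩ : ∃ f ∈ homog k m n, ∀ w : Fin n → Fin m,
        pair (mono k w) f = θ (π ⟨mono k w, mono_mem w⟩) := by
      refine ⟨∑ w : Fin n → Fin m, θ (π ⟨mono k w, mono_mem w⟩) • mono k w,
        Submodule.sum_mem _ fun w _ => Submodule.smul_mem _ _ (mono_mem w), fun w => ?_⟩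
      rw [← pairB_apply, map_sum]
      simp [pairB_apply, pair_mono]
    have hfp : ∀ g (hg : g ∈ homog k m n), pair g f = θ (π ⟨g, hg⟩) := by
      intro g hg
      have h1 : (⟨g, hg⟩ : homog k m n) =
          ∑ w : Fin n → Fin m, pair (mono k w) g • ⟨mono k w, mono_mem w⟩ := by
        apply Subtype.ext
        simpa using eq_sum_pair hg
      rw [h1, map_sum, map_sum]
      conv_lhs => rw [eq_sum_pair hg]
      rw [← pairB_apply, map_sum, LinearMap.sum_apply]
      refine Finset.sum_congr rfl fun w _ => ?_
      rw [map_smul, LinearMap.smul_apply, map_smul, map_smul, pairB_apply, hm]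
    have hfW : f ∈ W s R n := mem_W_of_forall_pair hR hf fun g hg hg0 => by
      rw [hfp g hg]
      have : π ⟨g, hg⟩ = 0 := Subtype.ext hg0
      rw [this, map_zero]
    rw [← hspan, Submodule.mem_span_range_iff_exists_fun] at hfW
    obtain ⟨c, hc⟩ := hfW
    rw [Submodule.mem_span_range_iff_exists_fun]
    refine ⟨c, LinearMap.ext ?_⟩
    rintro ⟨_, g, hg, rfl⟩
    have h2 := hfp g hg
    rw [← hc, ← pairB_apply, map_sum] at h2
    change _ = θ (π ⟨g, hg⟩)
    rw [← h2, LinearMap.sum_apply]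
    refine Finset.sum_congr rfl fun i _ => ?_
    rw [LinearMap.smul_apply, map_smul]
    exact congrArg _ (hψ i g hg)
  refine ⟨Module.Basis.mk hli hsp, fun i g hg => ?_⟩
  rw [Module.Basis.mk_apply, hψ i g hg]

theorem finrank_comp_dualRel (hR : R ≤ homog k m s) {n r : ℕ} {b : Fin r → Free k m}
    (hb : LinearIndependent k b) (hspan : Submodule.span k (Set.range b) = W s R n) :
    Module.finrank k (comp (dualRel s R) n) = r := by
  obtain ⟨β, -⟩ := exists_dualBasis hR hb hspan
  rw [← Subspace.dual_finrank_eq, Module.finrank_eq_card_basis β, Fintype.card_fin]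

/-- Coordinates on `(Λ^!_n)^* ⊗ Λ` with respect to a basis of `(Λ^!_n)^*`. -/
def coordEquiv {n r : ℕ} (β : Module.Basis (Fin r) k (Module.Dual k (comp (dualRel s R) n))) :
    Module.Dual k (comp (dualRel s R) n) ⊗[k] QuotAlg R ≃ₗ[k] (Fin r → QuotAlg R) :=
  (TensorProduct.equivFinsuppOfBasisLeft β).trans (Finsupp.linearEquivFunOnFinite k _ _)

theorem coordEquiv_symm_single {n r : ℕ}
    (β : Module.Basis (Fin r) k (Module.Dual k (comp (dualRel s R) n))) (i : Fin r)
    (x : QuotAlg R) : (coordEquiv β).symm (Pi.single i x) = β i ⊗ₜ x := by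
  rw [LinearEquiv.symm_apply_eq]
  ext j
  simp [coordEquiv, Pi.single_apply, Finsupp.single_apply, eq_comm]

theorem coordEquiv_tmul {n r : ℕ}
    (β : Module.Basis (Fin r) k (Module.Dual k (comp (dualRel s R) n))) (i : Fin r)
    (x : QuotAlg R) : coordEquiv β (β i ⊗ₜ x) = Pi.single i x := by
  rw [← coordEquiv_symm_single, LinearEquiv.apply_symm_apply]

/-- Multiplication of a column by a matrix over `k⟨x₁, …, x_m⟩`. -/
def matMap (R : Submodule k (Free k m)) {p q : ℕ} (μ : Fin p → Fin q → Free k m) :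
    (Fin q → QuotAlg R) →ₗ[k] (Fin p → QuotAlg R) where
  toFun x := fun a => ∑ c, proj R (μ a c) * x c
  map_add' x y := by ext a; simp [mul_add, Finset.sum_add_distrib]
  map_smul' c x := by ext a; simp [Finset.smul_sum]

theorem matMap_apply {p q : ℕ} (μ : Fin p → Fin q → Free k m) (x : Fin q → QuotAlg R) (a : Fin p) :
    matMap R μ x a = ∑ c, proj R (μ a c) * x c := rfl

/-- The transpose of multiplication in the dual algebra is the inclusion of W_q into W_p V^l,
because the pairing factors over products. A matrix `μ` expressing `bq` through `bp` is therefore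
the matrix of the differential. -/
theorem coordEquiv_koszulMap {p l q rp rq : ℕ} (h : p + l = q)
    {bp : Fin rp → Free k m} {bq : Fin rq → Free k m} (hbp : ∀ a, bp a ∈ homog k m p)
    {μ : Fin rp → Fin rq → Free k m} (hμ : ∀ a c, μ a c ∈ homog k m l)
    (hbμ : ∀ c, bq c = ∑ a, bp a * μ a c)
    {βp : Module.Basis (Fin rp) k (Module.Dual k (comp (dualRel s R) p))}
    (hβp : ∀ i (g : Free k m) (hg : g ∈ homog k m p),
        βp i ⟨proj (dualRel s R) g, proj_mem_comp hg⟩ = pair g (bp i))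
    {βq : Module.Basis (Fin rq) k (Module.Dual k (comp (dualRel s R) q))}
    (hβq : ∀ i (g : Free k m) (hg : g ∈ homog k m q),
        βq i ⟨proj (dualRel s R) g, proj_mem_comp hg⟩ = pair g (bq i))
    (t : Module.Dual k (comp (dualRel s R) q) ⊗[k] QuotAlg R) :
    coordEquiv βp (koszulMap s R p l q h t) = matMap R μ (coordEquiv βq t) := by
  have key : ((coordEquiv βp).toLinearMap.comp (koszulMap s R p l q h)).comp
      (coordEquiv βq).symm.toLinearMap = matMap R μ := by
    refine LinearMap.pi_ext fun c x => ?_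
    have hd : ∀ w : Fin l → Fin m,
        ((LinearMap.mulRight k (proj (dualRel s R) (mono k w))).restrict
          (p := comp (dualRel s R) p) (q := comp (dualRel s R) q)
          fun _ ha => h ▸ comp_mul _ ha (proj_mono_mem _ w)).dualMap (βq c) =
        ∑ a, pair (mono k w) (μ a c) • βp a := by
      intro w
      refine LinearMap.ext ?_
      rintro ⟨_, g, hg, rfl⟩
      have hgw : g * mono k w ∈ homog k m q := h ▸ homog_mul hg (mono_mem w)
      have h1 := hβq c _ hgw
      rw [LinearMap.dualMap_apply]
      refine Eq.trans ?_ (h1.trans ?_)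
      · exact congrArg _ (Subtype.ext (map_mul (proj (dualRel s R)) g (mono k w)).symm)
      · rw [hbμ, ← pairB_apply, map_sum, LinearMap.sum_apply]
        refine Finset.sum_congr rfl fun a _ => ?_
        rw [pairB_apply, pair_mul hg (hbp a) (mono_mem w) (hμ a c), LinearMap.smul_apply,
          smul_eq_mul, mul_comm]
        congr 1
        exact (hβp a g hg).symm
    rw [LinearMap.comp_apply, LinearEquiv.coe_coe, coordEquiv_symm_single, LinearMap.comp_apply,
      koszulMap, LinearMap.sum_apply]
    simp only [TensorProduct.map_tmul, hd, TensorProduct.sum_tmul, LinearMap.mulLeft_apply]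
    rw [Finset.sum_comm]
    have h2 : ∀ a, ∑ w : Fin l → Fin m,
        (pair (mono k w) (μ a c) • βp a) ⊗ₜ[k] (proj R (mono k w) * x) =
        βp a ⊗ₜ[k] (proj R (μ a c) * x) := by
      intro a
      conv_rhs => rw [eq_sum_pair (hμ a c), map_sum, Finset.sum_mul, TensorProduct.tmul_sum]
      refine Finset.sum_congr rfl fun w _ => ?_
      rw [TensorProduct.smul_tmul, map_smul, smul_mul_assoc]
    simp only [h2]
    rw [LinearEquiv.coe_coe, map_sum]
    simp only [coordEquiv_tmul]
    ext a
    rw [Finset.sum_apply, matMap_apply]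
    simp [Pi.single_apply]
  have := LinearMap.congr_fun key (coordEquiv βq t)
  simpa using this

end Duality

end HomogAlg

end

noncomputable section

namespace HomogAlg

/-! ### The degree function -/

section Chi

theorem chi_even (s j : ℕ) : chi s (2 * j) = s * j := by
  simp [chi, mul_comm]

theorem chi_odd (s j : ℕ) : chi s (2 * j + 1) = s * j + 1 := by
  have : ¬ Even (2 * j + 1) := by simp
  rw [chi, if_neg this, Nat.add_sub_cancel, Nat.mul_div_cancel_left _ (by norm_num), mul_comm]

theorem chi_add_two (s i : ℕ) : chi s (i + 2) = chi s i + s := by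
  obtain ⟨j, rfl | rfl⟩ := Nat.even_or_odd' i
  · rw [show 2 * j + 2 = 2 * (j + 1) by ring, chi_even, chi_even]; ring
  · rw [show 2 * j + 1 + 2 = 2 * (j + 1) + 1 by ring, chi_odd, chi_odd]; ring

theorem chi_zero (s : ℕ) : chi s 0 = 0 := chi_even s 0

theorem chi_one (s : ℕ) : chi s 1 = 1 := chi_odd s 0

theorem chi_two (s : ℕ) : chi s 2 = s := by rw [chi_add_two, chi_zero, zero_add]

theorem chi_three (s : ℕ) : chi s 3 = s + 1 := by rw [chi_add_two, chi_one, add_comm]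

theorem chi_lt_succ {s : ℕ} (hs : 2 ≤ s) (i : ℕ) : chi s i < chi s (i + 1) := by
  obtain ⟨j, rfl | rfl⟩ := Nat.even_or_odd' i
  · rw [chi_even, chi_odd]; omega
  · rw [show 2 * j + 1 + 1 = 2 * (j + 1) by ring, chi_even, chi_odd, mul_add]; omega

theorem le_chi {s : ℕ} (hs : 2 ≤ s) (i : ℕ) : i ≤ chi s i := by
  induction i with
  | zero => omega
  | succ i ih => have := chi_lt_succ hs i; omega

end Chi

/-! ### The Koszul complex in coordinates -/

section Complex

variable {k : Type u} [Field k] {m : ℕ}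

theorem linearIndependent_ι : LinearIndependent k (FreeAlgebra.ι k : Fin m → Free k m) := by
  rw [Fintype.linearIndependent_iff]
  intro c hc i
  have h := lc_sum_ι_mul (k := k) (fun l => algebraMap k (Free k m) (c l)) i
  have h2 : ∑ l, FreeAlgebra.ι k l * algebraMap k (Free k m) (c l) = 0 := by
    rw [← hc]
    exact Finset.sum_congr rfl fun l _ => by rw [← Algebra.commutes, ← Algebra.smul_def]
  rw [h2, map_zero] at h
  exact (FreeAlgebra.algebraMap_eq_zero_iff _).1 h.symm

/-- Bases of the spaces dual to the components of the `s`-homogeneous dual in the degrees that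
occur in the generalized Koszul complex, for an algebra with two relations. -/
structure KData (s : ℕ) (R : Submodule k (Free k m)) where
  f : Fin 2 → Free k m
  f_li : LinearIndependent k f
  f_span : Submodule.span k (Set.range f) = R
  ρ : ℕ → ℕ
  e : ∀ n, Fin (ρ n) → Free k m
  e_li : ∀ n, LinearIndependent k (e n)
  e_span : ∀ n, Submodule.span k (Set.range (e n)) = W s R (chi s (n + 3))

namespace KData

variable {s : ℕ} {R : Submodule k (Free k m)} (K : KData s R)

/-- The ranks of the terms of the generalized Koszul complex. -/
def r : ℕ → ℕ
  | 0 => 1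
  | 1 => m
  | 2 => 2
  | n + 3 => K.ρ n

/-- The basis elements generating the terms of the generalized Koszul complex. -/
def b : ∀ i, Fin (K.r i) → Free k m
  | 0 => fun _ => 1
  | 1 => fun i => FreeAlgebra.ι k i
  | 2 => K.f
  | n + 3 => K.e n

theorem b_li : ∀ i, LinearIndependent k (K.b i)
  | 0 => LinearIndependent.of_subsingleton (ι := Fin 1) (v := fun _ => (1 : Free k m)) 0 one_ne_zero
  | 1 => linearIndependent_ι
  | 2 => K.f_li
  | n + 3 => K.e_li n

theorem b_span (hs : 2 ≤ s) : ∀ i, Submodule.span k (Set.range (K.b i)) = W s R (chi s i)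
  | 0 => by
    rw [chi_zero, W_of_lt (by omega), homog_zero]
    congr 1
    ext a
    constructor
    · rintro ⟨_, rfl⟩; rfl
    · rintro rfl; exact ⟨(0 : Fin 1), rfl⟩
  | 1 => by
    rw [chi_one, W_of_lt (by omega), homog_one]
    rfl
  | 2 => by
    rw [chi_two, W_self]
    exact K.f_span
  | n + 3 => K.e_span n

theorem b_mem_W (hs : 2 ≤ s) (i : ℕ) (a : Fin (K.r i)) : K.b i a ∈ W s R (chi s i) := by
  rw [← K.b_span hs]; exact Submodule.subset_span ⟨a, rfl⟩

theorem b_mem (hs : 2 ≤ s) (hR : R ≤ homog k m s) (i : ℕ) (a : Fin (K.r i)) :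
    K.b i a ∈ homog k m (chi s i) := W_le_homog hR _ (K.b_mem_W hs i a)

theorem exists_μ (hs : 2 ≤ s) (hR : R ≤ homog k m s) (i : ℕ) (c : Fin (K.r (i + 1))) :
    ∃ t : Fin (K.r i) → Free k m, (∀ a, t a ∈ homog k m (chi s (i + 1) - chi s i)) ∧
      K.b (i + 1) c = ∑ a, K.b i a * t a := by
  apply exists_sum_of_mem_span_mul
  rw [K.b_span hs]
  refine W_add_le hR _ _ ?_
  rw [Nat.add_sub_cancel' (chi_lt_succ hs i).le]
  exact K.b_mem_W hs _ c

end KData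

variable {s : ℕ} {R : Submodule k (Free k m)} (K : KData s R) (hs : 2 ≤ s) (hR : R ≤ homog k m s)

namespace KData

/-- The matrices of the differentials of the generalized Koszul complex. -/
def μ (i : ℕ) (a : Fin (K.r i)) (c : Fin (K.r (i + 1))) : Free k m :=
  (K.exists_μ hs hR i c).choose a

theorem μ_mem (i : ℕ) (a : Fin (K.r i)) (c : Fin (K.r (i + 1))) :
    K.μ hs hR i a c ∈ homog k m (chi s (i + 1) - chi s i) :=
  (K.exists_μ hs hR i c).choose_spec.1 a

theorem b_succ (i : ℕ) (c : Fin (K.r (i + 1))) :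
    K.b (i + 1) c = ∑ a, K.b i a * K.μ hs hR i a c :=
  (K.exists_μ hs hR i c).choose_spec.2

theorem proj_μ_mem (i : ℕ) (a : Fin (K.r i)) (c : Fin (K.r (i + 1))) :
    proj R (K.μ hs hR i a c) ∈ cz R ((chi s (i + 1) : ℤ) - chi s i) := by
  have := proj_mem_cz (R := R) (K.μ_mem hs hR i a c)
  rwa [Nat.cast_sub (chi_lt_succ hs i).le] at this

/-- The chosen matrices are forced by right independence, so any explicit expansion of the basis
computes the differential. -/
theorem μ_unique {i : ℕ} {c : Fin (K.r (i + 1))} {t : Fin (K.r i) → Free k m}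
    (h : K.b (i + 1) c = ∑ a, K.b i a * t a) (a : Fin (K.r i)) : K.μ hs hR i a c = t a := by
  rw [← sub_eq_zero]
  refine eq_zero_of_sum_mul_eq_zero (K.b_li i) (K.b_mem hs hR i)
    (t := fun a => K.μ hs hR i a c - t a) ?_ a
  simp only [mul_sub, Finset.sum_sub_distrib]
  rw [← K.b_succ, ← h, sub_self]

theorem μ_zero (a : Fin (K.r 0)) (c : Fin (K.r 1)) : K.μ hs hR 0 a c = FreeAlgebra.ι k c := by
  refine K.μ_unique hs hR (t := fun _ => FreeAlgebra.ι k c) ?_ a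
  change FreeAlgebra.ι k c = ∑ a : Fin 1, 1 * FreeAlgebra.ι k c
  simp

theorem f_mem (j : Fin 2) : K.f j ∈ R :=
  K.f_span.le (Submodule.subset_span ⟨j, rfl⟩)

theorem μ_one (a : Fin (K.r 1)) (c : Fin (K.r 2)) : K.μ hs hR 1 a c = lc a (K.f c) := by
  refine K.μ_unique hs hR (t := fun a => lc a (K.f c)) ?_ a
  obtain ⟨s, rfl⟩ : ∃ s', s = s' + 1 := ⟨s - 1, by omega⟩
  exact eq_sum_lc_of_mem (hR (K.f_mem c))

/-- The differentials of the generalized Koszul complex. -/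
def d (i : ℕ) : (Fin (K.r (i + 1)) → QuotAlg R) →ₗ[k] (Fin (K.r i) → QuotAlg R) :=
  matMap R (K.μ hs hR i)

theorem d_apply (i : ℕ) (x : Fin (K.r (i + 1)) → QuotAlg R) (a : Fin (K.r i)) :
    K.d hs hR i x a = ∑ c, proj R (K.μ hs hR i a c) * x c := rfl

theorem d_zero_apply (x : Fin m → QuotAlg R) (a : Fin (K.r 0)) :
    K.d hs hR 0 x a = ∑ i, proj R (FreeAlgebra.ι k i) * x i :=
  (K.d_apply hs hR 0 x a).trans (Finset.sum_congr (s₁ := (Finset.univ : Finset (Fin m))) rfl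
    fun i _ => congrArg (fun t => proj R t * x i) (K.μ_zero hs hR a i))

theorem d_one_apply (x : Fin 2 → QuotAlg R) (i : Fin m) :
    K.d hs hR 1 x i = ∑ j, proj R (lc i (K.f j)) * x j :=
  (K.d_apply hs hR 1 x i).trans (Finset.sum_congr (s₁ := (Finset.univ : Finset (Fin 2))) rfl
    fun j _ => congrArg (fun t => proj R t * x j) (K.μ_one hs hR i j))

/-- Two consecutive steps add `s` to the degree, and `b (i + 2) c` lies in V^p R with p = `chi s i`;
hence the entries of the product matrix lie in R. -/
theorem d_d (i : ℕ) (x : Fin (K.r (i + 2)) → QuotAlg R) :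
    K.d hs hR i (K.d hs hR (i + 1) x) = 0 := by
  have key : ∀ a c, ∑ j, K.μ hs hR i a j * K.μ hs hR (i + 1) j c ∈ R := by
    intro a c
    refine mem_of_sum_mul_mem (K.b_li i) (K.b_mem hs hR i)
      (t := fun a => ∑ j, K.μ hs hR i a j * K.μ hs hR (i + 1) j c) ?_ a
    have h : ∑ a, K.b i a * ∑ j, K.μ hs hR i a j * K.μ hs hR (i + 1) j c = K.b (i + 2) c := by
      rw [K.b_succ hs hR (i + 1) c]
      simp only [K.b_succ hs hR i, Finset.sum_mul, Finset.mul_sum, mul_assoc]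
      exact Finset.sum_comm
    rw [h]
    refine W_add_self_le hR _ ?_
    rw [← chi_add_two]
    exact K.b_mem_W hs _ c
  ext a
  simp only [d_apply, Finset.mul_sum, ← mul_assoc, ← map_mul]
  rw [Finset.sum_comm]
  simp only [← Finset.sum_mul, ← map_sum, proj_eq_zero_of_mem (key a _), zero_mul,
    Finset.sum_const_zero, Pi.zero_apply]

/-- The homogeneous component of degree `n` of the `i`-th term. -/
def gr (i : ℕ) (n : ℤ) : Submodule k (Fin (K.r i) → QuotAlg R) :=
  Submodule.pi Set.univ fun _ => cz R (n - chi s i)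

theorem mem_gr {i : ℕ} {n : ℤ} {x : Fin (K.r i) → QuotAlg R} :
    x ∈ K.gr i n ↔ ∀ a, x a ∈ cz R (n - chi s i) := by simp [gr]

/-- The projection to the homogeneous component of degree `n` of the `i`-th term. -/
def hp (i : ℕ) (n : ℤ) : (Fin (K.r i) → QuotAlg R) →ₗ[k] (Fin (K.r i) → QuotAlg R) :=
  (hz hR (n - chi s i)).compLeft _

theorem hp_apply (i : ℕ) (n : ℤ) (x : Fin (K.r i) → QuotAlg R) (a : Fin (K.r i)) :
    K.hp hR i n x a = hz hR (n - chi s i) (x a) := rfl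

theorem hp_mem (i : ℕ) (n : ℤ) (x : Fin (K.r i) → QuotAlg R) : K.hp hR i n x ∈ K.gr i n :=
  K.mem_gr.2 fun _ => hz_mem hR _ _

theorem hp_of_mem {i : ℕ} {n : ℤ} {x : Fin (K.r i) → QuotAlg R} (hx : x ∈ K.gr i n) (n' : ℤ) :
    K.hp hR i n' x = if n = n' then x else 0 := by
  ext a
  rw [hp_apply, hz_of_mem hR (K.mem_gr.1 hx a)]
  by_cases h : n = n'
  · rw [if_pos h, if_pos (by omega)]
  · rw [if_neg h, if_neg (by omega), Pi.zero_apply]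

theorem d_mem {i : ℕ} {n : ℤ} {x : Fin (K.r (i + 1)) → QuotAlg R} (hx : x ∈ K.gr (i + 1) n) :
    K.d hs hR i x ∈ K.gr i n := by
  rw [mem_gr]
  intro a
  rw [d_apply]
  refine Submodule.sum_mem _ fun c _ => ?_
  have := mul_mem_cz (K.proj_μ_mem hs hR i a c) (K.mem_gr.1 hx c)
  convert this using 2
  ring

theorem hp_d (i : ℕ) (n : ℤ) (x : Fin (K.r (i + 1)) → QuotAlg R) :
    K.hp hR i n (K.d hs hR i x) = K.d hs hR i (K.hp hR (i + 1) n x) := by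
  ext a
  rw [hp_apply, d_apply, d_apply, map_sum]
  refine Finset.sum_congr rfl fun c _ => ?_
  rw [hz_mul_left hR (K.proj_μ_mem hs hR i a c), hp_apply]
  congr 3
  ring

theorem exists_hp_sum (i : ℕ) (x : Fin (K.r i) → QuotAlg R) :
    ∃ S : Finset ℤ, (∀ n ∉ S, K.hp hR i n x = 0) ∧ ∑ n ∈ S, K.hp hR i n x = x := by
  choose S hS using fun a => exists_hz_sum hR (x a)
  refine ⟨(Finset.univ.biUnion S).image (· + (chi s i : ℤ)), fun n hn => ?_, ?_⟩
  · ext a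
    rw [hp_apply]
    refine (hS a (S a) subset_rfl).1 _ fun h => hn ?_
    rw [Finset.mem_image]
    exact ⟨n - chi s i, Finset.mem_biUnion.2 ⟨a, Finset.mem_univ _, h⟩, by ring⟩
  · ext a
    rw [Finset.sum_apply, Finset.sum_image (fun _ _ _ _ h => by simpa using h)]
    simp only [hp_apply, add_sub_cancel_right]
    exact (hS a _ (Finset.subset_biUnion_of_mem S (Finset.mem_univ a))).2

/-- Exactness of the generalized Koszul complex in the component of degree `n` of the term
`i + 1`. -/
def ExactAt (i : ℕ) (n : ℤ) : Prop :=
  ∀ x ∈ K.gr (i + 1) n, K.d hs hR i x = 0 → ∃ y ∈ K.gr (i + 2) n, K.d hs hR (i + 1) y = x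

variable {K hs hR} in
theorem exact_of_exactAt {i : ℕ} (h : ∀ n, K.ExactAt hs hR i n) :
    Function.Exact (K.d hs hR (i + 1)) (K.d hs hR i) := by
  intro x
  constructor
  · intro hx
    obtain ⟨S, -, hS⟩ := K.exists_hp_sum hR (i + 1) x
    have h1 : ∀ n, K.hp hR (i + 1) n x ∈ Set.range (K.d hs hR (i + 1)) := by
      intro n
      obtain ⟨y, -, hy⟩ := h n _ (K.hp_mem hR _ n x) (by rw [← hp_d, hx, map_zero])
      exact ⟨y, hy⟩
    rw [← hS]
    exact Submodule.sum_mem (LinearMap.range (K.d hs hR (i + 1))) fun n _ => h1 n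
  · rintro ⟨y, rfl⟩
    exact K.d_d hs hR i y

variable {K hs hR} in
theorem exactAt_of_exact {i : ℕ} (h : Function.Exact (K.d hs hR (i + 1)) (K.d hs hR i)) (n : ℤ) :
    K.ExactAt hs hR i n := by
  intro x hx hx0
  obtain ⟨y, rfl⟩ := (h x).1 hx0
  refine ⟨K.hp hR _ n y, K.hp_mem hR _ _ _, ?_⟩
  rw [← hp_d, K.hp_of_mem hR hx, if_pos rfl]

theorem exact_zero : Function.Exact (K.d hs hR 1) (K.d hs hR 0) := by
  intro x
  constructor
  · intro hx
    have h := (K.d_zero_apply hs hR x (0 : Fin 1)).symm.trans (congrFun hx (0 : Fin 1))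
    obtain ⟨c, hc⟩ := exists_of_sum_ι_mul_eq_zero (show s ≠ 0 by omega)
      (fun j => hR (K.f_mem j)) K.f_span.symm h
    exact ⟨c, funext fun i => (K.d_one_apply hs hR c i).trans (hc i).symm⟩
  · rintro ⟨y, rfl⟩
    exact K.d_d hs hR 0 y

theorem exactAt_zero (n : ℤ) : K.ExactAt hs hR 0 n := exactAt_of_exact (K.exact_zero hs hR) n

theorem exists_d_zero {n : ℤ} (hn : n ≠ 0) {x : Fin (K.r 0) → QuotAlg R} (hx : x ∈ K.gr 0 n) :
    ∃ y ∈ K.gr 1 n, K.d hs hR 0 y = x := by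
  have hx0 := K.mem_gr.1 hx (0 : Fin 1)
  rw [chi_zero, Nat.cast_zero, sub_zero] at hx0
  have h2 : ∃ y, K.d hs hR 0 y = x := by
    rcases lt_or_ge n 0 with h | h
    · rw [cz_of_neg h, Submodule.mem_bot] at hx0
      refine ⟨0, ?_⟩
      rw [map_zero]
      ext (a : Fin 1)
      rw [Subsingleton.elim a 0, hx0]; rfl
    · lift n to ℕ using h
      rw [cz_natCast] at hx0
      obtain ⟨t, ht, ht'⟩ := hx0
      obtain ⟨n, rfl⟩ : ∃ n', n = n' + 1 := ⟨n - 1, by omega⟩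
      refine ⟨fun i => proj R (lc i t), ?_⟩
      ext (a : Fin 1)
      rw [Subsingleton.elim a 0, ← ht']
      refine (K.d_zero_apply hs hR _ _).trans ?_
      change _ = proj R t
      conv_rhs => rw [eq_sum_lc_of_mem ht, map_sum]
      simp only [map_mul]
      rfl
  obtain ⟨y, rfl⟩ := h2
  refine ⟨K.hp hR _ n y, K.hp_mem hR _ _ _, ?_⟩
  rw [← hp_d, K.hp_of_mem hR hx, if_pos rfl]

end KData

end Complex

end HomogAlg

end

noncomputable section

namespace HomogAlg

/-! ### Euler characteristics -/

section Euler

variable {k : Type u} [Field k] {E : ℕ → Type*} [∀ i, AddCommGroup (E i)] [∀ i, Module k (E i)]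
  (P : ∀ i, Submodule k (E i)) (D : ∀ i, E (i + 1) →ₗ[k] E i)

/-- The dimension of the space of cycles in a subcomplex. -/
def cycDim : ℕ → ℕ
  -- No differential leaves term 0, so all of it counts as cycles.
  | 0 => Module.finrank k (P 0)
  | i + 1 => Module.finrank k (P (i + 1) ⊓ LinearMap.ker (D i) : Submodule k (E (i + 1)))

/-- The dimension of the space of boundaries in a subcomplex. -/
def bdDim (i : ℕ) : ℕ := Module.finrank k ((P (i + 1)).map (D i))

variable [∀ i, Module.Finite k (P i)]

theorem finrank_eq_bdDim_add_cycDim (i : ℕ) :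
    Module.finrank k (P (i + 1)) = bdDim P D i + cycDim P D (i + 1) := by
  rw [← LinearMap.finrank_range_add_finrank_ker ((D i).domRestrict (P (i + 1))),
    LinearMap.range_domRestrict, LinearMap.ker_domRestrict, bdDim, cycDim,
    ← Submodule.map_comap_subtype, Submodule.finrank_map_subtype_eq]

/-- Rank–nullity, telescoped. The last summand is the error of truncation and vanishes once the next
term does. -/
theorem sum_finrank_eq (N : ℕ) :
    ∑ i ∈ Finset.range (N + 1), (-1 : ℤ) ^ i * Module.finrank k (P i) =
      ∑ i ∈ Finset.range (N + 1), (-1 : ℤ) ^ i * (cycDim P D i - bdDim P D i) +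
        (-1) ^ N * bdDim P D N := by
  induction N with
  | zero => simp [cycDim]
  | succ N ih =>
    rw [Finset.sum_range_succ, ih, Finset.sum_range_succ _ (N + 1),
      finrank_eq_bdDim_add_cycDim P D N]
    push_cast
    ring

variable {P D}

theorem cycDim_eq_bdDim_iff {i : ℕ} (hD : ∀ x ∈ P (i + 2), D (i + 1) x ∈ P (i + 1))
    (hDD : ∀ x, D i (D (i + 1) x) = 0) :
    cycDim P D (i + 1) = bdDim P D (i + 1) ↔
      ∀ x ∈ P (i + 1), D i x = 0 → ∃ y ∈ P (i + 2), D (i + 1) y = x := by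
  have hle : (P (i + 2)).map (D (i + 1)) ≤ P (i + 1) ⊓ LinearMap.ker (D i) := by
    rintro _ ⟨x, hx, rfl⟩
    exact ⟨hD x hx, hDD x⟩
  have : Module.Finite k (P (i + 1) ⊓ LinearMap.ker (D i) : Submodule k (E (i + 1))) :=
    Submodule.finiteDimensional_of_le inf_le_left
  constructor
  · intro h x hx hx0
    have := Submodule.eq_of_le_of_finrank_eq hle h.symm
    have hx' : x ∈ P (i + 1) ⊓ LinearMap.ker (D i) := ⟨hx, hx0⟩
    rw [← this] at hx'
    exact hx'
  · intro h
    have : P (i + 1) ⊓ LinearMap.ker (D i) = (P (i + 2)).map (D (i + 1)) :=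
      le_antisymm (fun x hx => h x hx.1 hx.2) hle
    rw [cycDim, this, bdDim]

end Euler

/-! ### Hilbert series and exactness at the second term -/

section Hilbert

variable {k : Type u} [Field k] {m s : ℕ} {R : Submodule k (Free k m)} (K : KData s R)

namespace KData

/-- The component of degree `n` of the `i`-th term as a power of a component of the algebra. -/
def grEquiv (i : ℕ) (n : ℤ) : K.gr i n ≃ₗ[k] (Fin (K.r i) → cz R (n - chi s i)) where
  toFun x a := ⟨x.1 a, K.mem_gr.1 x.2 a⟩
  map_add' _ _ := rfl
  map_smul' _ _ := rfl
  invFun y := ⟨fun a => (y a).1, K.mem_gr.2 fun a => (y a).2⟩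
  left_inv _ := rfl
  right_inv _ := rfl

instance (i : ℕ) (n : ℤ) : Module.Finite k (K.gr i n) := Module.Finite.equiv (K.grEquiv i n).symm

theorem finrank_gr (i : ℕ) (n : ℤ) :
    Module.finrank k (K.gr i n) = K.r i * Module.finrank k (cz R (n - chi s i)) := by
  rw [(K.grEquiv i n).finrank_eq, Module.finrank_pi_fintype]
  simp

theorem gr_eq_bot {i : ℕ} {n : ℤ} (h : n < chi s i) : K.gr i n = ⊥ := by
  rw [eq_bot_iff]
  intro x hx
  rw [Submodule.mem_bot]
  ext a
  have := K.mem_gr.1 hx a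
  rwa [cz_of_neg (by omega), Submodule.mem_bot] at this

variable (hs : 2 ≤ s) (hR : R ≤ homog k m s)

theorem finrank_cz_zero (hs : s ≠ 0) (hR : R ≤ homog k m s) : Module.finrank k (cz R 0) = 1 := by
  have h1 : (1 : QuotAlg R) ≠ 0 := fun h => by
    have := congrArg (augQ hs hR) h
    simp at this
  have h2 : cz R 0 = Submodule.span k {(1 : QuotAlg R)} := by
    refine le_antisymm (fun a ha => ?_) ?_
    · obtain ⟨c, rfl⟩ := exists_algebraMap_of_mem_cz_zero ha
      rw [Algebra.algebraMap_eq_smul_one]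
      exact Submodule.smul_mem _ _ (Submodule.mem_span_singleton_self _)
    · rw [Submodule.span_le, Set.singleton_subset_iff]
      exact one_mem_cz
  rw [h2, finrank_span_singleton h1]

/-- The Euler characteristic of the component of degree `n` of the generalized Koszul complex. -/
def euler (n : ℕ) : ℤ :=
  -- Terms with `i > n` vanish in degree `n`, as `i ≤ chi s i`. The bound `n + 3` guarantees that
  -- terms 0, 1 and 2 are always present and can be split off.
  ∑ i ∈ Finset.range (n + 3), (-1 : ℤ) ^ i * (K.r i * Module.finrank k (cz R ((n : ℤ) - chi s i)))

theorem cycDim_zero_sub_bdDim (n : ℕ) :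
    (cycDim (fun i => K.gr i n) (K.d hs hR) 0 : ℤ) - bdDim (fun i => K.gr i n) (K.d hs hR) 0 =
      if n = 0 then 1 else 0 := by
  split_ifs with hn
  · subst hn
    rw [cycDim, bdDim, K.finrank_gr, K.gr_eq_bot (i := 0 + 1) (by rw [chi_one]; norm_num),
      Submodule.map_bot, finrank_bot, chi_zero]
    rw [show ((0 : ℕ) : ℤ) - ((0 : ℕ) : ℤ) = 0 from rfl, finrank_cz_zero (by omega) hR]
    simp [r]
  · have : (K.gr (0 + 1) (n : ℤ)).map (K.d hs hR 0) = K.gr 0 n := by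
      refine le_antisymm ?_ fun x hx => ?_
      · rintro _ ⟨x, hx, rfl⟩
        exact K.d_mem hs hR hx
      · exact K.exists_d_zero hs hR (by exact_mod_cast hn) hx
    rw [cycDim, bdDim, this, sub_self]

theorem exactAt_iff (i : ℕ) (n : ℤ) :
    K.ExactAt hs hR i n ↔ cycDim (fun i => K.gr i n) (K.d hs hR) (i + 1) =
      bdDim (fun i => K.gr i n) (K.d hs hR) (i + 1) :=
  (cycDim_eq_bdDim_iff (P := fun i => K.gr i n) (D := K.d hs hR)
    (fun _ hx => K.d_mem hs hR hx) (K.d_d hs hR i)).symm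

/-- The homology is k in degree 0 at K_0, zero at K_1, and zero beyond K_2 by hypothesis; only K_2
can contribute anything else. -/
theorem euler_eq (n : ℕ) (h : ∀ i ≥ 2, K.ExactAt hs hR i n) :
    K.euler n = (if n = 0 then 1 else 0) +
      ((cycDim (fun i => K.gr i n) (K.d hs hR) 2 : ℤ) -
        bdDim (fun i => K.gr i n) (K.d hs hR) 2) := by
  have h1 := sum_finrank_eq (fun i => K.gr i n) (K.d hs hR) (n + 2)
  have h2 : bdDim (fun i => K.gr i n) (K.d hs hR) (n + 2) = 0 := by
    rw [bdDim, K.gr_eq_bot (by have := le_chi hs (n + 2 + 1); omega), Submodule.map_bot,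
      finrank_bot]
  rw [h2, Nat.cast_zero, mul_zero, add_zero] at h1
  simp only [finrank_gr, Nat.cast_mul] at h1
  rw [euler, h1, Finset.sum_range_succ', Finset.sum_range_succ', Finset.sum_range_succ',
    Finset.sum_eq_zero, zero_add, K.cycDim_zero_sub_bdDim hs hR,
    (K.exactAt_iff hs hR 0 n).1 (K.exactAt_zero hs hR n)]
  · ring
  · intro i _
    rw [(K.exactAt_iff hs hR (i + 2) n).1 (h (i + 2) (by omega))]
    ring

theorem coeff_expand_hilbertSeries {B : Type u} [Ring B] [Algebra k B] (𝒜 : ℕ → Submodule k B)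
    {s : ℕ} (hs : s ≠ 0) {p N : ℕ} (hN : p < N) :
    PowerSeries.coeff p (PowerSeries.expand s hs (hilbertSeries 𝒜)) =
      ∑ j ∈ Finset.range N, if s * j = p then (Module.finrank k (𝒜 j) : ℤ) else 0 := by
  by_cases h : s ∣ p
  · obtain ⟨j, rfl⟩ := h
    rw [PowerSeries.coeff_expand_mul, Finset.sum_eq_single j]
    · simp [hilbertSeries]
    · intro i _ hij
      rw [if_neg]
      exact fun h => hij (Nat.eq_of_mul_eq_mul_left (Nat.pos_of_ne_zero hs) h)
    · intro hj
      exfalso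
      rw [Finset.mem_range, not_lt] at hj
      have := Nat.le_mul_of_pos_left j (Nat.pos_of_ne_zero hs)
      omega
  · rw [PowerSeries.coeff_expand_of_not_dvd _ _ _ h]
    refine (Finset.sum_eq_zero fun j _ => ?_).symm
    rw [if_neg]
    rintro rfl
    exact h ⟨j, rfl⟩

theorem sum_range_two_mul (g : ℕ → ℤ) (N : ℕ) :
    ∑ i ∈ Finset.range (2 * N), g i = ∑ j ∈ Finset.range N, (g (2 * j) + g (2 * j + 1)) := by
  induction N with
  | zero => simp
  | succ N ih => rw [mul_add, mul_one, Finset.sum_range_succ, Finset.sum_range_succ, ih,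
      Finset.sum_range_succ]; ring

theorem finrank_A (hs : 2 ≤ s) (hR : R ≤ homog k m s) (j : ℕ) : Module.finrank k (A s R j) = K.r (2 * j) := by
  have := finrank_comp_dualRel hR (K.b_li (2 * j)) (K.b_span hs (2 * j))
  rw [chi_even] at this
  exact this

theorem finrank_M (hs : 2 ≤ s) (hR : R ≤ homog k m s) (j : ℕ) : Module.finrank k (M s R j) = K.r (2 * j + 1) := by
  have := finrank_comp_dualRel hR (K.b_li (2 * j + 1)) (K.b_span hs (2 * j + 1))
  rw [chi_odd] at this
  exact this

theorem coeff_sub (hs : 2 ≤ s) (hR : R ≤ homog k m s) {p N : ℕ} (hN : p < N)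
    (hs0 : s ≠ 0) :
    PowerSeries.coeff p (PowerSeries.expand s hs0 (hilbertSeries (A s R))
          - PowerSeries.X * PowerSeries.expand s hs0 (hilbertSeries (M s R))) =
      ∑ i ∈ Finset.range (2 * N), if chi s i = p then (-1 : ℤ) ^ i * K.r i else 0 := by
  rw [sum_range_two_mul, Finset.sum_add_distrib, map_sub, sub_eq_add_neg,
    coeff_expand_hilbertSeries _ _ hN]
  congr 1
  · refine Finset.sum_congr rfl fun j _ => ?_
    rw [chi_even, K.finrank_A hs hR]
    simp
  · cases p with
    | zero =>
      rw [PowerSeries.coeff_zero_X_mul, neg_zero]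
      exact (Finset.sum_eq_zero fun j _ => by rw [chi_odd, if_neg (by omega)]).symm
    | succ p =>
      rw [PowerSeries.coeff_succ_X_mul, coeff_expand_hilbertSeries _ _ (by omega : p < N),
        ← Finset.sum_neg_distrib]
      refine Finset.sum_congr rfl fun j _ => ?_
      rw [chi_odd, K.finrank_M hs hR]
      by_cases h : s * j = p
      · simp [h, pow_succ]
      · rw [if_neg h, if_neg (by omega), neg_zero]

/-- The even terms of the complex come from A and the odd ones from M, so the first factor is the
signed generating function of the ranks placed in the degrees `chi s i`. -/
theorem coeff_hilbert (hs : 2 ≤ s) (hR : R ≤ homog k m s) (n : ℕ) (hs0 : s ≠ 0) :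
    PowerSeries.coeff n ((PowerSeries.expand s hs0 (hilbertSeries (A s R))
          - PowerSeries.X * PowerSeries.expand s hs0 (hilbertSeries (M s R)))
        * hilbertSeries (comp R)) = K.euler n := by
  rw [PowerSeries.coeff_mul]
  have h1 : ∀ p ∈ Finset.HasAntidiagonal.antidiagonal n,
      PowerSeries.coeff p.1 (PowerSeries.expand s hs0 (hilbertSeries (A s R))
          - PowerSeries.X * PowerSeries.expand s hs0 (hilbertSeries (M s R))) *
        PowerSeries.coeff p.2 (hilbertSeries (comp R)) =
      ∑ i ∈ Finset.range (2 * (n + 2)), if chi s i = p.1 then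
        (-1 : ℤ) ^ i * (K.r i * Module.finrank k (comp R p.2)) else 0 := by
    intro p hp
    rw [Finset.HasAntidiagonal.mem_antidiagonal] at hp
    rw [K.coeff_sub hs hR (N := n + 2) (by omega) hs0, Finset.sum_mul]
    refine Finset.sum_congr rfl fun i _ => ?_
    rw [hilbertSeries, PowerSeries.coeff_mk, ite_mul, zero_mul, mul_assoc]
  rw [Finset.sum_congr rfl h1, Finset.sum_comm]
  have h2 : ∀ i, (∑ p ∈ Finset.HasAntidiagonal.antidiagonal n, if chi s i = p.1 then
        (-1 : ℤ) ^ i * (K.r i * Module.finrank k (comp R p.2)) else 0) =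
      (-1 : ℤ) ^ i * (K.r i * Module.finrank k (cz R ((n : ℤ) - chi s i))) := by
    intro i
    by_cases h : chi s i ≤ n
    · rw [Finset.sum_eq_single (chi s i, n - chi s i)]
      · rw [if_pos rfl, ← Nat.cast_sub h, cz_natCast]
      · rintro ⟨a, b⟩ hab hne
        rw [Finset.HasAntidiagonal.mem_antidiagonal] at hab
        rw [if_neg]
        rintro rfl
        exact hne (Prod.ext rfl (by simp only at hab ⊢; omega))
      · intro h'
        exact absurd (Finset.HasAntidiagonal.mem_antidiagonal.2 (by simp only; omega)) h'
    · rw [Finset.sum_eq_zero, cz_of_neg (by omega), finrank_bot]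
      · simp
      · intro p hp
        rw [Finset.HasAntidiagonal.mem_antidiagonal] at hp
        rw [if_neg (by omega)]
  simp only [h2, euler]
  symm
  -- Grouping the terms in pairs produced a longer range than that of `euler`; the surplus terms are
  -- zero.
  refine Finset.sum_subset (fun i hi => ?_) fun i _ hi => ?_
  · rw [Finset.mem_range] at hi ⊢; omega
  · rw [Finset.mem_range, not_lt] at hi
    have := le_chi hs i
    rw [cz_of_neg (by omega), finrank_bot]
    simp

theorem hilbert_iff (hs : 2 ≤ s) (hR : R ≤ homog k m s) (hs0 : s ≠ 0) :
    (PowerSeries.expand s hs0 (hilbertSeries (A s R))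
          - PowerSeries.X * PowerSeries.expand s hs0 (hilbertSeries (M s R)))
        * hilbertSeries (comp R) = 1 ↔ ∀ n, K.euler n = if n = 0 then 1 else 0 := by
  rw [PowerSeries.ext_iff]
  refine forall_congr' fun n => ?_
  rw [K.coeff_hilbert hs hR, PowerSeries.coeff_one]

theorem koszulExactAtTwo_iff (hs1 : 1 ≤ s) :
    KoszulExactAtTwo R (s := s) hs1 ↔ ∀ n, K.ExactAt hs hR 1 n := by
  -- The dual bases have to live in the degrees as written in `dEven` and `dOdd`, not in the equal
  -- degrees `chi s i`.
  have e1 : s * 0 + 1 = chi s 1 := by rw [chi_one]; ring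
  have e2 : s * (0 + 1) + 0 = chi s 2 := by rw [chi_two]; ring
  have e3 : s * 1 + 1 = chi s 3 := by rw [chi_three]; ring
  obtain ⟨β₁, h₁⟩ := exists_dualBasis (n := s * 0 + 1) hR (K.b_li 1) (by rw [e1]; exact K.b_span hs 1)
  obtain ⟨β₂, h₂⟩ := exists_dualBasis (n := s * (0 + 1) + 0) hR (K.b_li 2)
    (by rw [e2]; exact K.b_span hs 2)
  obtain ⟨β₃, h₃⟩ := exists_dualBasis (n := s * 1 + 1) hR (K.b_li 3) (by rw [e3]; exact K.b_span hs 3)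
  have hd₁ : ∀ t, coordEquiv β₁ (dOdd R hs1 0 t) = K.d hs hR 1 (coordEquiv β₂ t) := by
    intro t
    refine coordEquiv_koszulMap _ (fun a => ?_) (fun a c => ?_) (K.b_succ hs hR 1) h₁ h₂ t
    · rw [e1]; exact K.b_mem hs hR 1 a
    · have := K.μ_mem hs hR 1 a c
      rwa [chi_one, chi_two] at this
  have hd₂ : ∀ t, coordEquiv β₂ (dEven s R 1 t) = K.d hs hR 2 (coordEquiv β₃ t) := by
    intro t
    refine coordEquiv_koszulMap (p := s * 1 + 0) _ (fun a => ?_) (fun a c => ?_) (K.b_succ hs hR 2)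
      h₂ h₃ t
    · have := K.b_mem hs hR 2 a
      rw [← e2] at this
      exact this
    · have := K.μ_mem hs hR 2 a c
      rwa [chi_two, chi_three, Nat.add_sub_cancel_left] at this
  have hz : ∀ t, K.d hs hR 1 (coordEquiv β₂ t) = 0 ↔ dOdd R hs1 0 t = 0 := fun t =>
    ⟨fun h => (coordEquiv β₁).injective ((hd₁ t).trans (h.trans (map_zero _).symm)),
      fun h => (hd₁ t).symm.trans ((congrArg _ h).trans (map_zero _))⟩
  have hr : ∀ t, coordEquiv β₂ t ∈ Set.range (K.d hs hR 2) ↔ t ∈ Set.range (dEven s R 1) := by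
    refine fun t => ⟨?_, ?_⟩
    · rintro ⟨y, hy⟩
      obtain ⟨y, rfl⟩ := (coordEquiv β₃).surjective y
      exact ⟨y, (coordEquiv β₂).injective ((hd₂ y).trans hy)⟩
    · rintro ⟨y, rfl⟩
      exact ⟨coordEquiv β₃ y, (hd₂ y).symm⟩
  have key : KoszulExactAtTwo R (s := s) hs1 ↔
      Function.Exact (K.d hs hR 2) (K.d hs hR 1) := by
    constructor
    · intro h x
      obtain ⟨t, rfl⟩ := (coordEquiv β₂).surjective x
      exact (hz t).trans ((h t).trans (hr t).symm)
    · intro h t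
      exact (hz t).symm.trans ((h _).trans (hr t))
  rw [key]
  exact ⟨fun h n => exactAt_of_exact h n, fun h => exact_of_exactAt h⟩

/-- Exactness in the second term, in degrees less than `n`, forces exactness in the higher terms
in degree `n`. -/
def Determined : Prop :=
  ∀ n : ℤ, (∀ n' < n, K.ExactAt hs hR 1 n') → ∀ i ≥ 2, K.ExactAt hs hR i n

variable {K hs hR} in
-- Induction on the degree: exactness at K_2 below degree `N` gives exactness beyond K_2 in degree
-- `N`, after which the Euler characteristic there measures precisely the homology at K_2.
theorem exactAt_one_of_euler (hK : K.Determined hs hR)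
    (h : ∀ n, K.euler n = if n = 0 then 1 else 0) (n : ℤ) : K.ExactAt hs hR 1 n := by
  have key : ∀ N : ℕ, ∀ n < (N : ℤ), K.ExactAt hs hR 1 n := by
    intro N
    induction N with
    | zero =>
      intro n hn x hx _
      rw [K.gr_eq_bot (by omega), Submodule.mem_bot] at hx
      exact ⟨0, zero_mem _, by rw [map_zero, hx]⟩
    | succ N ih =>
      intro n hn
      rcases (by omega : n < N ∨ n = N) with h1 | rfl
      · exact ih n h1
      · have := K.euler_eq hs hR N (hK N ih)
        rw [h N, left_eq_add, sub_eq_zero] at this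
        exact (K.exactAt_iff hs hR 1 N).2 (by exact_mod_cast this)
  exact key (n.toNat + 1) n (by omega)

variable {K hs hR} in
theorem euler_of_exactAt_one (hK : K.Determined hs hR) (h : ∀ n, K.ExactAt hs hR 1 n) (n : ℕ) :
    K.euler n = if n = 0 then 1 else 0 := by
  rw [K.euler_eq hs hR n (hK n fun n' _ => h n'), (K.exactAt_iff hs hR 1 n).1 (h n)]
  simp

end KData

end Hilbert

end HomogAlg

end

noncomputable section

namespace HomogAlg

/-! ### An exact Koszul complex gives s-Koszulness -/

section Resolution

variable {k : Type u} [Field k] {m s : ℕ} {R : Submodule k (Free k m)}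

/-- The algebra as a free right module of rank one. -/
def opEquiv (B : Type*) [Ring B] : Bᵐᵒᵖ ≃ₗ[Bᵐᵒᵖ] B where
  toFun := MulOpposite.unop
  map_add' _ _ := rfl
  map_smul' _ _ := rfl
  invFun := MulOpposite.op
  left_inv _ := rfl
  right_inv _ := rfl

instance (r : ℕ) : Module.Projective (QuotAlg R)ᵐᵒᵖ (Fin r → QuotAlg R) :=
  have : Module.Free (QuotAlg R)ᵐᵒᵖ (QuotAlg R) := Module.Free.of_equiv (opEquiv (QuotAlg R))
  inferInstance

theorem mem_J_of_mem_cz {j : ℤ} (hj : 0 < j) {a : QuotAlg R} (ha : a ∈ cz R j) : a ∈ J R := by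
  lift j to ℕ using hj.le
  rw [cz_natCast] at ha
  exact Submodule.subset_span ⟨j, by exact_mod_cast hj, ha⟩

theorem mul_mem_J_of_mem_cz {j : ℤ} (hj : 0 < j) (b : QuotAlg R) {a : QuotAlg R}
    (ha : a ∈ cz R j) : b * a ∈ J R := by
  induction b using homogeneous_induction with
  | mem n x hx =>
    rw [← cz_natCast] at hx
    exact mem_J_of_mem_cz (by omega) (mul_mem_cz hx ha)
  | zero => rw [zero_mul]; exact zero_mem _
  | add x y hx hy => rw [add_mul]; exact add_mem hx hy

theorem op_smul_triv {j : ℤ} (hj : 0 < j) {a : QuotAlg R} (ha : a ∈ cz R j) (t : Triv R) :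
    MulOpposite.op a • t = 0 := by
  obtain ⟨b, rfl⟩ := Submodule.mkQ_surjective _ t
  rw [← map_smul]
  exact (Submodule.Quotient.mk_eq_zero _).2 (mul_mem_J_of_mem_cz hj b ha)

theorem augQ_of_mem_J (hs : s ≠ 0) (hR : R ≤ homog k m s) {a : QuotAlg R} (ha : a ∈ J R) :
    augQ hs hR a = 0 := by
  induction ha using Submodule.span_induction with
  | mem x hx =>
    obtain ⟨n, hn, hx⟩ := hx
    rw [← cz_natCast] at hx
    exact augQ_of_mem hs hR (by omega) hx
  | zero => exact map_zero _
  | add x y _ _ hx hy => rw [map_add, hx, hy, add_zero]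
  | smul c x _ hx =>
    change augQ hs hR (x * c.unop) = 0
    rw [map_mul, hx, zero_mul]

namespace KData

variable (K : KData s R) (hs : 2 ≤ s) (hR : R ≤ homog k m s)

/-- The differentials of the generalized Koszul complex as maps of right modules. -/
def dS (i : ℕ) :
    (Fin (K.r (i + 1)) → QuotAlg R) →ₗ[(QuotAlg R)ᵐᵒᵖ] (Fin (K.r i) → QuotAlg R) where
  toFun := K.d hs hR i
  map_add' := map_add _
  map_smul' c x := by
    ext a
    simp only [d_apply, RingHom.id_apply, Pi.smul_apply, Finset.smul_sum]
    exact Finset.sum_congr rfl fun j _ => (mul_assoc _ _ _).symm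

theorem dS_apply (i : ℕ) (x : Fin (K.r (i + 1)) → QuotAlg R) :
    K.dS hs hR i x = K.d hs hR i x := rfl

/-- The augmentation of the generalized Koszul complex. -/
def εS : (Fin (K.r 0) → QuotAlg R) →ₗ[(QuotAlg R)ᵐᵒᵖ] Triv R :=
  (J R).mkQ.comp (LinearMap.proj (0 : Fin 1))

theorem εS_apply (x : Fin (K.r 0) → QuotAlg R) : K.εS x = (J R).mkQ (x (0 : Fin 1)) := rfl

theorem εS_surjective : Function.Surjective K.εS := by
  intro t
  obtain ⟨b, rfl⟩ := Submodule.mkQ_surjective _ t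
  exact ⟨fun _ => b, rfl⟩

theorem εS_of_mem {j : ℤ} (hj : j ≠ 0) {x : Fin (K.r 0) → QuotAlg R} (hx : x ∈ K.gr 0 j) :
    K.εS x = 0 := by
  have h := K.mem_gr.1 hx (0 : Fin 1)
  rw [chi_zero, Nat.cast_zero, sub_zero] at h
  rw [εS_apply]
  rcases lt_or_gt_of_ne hj with h1 | h1
  · rw [cz_of_neg h1, Submodule.mem_bot] at h
    rw [h, map_zero]
  · exact (Submodule.Quotient.mk_eq_zero _).2 (mem_J_of_mem_cz h1 h)

theorem exact_εS : Function.Exact (K.dS hs hR 0) K.εS := by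
  intro x
  constructor
  · intro hx
    have hxJ : x (0 : Fin 1) ∈ J R := (Submodule.Quotient.mk_eq_zero _).1 hx
    have hle : J R ≤ (LinearMap.range (K.dS hs hR 0)).map
        (LinearMap.proj (R := (QuotAlg R)ᵐᵒᵖ) (φ := fun _ : Fin (K.r 0) => QuotAlg R)
          (0 : Fin 1)) := by
      unfold J
      rw [Submodule.span_le]
      rintro a ⟨n, hn, ha⟩
      rw [← cz_natCast] at ha
      obtain ⟨y, -, hy⟩ := K.exists_d_zero hs hR (n := n) (by omega) (x := fun _ => a)
        (K.mem_gr.2 fun _ => by rwa [chi_zero, Nat.cast_zero, sub_zero])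
      exact ⟨_, ⟨y, hy⟩, rfl⟩
    obtain ⟨_, ⟨y, rfl⟩, hy⟩ := hle hxJ
    refine ⟨y, ?_⟩
    ext (a : Fin 1)
    rw [Subsingleton.elim a 0]
    exact hy
  · rintro ⟨y, rfl⟩
    refine (Submodule.Quotient.mk_eq_zero _).2 ?_
    change K.d hs hR 0 y (0 : Fin 1) ∈ J R
    rw [show K.d hs hR 0 y (0 : Fin 1) = _ from K.d_zero_apply hs hR y (0 : Fin 1)]
    refine Submodule.sum_mem _ fun i _ => ?_
    exact (J R).smul_mem (MulOpposite.op (y i))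
      (Submodule.subset_span ⟨1, one_pos, proj_mem_comp (ι_mem i)⟩)

theorem op_smul_mem {i n : ℕ} {j : ℤ} {a : QuotAlg R} (ha : a ∈ comp R n)
    {x : Fin (K.r i) → QuotAlg R} (hx : x ∈ K.gr i j) : MulOpposite.op a • x ∈ K.gr i (j + n) := by
  refine K.mem_gr.2 fun c => ?_
  rw [← cz_natCast] at ha
  have := mul_mem_cz (K.mem_gr.1 hx c) ha
  rwa [show j - chi s i + n = j + n - chi s i by ring] at this

theorem hp_op_smul {i n : ℕ} (j : ℤ) {a : QuotAlg R} (ha : a ∈ comp R n)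
    (x : Fin (K.r i) → QuotAlg R) :
    K.hp hR i j (MulOpposite.op a • x) = MulOpposite.op a • K.hp hR i (j - n) x := by
  rw [← cz_natCast] at ha
  ext c
  rw [hp_apply]
  change hz hR _ (x c * a) = hz hR _ (x c) * a
  rw [hz_mul_right hR ha]
  congr 3
  ring

theorem isInternal_gr (hR : R ≤ homog k m s) (i : ℕ) :
    DirectSum.IsInternal fun j => (K.gr i j).toAddSubgroup := by
  constructor
  · rw [injective_iff_map_eq_zero]
    intro x hx
    have key : ∀ n, K.hp hR i n (DirectSum.coeAddMonoidHom
        (fun j => (K.gr i j).toAddSubgroup) x) = x n := by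
      clear hx
      intro n
      induction x using DirectSum.induction_on with
      | zero => simp
      | of j y =>
        rw [DirectSum.coeAddMonoidHom_of, K.hp_of_mem hR y.2]
        by_cases h : j = n
        · subst h; rw [if_pos rfl, DirectSum.of_eq_same]
        · rw [if_neg h, DirectSum.of_eq_of_ne _ _ _ (Ne.symm h)]; rfl
      | add x y hx hy => rw [map_add, map_add, hx, hy]; rfl
    ext n : 1
    apply Subtype.ext
    rw [← key n, hx, map_zero]
    rfl
  · intro x
    obtain ⟨S, -, hS⟩ := K.exists_hp_sum hR i x
    refine ⟨∑ n ∈ S, DirectSum.of (fun j => (K.gr i j).toAddSubgroup) n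
      ⟨K.hp hR i n x, K.hp_mem hR i n x⟩, ?_⟩
    rw [map_sum]
    simp only [DirectSum.coeAddMonoidHom_of]
    exact hS

/-- The generalized Koszul complex as a resolution. -/
def res (hE : ∀ i, Function.Exact (K.d hs hR (i + 1)) (K.d hs hR i)) : GradedProjRes R where
  P i := Fin (K.r i) → QuotAlg R
  gr i j := (K.gr i j).toAddSubgroup
  isInternal i := K.isInternal_gr hR i
  smul_mem _ _ _ _ _ ha hp := K.op_smul_mem ha hp
  projective _ := inferInstance
  d i := K.dS hs hR i
  d_mem _ _ _ hp := K.d_mem hs hR hp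
  ε := K.εS
  ε_degree _ _ hj hp := K.εS_of_mem hj hp
  ε_surjective := K.εS_surjective
  exact_zero := K.exact_εS hs hR
  exact_succ i := hE i

theorem eq_sum_op_smul_single {i : ℕ} (x : Fin (K.r i) → QuotAlg R) :
    x = ∑ c, MulOpposite.op (x c) • (Pi.single c 1 : Fin (K.r i) → QuotAlg R) := by
  ext a
  rw [Finset.sum_apply, Finset.sum_eq_single a]
  · simp
  · intro c _ hc
    simp [Pi.single_eq_of_ne (Ne.symm hc)]
  · simp

/-- The `i`-th term is generated in the single degree `chi s i`, so already the cochains, not merely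
their cohomology, vanish in all other degrees. -/
theorem eq_zero_of_cochain {i : ℕ} {e : ℤ} (he : (chi s i : ℤ) ≠ -e)
    {φ : (Fin (K.r i) → QuotAlg R) →ₗ[(QuotAlg R)ᵐᵒᵖ] Triv R}
    (hφ : ∀ (j : ℤ) (p : Fin (K.r i) → QuotAlg R), j ≠ -e → p ∈ K.gr i j → φ p = 0) : φ = 0 := by
  refine LinearMap.ext fun x => ?_
  rw [K.eq_sum_op_smul_single x, map_sum, LinearMap.zero_apply]
  refine Finset.sum_eq_zero fun c _ => ?_
  rw [map_smul, hφ (chi s i) _ he, smul_zero]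
  refine K.mem_gr.2 fun a => ?_
  rw [sub_self]
  by_cases h : a = c
  · subst h; rw [Pi.single_eq_same]; exact one_mem_cz
  · rw [Pi.single_eq_of_ne h]; exact zero_mem _

theorem isSKoszul_of_exact (hE : ∀ i, Function.Exact (K.d hs hR (i + 1)) (K.d hs hR i)) :
    IsSKoszul R s := by
  refine ⟨K.res hs hR hE, fun i e he => ?_⟩
  have : Subsingleton ((K.res hs hR hE).cocycles i e) := by
    refine ⟨?_⟩
    have key : ∀ φ ∈ (K.res hs hR hE).cochains i e, φ = 0 := fun φ hφ =>
      K.eq_zero_of_cochain (e := e) (by omega) hφ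
    rintro ⟨φ, hφ⟩ ⟨ψ, hψ⟩
    exact Subtype.ext ((key φ hφ.1).trans (key ψ hψ.1).symm)
  exact Quotient.instSubsingletonQuotient _

end KData

end Resolution

end HomogAlg

end

noncomputable section

namespace HomogAlg

/-! ### From s-Koszulness to exactness at the second term -/

section Comparison

variable {k : Type u} [Field k] {m s : ℕ} {R : Submodule k (Free k m)}

/-- A map out of a projective module lifts along a map whose range contains its range. -/
theorem exists_lift_of_range_le {S P A B : Type*} [Ring S] [AddCommGroup P] [Module S P]
    [Module.Projective S P] [AddCommGroup A] [Module S A] [AddCommGroup B] [Module S B]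
    (f : A →ₗ[S] B) (g : P →ₗ[S] B) (h : ∀ p, g p ∈ Set.range f) :
    ∃ t : P →ₗ[S] A, ∀ p, f (t p) = g p := by
  obtain ⟨t, ht⟩ := Module.projective_lifting_property f.rangeRestrict
    (g.codRestrict (LinearMap.range f) h) f.surjective_rangeRestrict
  exact ⟨t, fun p => congrArg Subtype.val (LinearMap.congr_fun ht p)⟩

theorem GradedProjRes.gr_induction (Q : GradedProjRes R) (i : ℕ) {p : Q.P i → Prop} (x : Q.P i)
    (mem : ∀ j, ∀ y ∈ Q.gr i j, p y) (zero : p 0) (add : ∀ x y, p x → p y → p (x + y)) : p x := by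
  obtain ⟨x, rfl⟩ := (Q.isInternal i).2 x
  induction x using DirectSum.induction_on with
  | zero => rw [map_zero]; exact zero
  | of j y => rw [DirectSum.coeAddMonoidHom_of]; exact mem j _ y.2
  | add x y hx hy => rw [map_add]; exact add _ _ hx hy

namespace KData

variable (K : KData s R) (hs : 2 ≤ s) (hR : R ≤ homog k m s)

/-- The degree zero part of a map from a graded projective resolution to a term of the
generalized Koszul complex. -/
theorem exists_degree_zero_part (Q : GradedProjRes R) (i l : ℕ)
    (t : Q.P i →ₗ[(QuotAlg R)ᵐᵒᵖ] (Fin (K.r l) → QuotAlg R)) :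
    ∃ t' : Q.P i →ₗ[(QuotAlg R)ᵐᵒᵖ] (Fin (K.r l) → QuotAlg R),
      ∀ j, ∀ p ∈ Q.gr i j, t' p = K.hp hR l j (t p) := by
  let E := AddEquiv.ofBijective _ (Q.isInternal i)
  let F : (DirectSum ℤ fun j => Q.gr i j) →+ (Fin (K.r l) → QuotAlg R) :=
    DirectSum.toAddMonoid fun j =>
      ((K.hp hR l j).toAddMonoidHom.comp t.toAddMonoidHom).comp (Q.gr i j).subtype
  let G : Q.P i →+ (Fin (K.r l) → QuotAlg R) := F.comp E.symm.toAddMonoidHom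
  have hG : ∀ j, ∀ p ∈ Q.gr i j, G p = K.hp hR l j (t p) := by
    intro j p hp
    have h1 : E.symm p = DirectSum.of (fun j => Q.gr i j) j ⟨p, hp⟩ := by
      rw [AddEquiv.symm_apply_eq]
      exact (DirectSum.coeAddMonoidHom_of (Q.gr i) j ⟨p, hp⟩).symm
    change F (E.symm p) = _
    rw [h1, DirectSum.toAddMonoid_of]
    rfl
  refine ⟨{ G with map_smul' := ?_ }, hG⟩
  intro c p
  change G (c • p) = c • G p
  obtain ⟨a, rfl⟩ := MulOpposite.op_surjective c
  induction a using homogeneous_induction with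
  | mem n a ha =>
    induction p using Q.gr_induction i with
    | mem j p hp =>
      rw [hG _ _ (Q.smul_mem i n j a p ha hp), hG _ _ hp, map_smul, K.hp_op_smul hR _ ha,
        add_sub_cancel_right]
    | zero => simp
    | add x y hx hy => rw [smul_add, map_add, hx, hy, map_add, smul_add]
  | zero => simp
  | add x y hx hy => rw [MulOpposite.op_add, add_smul, map_add, hx, hy, add_smul]

theorem εS_hp_zero (x : Fin (K.r 0) → QuotAlg R) : K.εS (K.hp hR 0 0 x) = K.εS x := by
  obtain ⟨S, hS0, hS⟩ := K.exists_hp_sum hR 0 x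
  conv_rhs => rw [← hS, map_sum]
  rw [Finset.sum_eq_single 0]
  · intro j _ hj
    exact K.εS_of_mem hj (K.hp_mem hR 0 j x)
  · intro h
    rw [hS0 0 h, map_zero]

/-- The start of a graded map from a graded projective resolution to the generalized Koszul
complex. -/
theorem exists_comparison (Q : GradedProjRes R) :
    ∃ (α₀ : Q.P 0 →ₗ[(QuotAlg R)ᵐᵒᵖ] (Fin (K.r 0) → QuotAlg R))
      (α₁ : Q.P 1 →ₗ[(QuotAlg R)ᵐᵒᵖ] (Fin (K.r 1) → QuotAlg R))
      (α₂ : Q.P 2 →ₗ[(QuotAlg R)ᵐᵒᵖ] (Fin (K.r 2) → QuotAlg R)),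
      (∀ p, K.εS (α₀ p) = Q.ε p) ∧ (∀ p, K.d hs hR 0 (α₁ p) = α₀ (Q.d 0 p)) ∧
      (∀ p, K.d hs hR 1 (α₂ p) = α₁ (Q.d 1 p)) ∧ ∀ j, ∀ p ∈ Q.gr 2 j, α₂ p ∈ K.gr 2 j := by
  have := Q.projective
  obtain ⟨t₀, ht₀⟩ := exists_lift_of_range_le K.εS Q.ε fun p => K.εS_surjective _
  obtain ⟨α₀, hα₀⟩ := K.exists_degree_zero_part hR Q 0 0 t₀
  have g₀ : ∀ j, ∀ p ∈ Q.gr 0 j, α₀ p ∈ K.gr 0 j := fun j p hp => by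
    rw [hα₀ j p hp]; exact K.hp_mem hR _ _ _
  have h₀ : ∀ p, K.εS (α₀ p) = Q.ε p := by
    intro p
    induction p using Q.gr_induction 0 with
    | mem j p hp =>
      by_cases hj : j = 0
      · subst hj
        rw [hα₀ 0 p hp, εS_hp_zero, ht₀]
      · rw [K.εS_of_mem hj (g₀ j p hp), Q.ε_degree j p hj hp]
    | zero => simp
    | add x y hx hy => rw [map_add, map_add, hx, hy, map_add]
  obtain ⟨t₁, ht₁⟩ := exists_lift_of_range_le (K.dS hs hR 0) (α₀.comp (Q.d 0)) fun p =>
    (K.exact_εS hs hR _).1 (by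
      rw [LinearMap.comp_apply, h₀]
      exact (Q.exact_zero _).2 ⟨p, rfl⟩)
  obtain ⟨α₁, hα₁⟩ := K.exists_degree_zero_part hR Q 1 1 t₁
  have g₁ : ∀ j, ∀ p ∈ Q.gr 1 j, α₁ p ∈ K.gr 1 j := fun j p hp => by
    rw [hα₁ j p hp]; exact K.hp_mem hR _ _ _
  have h₁ : ∀ p, K.d hs hR 0 (α₁ p) = α₀ (Q.d 0 p) := by
    intro p
    induction p using Q.gr_induction 1 with
    | mem j p hp =>
      rw [hα₁ j p hp, ← hp_d, ← dS_apply, ht₁, LinearMap.comp_apply,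
        K.hp_of_mem hR (g₀ j _ (Q.d_mem 0 j p hp)), if_pos rfl]
    | zero => simp
    | add x y hx hy => rw [map_add, map_add, hx, hy, map_add, map_add]
  obtain ⟨t₂, ht₂⟩ := exists_lift_of_range_le (K.dS hs hR 1) (α₁.comp (Q.d 1)) fun p =>
    (K.exact_zero hs hR _).1 (by
      rw [LinearMap.comp_apply, h₁, (Q.exact_succ 0 _).2 ⟨p, rfl⟩, map_zero])
  obtain ⟨α₂, hα₂⟩ := K.exists_degree_zero_part hR Q 2 2 t₂
  refine ⟨α₀, α₁, α₂, h₀, h₁, fun p => ?_, fun j p hp => ?_⟩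
  · induction p using Q.gr_induction 2 with
    | mem j p hp =>
      rw [hα₂ j p hp, ← hp_d, ← dS_apply, ht₂, LinearMap.comp_apply,
        K.hp_of_mem hR (g₁ j _ (Q.d_mem 1 j p hp)), if_pos rfl]
    | zero => simp
    | add x y hx hy => rw [map_add, map_add, hx, hy, map_add, map_add]
  · rw [hα₂ j p hp]; exact K.hp_mem hR _ _ _

/-- If `Ext³` vanishes in degree `-n`, then the module of second syzygies has no nonzero maps of
degree `-n` to `k`. -/
theorem eq_zero_of_subsingleton_ext (Q : GradedProjRes R) {n : ℤ}
    (hQ : Subsingleton (Q.ExtComp 3 (-n))) (hn : (s : ℤ) < n)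
    (φ : LinearMap.ker (K.dS hs hR 1) →ₗ[(QuotAlg R)ᵐᵒᵖ] Triv R)
    (hφ : ∀ j, j ≠ n → ∀ z : LinearMap.ker (K.dS hs hR 1), z.1 ∈ K.gr 2 j → φ z = 0)
    (z : LinearMap.ker (K.dS hs hR 1)) (hz : z.1 ∈ K.gr 2 n) : φ z = 0 := by
  have := Q.projective
  obtain ⟨α₀, α₁, α₂, h₀, h₁, h₂, g₂⟩ := K.exists_comparison hs hR Q
  have hdd : ∀ i p, Q.d i (Q.d (i + 1) p) = 0 := fun i p => (Q.exact_succ i _).2 ⟨p, rfl⟩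
  -- The comparison map sends boundaries of `Q.P 2` to second syzygies, so `φ` pulls back to a
  -- 3-cocycle of degree `-n`, which is a coboundary `ψ ∘ d` by hypothesis.
  let α₃ : Q.P 3 →ₗ[(QuotAlg R)ᵐᵒᵖ] LinearMap.ker (K.dS hs hR 1) :=
    (α₂.comp (Q.d 2)).codRestrict _ fun p => by
      rw [LinearMap.mem_ker, dS_apply, LinearMap.comp_apply, h₂, hdd, map_zero]
  have hc : φ.comp α₃ ∈ Q.cocycles 3 (-n) := by
    refine ⟨fun j p hj hp => ?_, ?_⟩
    · exact hφ j (by simpa using hj) _ (g₂ j _ (Q.d_mem 2 j p hp))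
    · change Q.coboundary 3 (φ.comp α₃) = 0
      refine LinearMap.ext fun p => ?_
      have : α₃ (Q.d 3 p) = 0 := Subtype.ext (by
        change α₂ (Q.d 2 (Q.d 3 p)) = 0
        rw [hdd, map_zero])
      change φ (α₃ (Q.d 3 p)) = 0
      rw [this, map_zero]
  obtain ⟨ψ, -, hψ⟩ : φ.comp α₃ ∈ Q.coboundaries 3 (-n) := by
    have := (QuotientAddGroup.eq_zero_iff (N := (Q.coboundaries 3 (-n)).addSubgroupOf
      (Q.cocycles 3 (-n))) ⟨_, hc⟩).1 (Subsingleton.elim _ _)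
    exact AddSubgroup.mem_addSubgroupOf.1 this
  have hψ' : ∀ p, ψ (Q.d 2 p) = φ (α₃ p) := fun p => LinearMap.congr_fun hψ p
  -- For the comparison in the opposite direction no grading is needed.
  obtain ⟨β₀, hβ₀⟩ := exists_lift_of_range_le Q.ε K.εS fun p => Q.ε_surjective _
  obtain ⟨β₁, hβ₁⟩ := exists_lift_of_range_le (Q.d 0) (β₀.comp (K.dS hs hR 0)) fun p =>
    (Q.exact_zero _).1 (by
      rw [LinearMap.comp_apply, hβ₀]
      exact (K.exact_εS hs hR _).2 ⟨p, rfl⟩)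
  obtain ⟨β₂, hβ₂⟩ := exists_lift_of_range_le (Q.d 1) (β₁.comp (K.dS hs hR 1)) fun p =>
    (Q.exact_succ 0 _).1 (by
      rw [LinearMap.comp_apply, hβ₁, LinearMap.comp_apply, dS_apply, dS_apply, K.d_d, map_zero])
  -- A homotopy from the composite `α ∘ β` to the identity. Exactness at K_2 is not available, so it
  -- stops there, and `θ` records the remaining defect, with values in the syzygies.
  obtain ⟨η₀, hη₀⟩ := exists_lift_of_range_le (K.dS hs hR 0) (α₀.comp β₀ - LinearMap.id)
    fun p => (K.exact_εS hs hR _).1 (by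
      rw [LinearMap.sub_apply, LinearMap.comp_apply, LinearMap.id_apply, map_sub, h₀, hβ₀,
        sub_self])
  obtain ⟨η₁, hη₁⟩ := exists_lift_of_range_le (K.dS hs hR 1)
    (α₁.comp β₁ - LinearMap.id - η₀.comp (K.dS hs hR 0)) fun p => (K.exact_zero hs hR _).1 (by
      have h := hη₀ (K.dS hs hR 0 p)
      have h' := hβ₁ p
      simp only [LinearMap.sub_apply, LinearMap.comp_apply, LinearMap.id_apply, dS_apply,
        map_sub] at h h' ⊢
      rw [h, h₁, h']
      abel)
  let θ : (Fin (K.r 2) → QuotAlg R) →ₗ[(QuotAlg R)ᵐᵒᵖ] LinearMap.ker (K.dS hs hR 1) :=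
    (α₂.comp β₂ - LinearMap.id - η₁.comp (K.dS hs hR 1)).codRestrict _ fun p => by
      have h := hη₁ (K.dS hs hR 1 p)
      have h' := hβ₂ p
      simp only [LinearMap.sub_apply, LinearMap.comp_apply, LinearMap.id_apply, dS_apply,
        LinearMap.mem_ker, map_sub] at h h' ⊢
      rw [h, h₂, h', K.d_d, map_zero]
      abel
  -- On a syzygy `z` one has `β₂ z = d p` and `α₃ p = θ z + z`, so `Ψ` extends `φ` from the syzygies
  -- to the whole free module.
  let Ψ : (Fin (K.r 2) → QuotAlg R) →ₗ[(QuotAlg R)ᵐᵒᵖ] Triv R := ψ.comp β₂ - φ.comp θ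
  have hΨ : φ z = Ψ z.1 := by
    have hz0 : K.dS hs hR 1 z.1 = 0 := z.2
    obtain ⟨p, hp⟩ := (Q.exact_succ 1 (β₂ z.1)).1 (by
      rw [hβ₂, LinearMap.comp_apply, hz0, map_zero])
    have h5 : α₃ p = θ z.1 + z := Subtype.ext (by
      change α₂ (Q.d 2 p) = (α₂ (β₂ z.1) - z.1 - η₁ (K.dS hs hR 1 z.1)) + z.1
      rw [hp, hz0, map_zero]
      abel)
    change φ z = ψ (β₂ z.1) - φ (θ z.1)
    rw [← hp, hψ', h5, map_add]
    abel
  rw [hΨ, K.eq_sum_op_smul_single z.1, map_sum]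
  refine Finset.sum_eq_zero fun c _ => ?_
  rw [map_smul]
  -- The coordinates of `z` have degree `n - s > 0` and hence act as zero on k.
  refine op_smul_triv (j := n - s) (by omega) ?_ _
  have := K.mem_gr.1 hz c
  rwa [chi_two] at this

/-- In degree `s` a cycle is a linear dependence between the relations; below it the term is zero.
-/
theorem exactAt_one_of_le {n : ℤ} (hn : n ≤ s) : K.ExactAt hs hR 1 n := by
  intro x hx hx0
  have hf := fun j => hR (K.f_mem j)
  suffices x = 0 by exact ⟨0, zero_mem _, by rw [map_zero, this]⟩
  rcases hn.lt_or_eq with hn | rfl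
  · rwa [K.gr_eq_bot (by rw [chi_two]; exact hn), Submodule.mem_bot] at hx
  · have hx' : ∀ j : Fin 2, ∃ c : k, x j = algebraMap k _ c := by
      intro j
      have := K.mem_gr.1 hx j
      rw [chi_two, sub_self] at this
      exact exists_algebraMap_of_mem_cz_zero this
    choose c hc using hx'
    obtain ⟨s, rfl⟩ : ∃ s', s = s' + 1 := ⟨s - 1, by omega⟩
    have hmem : ∑ j, c j • K.f j ∈ homog k m (s + 1) :=
      Submodule.sum_mem _ fun j _ => Submodule.smul_mem _ _ (hf j)
    have h0 : ∑ j, c j • K.f j = 0 := by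
      refine eq_zero_of_lc hmem fun i => eq_zero_of_proj_eq_zero (by omega) hf K.f_span.symm
        (Nat.lt_succ_self s) (lcon_mem _ hmem) ?_
      have h1 := (K.d_one_apply hs hR x i).symm.trans (congrFun hx0 i)
      rw [map_sum, map_sum]
      refine Eq.trans (Finset.sum_congr rfl fun j _ => ?_) h1
      rw [hc j, map_smul, map_smul, Algebra.smul_def, Algebra.commutes]
    have h2 := Fintype.linearIndependent_iff.1 K.f_li c h0
    ext (j : Fin 2)
    rw [hc j, h2 j, map_zero]; rfl

/-- A cycle in degree `s + 1` is an element of RV ∩ VR, and K_3 is generated by just this space. -/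
theorem exactAt_one_succ : K.ExactAt hs hR 1 (s + 1 : ℤ) := by
  intro x hx hx0
  have hf := fun j => hR (K.f_mem j)
  have hx' : ∀ j : Fin 2, ∃ t ∈ homog k m 1, proj R t = x j := by
    intro j
    have := K.mem_gr.1 hx j
    rw [chi_two, add_sub_cancel_left] at this
    rw [show (1 : ℤ) = ((1 : ℕ) : ℤ) from rfl, cz_natCast] at this
    exact this
  choose t ht htx using hx'
  have hmem : ∑ j, K.f j * t j ∈ homog k m (s + 1) :=
    Submodule.sum_mem _ fun j _ => homog_mul (hf j) (ht j)
  have hW : ∑ j, K.f j * t j ∈ W s R (chi s 3) := by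
    rw [chi_three, W_succ le_rfl, W_self]
    refine ⟨Submodule.sum_mem _ fun j _ => Submodule.mul_mem_mul (K.f_mem j) (ht j), ?_⟩
    refine mem_homog_one_mul hmem fun i => mem_of_proj_eq_zero (by omega) hf K.f_span.symm
      (lcon_mem _ hmem) ?_
    have h1 := (K.d_one_apply hs hR x i).symm.trans (congrFun hx0 i)
    rw [map_sum, map_sum]
    refine Eq.trans (Finset.sum_congr rfl fun j _ => ?_) h1
    rw [lcon_mul, aug_eq_zero_of_mem (by omega) (hf j), zero_smul, add_zero, map_mul, htx]
  rw [← K.b_span hs 3, Submodule.mem_span_range_iff_exists_fun] at hW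
  obtain ⟨y, hy⟩ := hW
  have key : ∀ j : Fin (K.r 2), t j - ∑ c, y c • K.μ hs hR 2 j c = 0 := by
    refine eq_zero_of_sum_mul_eq_zero (K.b_li 2) (K.b_mem hs hR 2)
      (t := fun j : Fin (K.r 2) => t j - ∑ c, y c • K.μ hs hR 2 j c) ?_
    simp only [mul_sub, Finset.sum_sub_distrib]
    rw [show ∑ j, K.b 2 j * t j = ∑ c, y c • K.b 3 c from hy.symm, sub_eq_zero]
    simp only [K.b_succ hs hR 2, Finset.smul_sum, Finset.mul_sum, mul_smul_comm]
    exact Finset.sum_comm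
  refine ⟨fun c => algebraMap k _ (y c), K.mem_gr.2 fun c => ?_, ?_⟩
  · rw [chi_three, Nat.cast_add, Nat.cast_one, sub_self]
    exact algebraMap_mem_cz _
  · ext (j : Fin 2)
    have := sub_eq_zero.1 (key j)
    rw [← htx j]
    refine (K.d_apply hs hR 2 _ j).trans ?_
    rw [show t j = _ from this, map_sum]
    refine Finset.sum_congr rfl fun c _ => ?_
    rw [map_smul, Algebra.smul_def, Algebra.commutes]

theorem exactAt_one_of_isSKoszul (h : IsSKoszul R s) (n : ℤ) : K.ExactAt hs hR 1 n := by
  obtain ⟨Q, hQ⟩ := h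
  have key : ∀ N : ℕ, ∀ n ≤ (N : ℤ), K.ExactAt hs hR 1 n := by
    intro N
    induction N with
    | zero => exact fun n hn => K.exactAt_one_of_le hs hR (by omega)
    | succ N ih =>
      intro n hn
      rcases le_or_gt n s with h1 | h1
      · exact K.exactAt_one_of_le hs hR h1
      rcases eq_or_ne n (s + 1) with rfl | h2
      · exact K.exactAt_one_succ hs hR
      intro x hx hx0
      by_contra hcon
      have hx1 : x ∉ (K.gr 3 n).map (K.d hs hR 2) := fun ⟨y, hy, hyx⟩ => hcon ⟨y, hy, hyx⟩
      -- If `x` is not a boundary, some functional kills the boundaries of degree `n` but not `x`.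
      -- It will be shown to define a module map from the syzygies to k.
      obtain ⟨ψ, hψ, hle⟩ := Submodule.exists_le_ker_of_notMem hx1
      let φ : LinearMap.ker (K.dS hs hR 1) →ₗ[(QuotAlg R)ᵐᵒᵖ] Triv R :=
        { toFun := fun z => (J R).mkQ (algebraMap k _ (ψ (K.hp hR 2 n z.1)))
          map_add' := fun a b => by
            rw [Submodule.coe_add, map_add, map_add, map_add, map_add]
          map_smul' := fun c z => by
            rw [RingHom.id_apply]
            obtain ⟨a, rfl⟩ := MulOpposite.op_surjective c
            induction a using homogeneous_induction with
            | mem l a ha =>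
              rw [SetLike.val_smul, K.hp_op_smul hR n ha]
              rcases Nat.eq_zero_or_pos l with rfl | hl
              · rw [← cz_natCast] at ha
                obtain ⟨c, rfl⟩ := exists_algebraMap_of_mem_cz_zero ha
                have h3 : ∀ y : Fin (K.r 2) → QuotAlg R,
                    MulOpposite.op (algebraMap k (QuotAlg R) c) • y = c • y := by
                  intro y
                  ext a
                  change y a * algebraMap k _ c = c • y a
                  rw [Algebra.smul_def, Algebra.commutes]
                rw [h3, Nat.cast_zero, sub_zero, map_smul ψ]
                refine Eq.trans ?_ (map_smul (J R).mkQ _ _)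
                congr 1
                change algebraMap k (QuotAlg R) (c * _) = algebraMap k (QuotAlg R) _ * algebraMap k _ c
                rw [map_mul, Algebra.commutes]
              -- A scalar of positive degree `l` acts on the component of degree `n - l`, which is a
              -- boundary by induction; the product is a boundary of degree `n`, where `ψ` vanishes.
              · have hz0 : K.d hs hR 1 z.1 = 0 := z.2
                obtain ⟨y, hy, hyz⟩ := ih (n - l) (by omega) _ (K.hp_mem hR 2 (n - l) z.1)
                  (by rw [← hp_d, hz0, map_zero])
                have h4 : MulOpposite.op a • K.hp hR 2 (n - l) z.1 ∈
                    (K.gr 3 n).map (K.d hs hR 2) := by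
                  refine ⟨MulOpposite.op a • y, ?_, ?_⟩
                  · have := K.op_smul_mem ha hy
                    rwa [sub_add_cancel] at this
                  · rw [← dS_apply, map_smul, dS_apply, hyz]
                rw [hle h4, map_zero, map_zero]
                rw [← cz_natCast] at ha
                exact (op_smul_triv (by omega) ha _).symm
            | zero => simp
            | add x y hx hy =>
              rw [MulOpposite.op_add, add_smul, Submodule.coe_add, map_add, map_add, map_add,
                map_add, hx, hy, add_smul] }
      have hφ := K.eq_zero_of_subsingleton_ext hs hR Q (hQ 3 (-n) (by rw [chi_three]; omega)) h1 φ
        (fun j hj z hz => by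
          change (J R).mkQ (algebraMap k _ (ψ (K.hp hR 2 n z.1))) = 0
          rw [K.hp_of_mem hR hz, if_neg hj, map_zero, map_zero, map_zero])
        ⟨x, hx0⟩ hx
      -- Vanishing in k means membership in J, and the augmentation then recovers `ψ x = 0`.
      have h5 : algebraMap k (QuotAlg R) (ψ (K.hp hR 2 n x)) ∈ J R :=
        (Submodule.Quotient.mk_eq_zero _).1 hφ
      have h6 := augQ_of_mem_J (show s ≠ 0 by omega) hR h5
      rw [AlgHom.commutes, K.hp_of_mem hR hx, if_pos rfl] at h6
      exact hψ h6
  exact key n.toNat n (by omega)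

theorem main_of_determined (hK : K.Determined hs hR) (hs0 : s ≠ 0) (hs1 : 1 ≤ s) :
    (IsSKoszul R s ↔ KoszulExactAtTwo R (s := s) hs1) ∧
    (IsSKoszul R s ↔
      (PowerSeries.expand s hs0 (hilbertSeries (A s R))
          - PowerSeries.X * PowerSeries.expand s hs0 (hilbertSeries (M s R)))
        * hilbertSeries (comp R) = 1) := by
  have h12 : IsSKoszul R s ↔ ∀ n, K.ExactAt hs hR 1 n := by
    refine ⟨fun h => K.exactAt_one_of_isSKoszul hs hR h, fun h => ?_⟩
    refine K.isSKoszul_of_exact hs hR fun i => ?_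
    match i with
    | 0 => exact K.exact_zero hs hR
    | 1 => exact exact_of_exactAt h
    | i + 2 => exact exact_of_exactAt fun n => hK n (fun n' _ => h n') (i + 2) (by omega)
  rw [K.koszulExactAtTwo_iff hs hR, K.hilbert_iff hs hR, h12]
  exact ⟨Iff.rfl, fun h => euler_of_exactAt_one hK h, fun h => exactAt_one_of_euler hK h⟩

end KData

end Comparison

end HomogAlg

end

noncomputable section

namespace HomogAlg

/-! ### Equations between words in linear forms -/

section Words

variable {k : Type u} [Field k] {m : ℕ}

theorem pow_mem_homog {v : Free k m} (hv : v ∈ homog k m 1) (n : ℕ) : v ^ n ∈ homog k m n := by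
  rw [← homog_one_pow]
  exact Submodule.pow_mem_pow _ hv n

theorem exists_eq_smul_one {a : Free k m} (ha : a ∈ homog k m 0) : ∃ c : k, a = c • 1 :=
  ⟨aug a, by rw [← Algebra.algebraMap_eq_smul_one]; exact eq_algebraMap_of_mem_homog_zero ha⟩

theorem exists_functional_eq_one {E : Type*} [AddCommGroup E] [Module k E] {v : E} (hv : v ≠ 0) :
    ∃ φ : E →ₗ[k] k, φ v = 1 := by
  have h : v ∉ (⊥ : Submodule k E) := hv
  obtain ⟨φ, hφ, -⟩ := Submodule.exists_le_ker_of_notMem h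
  exact ⟨(φ v)⁻¹ • φ, by rw [LinearMap.smul_apply, smul_eq_mul, inv_mul_cancel₀ hφ]⟩

theorem exists_functional_of_notMem {E : Type*} [AddCommGroup E] [Module k E] {N : Submodule k E}
    {b : E} (hb : b ∉ N) : ∃ φ : E →ₗ[k] k, (∀ v ∈ N, φ v = 0) ∧ φ b = 1 := by
  obtain ⟨φ, hφ, hN⟩ := Submodule.exists_le_ker_of_notMem hb
  refine ⟨(φ b)⁻¹ • φ, fun v hv => ?_, ?_⟩
  · rw [LinearMap.smul_apply, show φ v = 0 from hN hv, smul_zero]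
  · rw [LinearMap.smul_apply, smul_eq_mul, inv_mul_cancel₀ hφ]

theorem exists_functional_of_notMem_span {E : Type*} [AddCommGroup E] [Module k E] {v b : E}
    (hb : b ∉ Submodule.span k {v}) : ∃ φ : E →ₗ[k] k, φ v = 0 ∧ φ b = 1 := by
  obtain ⟨φ, h, h'⟩ := exists_functional_of_notMem hb
  exact ⟨φ, h v (Submodule.mem_span_singleton_self v), h'⟩

theorem mem_span_singleton_of_forall {E : Type*} [AddCommGroup E] [Module k E] {v b : E}
    (h : ∀ φ : E →ₗ[k] k, φ v = 0 → φ b = 0) : ∃ c : k, b = c • v := by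
  by_contra hcon
  have hb : b ∉ Submodule.span k {v} := fun hb => by
    obtain ⟨c, hc⟩ := Submodule.mem_span_singleton.1 hb
    exact hcon ⟨c, hc.symm⟩
  obtain ⟨φ, h0, h1⟩ := exists_functional_of_notMem_span hb
  exact one_ne_zero (h1.symm.trans (h φ h0))

theorem exists_common_of_not_linearIndependent {E : Type*} [AddCommGroup E] [Module k E]
    {N : Submodule k E} {c : Fin 2 → E} (hcN : ∀ j, c j ∈ N) (hc : ¬ LinearIndependent k c) :
    ∃ w ∈ N, ∃ l : Fin 2 → k, ∀ j, c j = l j • w := by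
  have hc' : ¬ LinearIndependent k ![c 0, c 1] := by
    rwa [show ![c 0, c 1] = c by ext j; fin_cases j <;> rfl]
  rw [LinearIndependent.pair_iff] at hc'
  push Not at hc'
  obtain ⟨a, b, h, hab⟩ := hc'
  by_cases ha : a = 0
  · have hb := hab ha
    refine ⟨c 0, hcN 0, ![1, 0], fun j => ?_⟩
    have h1 : c 1 = 0 := by
      rw [ha, zero_smul, zero_add] at h
      exact (smul_eq_zero.1 h).resolve_left hb
    fin_cases j
    · simp
    · simpa using h1
  · refine ⟨c 1, hcN 1, ![-(a⁻¹ * b), 1], fun j => ?_⟩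
    have h1 : c 0 = -(a⁻¹ * b) • c 1 := by
      have : a⁻¹ • (a • c 0 + b • c 1) = 0 := by rw [h, smul_zero]
      rw [smul_add, smul_smul, smul_smul, inv_mul_cancel₀ ha, one_smul] at this
      rw [neg_smul]
      exact eq_neg_of_add_eq_zero_left this
    fin_cases j
    · simpa using h1
    · simp

theorem lcon_eq_sum (ξ : Fin m → k) {n : ℕ} {a : Free k m} (ha : a ∈ homog k m (n + 1)) :
    lcon ξ a = ∑ i, ξ i • lc i a := by
  conv_lhs => rw [eq_sum_lc_of_mem ha, map_sum]
  exact Finset.sum_congr rfl fun i _ => lcon_ι_mul _ _ _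

theorem rcon_eq_sum (ξ : Fin m → k) {n : ℕ} {a : Free k m} (ha : a ∈ homog k m (n + 1)) :
    rcon ξ a = ∑ i, ξ i • rc i a := by
  conv_lhs => rw [eq_sum_rc_of_mem ha, map_sum]
  exact Finset.sum_congr rfl fun i _ => rcon_mul_ι _ _ _

theorem exists_lcf_eq_lcon (ξ : Fin m → k) :
    ∃ φ : Free k m →ₗ[k] k, lcf φ = lcon ξ ∧ rcf φ = rcon ξ := by
  obtain ⟨φ, hφ⟩ := exists_dual_family (linearIndependent_ι (k := k) (m := m))
  have h : (fun i => (∑ j, ξ j • φ j) (FreeAlgebra.ι k i)) = ξ := by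
    ext i
    simp [hφ]
  exact ⟨∑ j, ξ j • φ j, congrArg lcon h, congrArg rcon h⟩

/-- If only functionals that do not kill `v` can contract `a` on the left nontrivially, then `v` is
the first factor of `a`. -/
theorem eq_mul_lcf {n : ℕ} {a v : Free k m} (ha : a ∈ homog k m (n + 1)) (hv : v ∈ homog k m 1)
    (h : ∀ φ : Free k m →ₗ[k] k, φ v = 0 → lcf φ a = 0) {φ : Free k m →ₗ[k] k} (hφ : φ v = 1) :
    a = v * lcf φ a := by
  rw [← sub_eq_zero]
  have hm : a - v * lcf φ a ∈ homog k m (n + 1) :=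
    sub_mem ha (add_comm 1 n ▸ homog_mul hv (lcon_mem _ ha))
  refine eq_zero_of_lc hm fun i => ?_
  obtain ⟨ψ, hψ, -⟩ := exists_lcf_eq_lcon (Pi.single i (1 : k))
  have h1 := h (ψ - ψ v • φ) (by simp [hφ])
  rw [lc, ← hψ, map_sub, lcf_mul ψ hv]
  rw [← h1, lcon_eq_sum _ ha, lcon_eq_sum _ ha, lcon_eq_sum _ ha, Finset.smul_sum,
    ← Finset.sum_sub_distrib]
  refine Finset.sum_congr rfl fun i _ => ?_
  rw [LinearMap.sub_apply, LinearMap.smul_apply, sub_smul, smul_assoc]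

theorem eq_rcf_mul {n : ℕ} {a v : Free k m} (ha : a ∈ homog k m (n + 1)) (hv : v ∈ homog k m 1)
    (h : ∀ φ : Free k m →ₗ[k] k, φ v = 0 → rcf φ a = 0) {φ : Free k m →ₗ[k] k} (hφ : φ v = 1) :
    a = rcf φ a * v := by
  rw [← sub_eq_zero]
  have hm : a - rcf φ a * v ∈ homog k m (n + 1) := sub_mem ha (homog_mul (rcon_mem _ ha) hv)
  have h0 : ∀ i, rc i (a - rcf φ a * v) = 0 := fun i => by
    obtain ⟨ψ, -, hψ⟩ := exists_lcf_eq_lcon (Pi.single i (1 : k))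
    have h1 := h (ψ - ψ v • φ) (by simp [hφ])
    rw [rc, ← hψ, map_sub, rcf_mul ψ hv]
    rw [← h1, rcon_eq_sum _ ha, rcon_eq_sum _ ha, rcon_eq_sum _ ha, Finset.smul_sum,
      ← Finset.sum_sub_distrib]
    refine Finset.sum_congr rfl fun i _ => ?_
    rw [LinearMap.sub_apply, LinearMap.smul_apply, sub_smul, smul_assoc]
  rw [eq_sum_rc_of_mem hm]
  exact Finset.sum_eq_zero fun i _ => by rw [h0, zero_mul]

/-- Contracting `v` away shows that `h` ends in `u`; cancelling `u` leaves the same equation one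
degree lower. -/
theorem eq_pow_of_mul_eq_mul {n : ℕ} {v u h : Free k m} (hv : v ∈ homog k m 1) (hv0 : v ≠ 0)
    (hh : h ∈ homog k m n) (hh0 : h ≠ 0) (H : v * h = h * u) :
    u = v ∧ ∃ c : k, h = c • v ^ n := by
  obtain ⟨φ, hφ⟩ := exists_functional_eq_one (k := k) hv0
  induction n generalizing h with
  | zero =>
    obtain ⟨c, rfl⟩ := exists_eq_smul_one hh
    rw [mul_smul_comm, smul_mul_assoc, mul_one, one_mul] at H
    have hc : c ≠ 0 := fun hc => hh0 (by rw [hc, zero_smul])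
    exact ⟨(smul_right_injective _ hc H).symm, c, by rw [pow_zero]⟩
  | succ n ih =>
    have h1 : h = lcf φ h * u := by
      have := congrArg (lcf φ) H
      rwa [lcf_mul φ hv, hφ, one_smul, lcf_mul_of_mem φ hh] at this
    have hu0 : u ≠ 0 := fun hu0 => hh0 (by rw [h1, hu0, mul_zero])
    have h2 : lcf φ h ≠ 0 := fun h2 => hh0 (by rw [h1, h2, zero_mul])
    obtain ⟨huv, c, hc⟩ := ih (lcon_mem _ hh) h2 (mul_right_cancel₀ hu0 (by
      rw [mul_assoc, ← h1, H]))
    refine ⟨huv, c, ?_⟩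
    rw [h1, hc, huv, smul_mul_assoc, pow_succ]

theorem not_linearIndependent_of_mem_homog_zero {f : Fin 2 → Free k m}
    (hf : ∀ j, f j ∈ homog k m 0) : ¬ LinearIndependent k f := by
  intro h
  choose c hc using fun j => exists_eq_smul_one (hf j)
  have h2 := Fintype.linearIndependent_iff.1 h ![c 1, -c 0] (by
    rw [Fin.sum_univ_two, hc 0, hc 1]
    simp [smul_smul, mul_comm])
  refine h.ne_zero 1 ?_
  have h3 := h2 0
  simp only [Matrix.cons_val_zero] at h3
  rw [hc 1, h3, zero_smul]

/-- An element of `R V ∩ V R` of rank one in `R ⊗ V` has rank one in `V ⊗ R`. -/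
theorem not_sum_mul_of_linearIndependent {n : ℕ} {f c : Fin 2 → Free k m}
    (hf : LinearIndependent k f) (hfn : ∀ j, f j ∈ homog k m n) (hc : LinearIndependent k c)
    (hc1 : ∀ j, c j ∈ homog k m 1) {u : Free k m} (a : Fin 2 → k)
    (H : (∑ j, a j • f j) * u = ∑ j, c j * f j) : False := by
  induction n generalizing f with
  | zero => exact not_linearIndependent_of_mem_homog_zero hfn hf
  | succ n ih =>
    obtain ⟨φ, hφ⟩ := exists_dual_family hc
    have hF : ∑ j, a j • f j ∈ homog k m (n + 1) :=
      Submodule.sum_mem _ fun j _ => Submodule.smul_mem _ _ (hfn j)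
    -- Every `f l` is divisible by `u` on the right, and the quotients satisfy the same relation.
    -- The descent ends in degree 0, which is too small for two independent elements.
    have h1 : ∀ l, f l = lcf (φ l) (∑ j, a j • f j) * u := by
      intro l
      have := congrArg (lcf (φ l)) H
      rw [lcf_mul_of_mem _ hF, map_sum _ (fun j => c j * f j)] at this
      rw [this, Finset.sum_congr rfl fun j _ => lcf_mul (φ l) (hc1 j) (f j)]
      simp [hφ]
    set g : Fin 2 → Free k m := fun l => lcf (φ l) (∑ j, a j • f j) with hg
    have hu0 : u ≠ 0 := fun hu0 => hf.ne_zero 0 (by rw [h1 0, hu0, mul_zero])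
    have hfg : f = LinearMap.mulRight k u ∘ g := funext h1
    refine ih (f := g) (LinearIndependent.of_comp (LinearMap.mulRight k u) (hfg ▸ hf))
      (fun l => lcon_mem _ hF) (mul_right_cancel₀ hu0 ?_)
    have h2 : (∑ j, a j • g j) * u = ∑ j, a j • f j := by
      rw [Finset.sum_mul]
      exact Finset.sum_congr rfl fun j _ => by rw [smul_mul_assoc, ← h1 j]
    rw [h2, H, Finset.sum_mul]
    exact Finset.sum_congr rfl fun j _ => by rw [mul_assoc, ← h1 j]

/-- An element of `R V ∩ V R` of rank one in `V ⊗ R` has rank one in `R ⊗ V`. -/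
theorem not_mul_sum_of_linearIndependent {n : ℕ} {f c : Fin 2 → Free k m}
    (hf : LinearIndependent k f) (hfn : ∀ j, f j ∈ homog k m n) (hc : LinearIndependent k c)
    (hc1 : ∀ j, c j ∈ homog k m 1) {u : Free k m} (a : Fin 2 → k)
    (H : u * (∑ j, a j • f j) = ∑ j, f j * c j) : False := by
  induction n generalizing f with
  | zero => exact not_linearIndependent_of_mem_homog_zero hfn hf
  | succ n ih =>
    obtain ⟨φ, hφ⟩ := exists_dual_family hc
    have hF : ∑ j, a j • f j ∈ homog k m (n + 1) :=
      Submodule.sum_mem _ fun j _ => Submodule.smul_mem _ _ (hfn j)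
    have h1 : ∀ l, f l = u * rcf (φ l) (∑ j, a j • f j) := by
      intro l
      have := congrArg (rcf (φ l)) H
      rw [rcf_mul_of_mem _ hF, map_sum _ (fun j => f j * c j)] at this
      rw [this, Finset.sum_congr rfl fun j _ => rcf_mul (φ l) (hc1 j) (f j)]
      simp [hφ]
    set g : Fin 2 → Free k m := fun l => rcf (φ l) (∑ j, a j • f j) with hg
    have hu0 : u ≠ 0 := fun hu0 => hf.ne_zero 0 (by rw [h1 0, hu0, zero_mul])
    have hfg : f = LinearMap.mulLeft k u ∘ g := funext h1
    refine ih (f := g) (LinearIndependent.of_comp (LinearMap.mulLeft k u) (hfg ▸ hf))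
      (fun l => rcon_mem _ hF) (mul_left_cancel₀ hu0 ?_)
    have h2 : u * (∑ j, a j • g j) = ∑ j, a j • f j := by
      rw [Finset.mul_sum]
      exact Finset.sum_congr rfl fun j _ => by rw [mul_smul_comm, ← h1 j]
    rw [h2, H, Finset.mul_sum]
    exact Finset.sum_congr rfl fun j _ => by rw [← mul_assoc, ← h1 j]

theorem not_linearIndependent_one_pair {g : Free k m} (hg : g ∈ homog k m 0) (v : Free k m) :
    ¬ LinearIndependent k ![v ^ 0, g] :=
  not_linearIndependent_of_mem_homog_zero fun j => by
    fin_cases j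
    · exact pow_zero v ▸ one_mem_homog
    · exact hg

theorem linearIndependent_of_shear {E : Type*} [AddCommGroup E] [Module k E] {x y z : E} {c : k}
    (h : LinearIndependent k ![x, y]) (hz : y = z - c • x) : LinearIndependent k ![x, z] := by
  rw [LinearIndependent.pair_iff] at h ⊢
  intro s t hst
  have := h (s + t * c) t (by rw [hz, ← hst]; module)
  have ht := this.2
  refine ⟨?_, ht⟩
  have h1 := this.1
  rwa [ht, zero_mul, add_zero] at h1

theorem linearIndependent_pair_of_map {E F : Type*} [AddCommGroup E] [Module k E] [AddCommGroup F]
    [Module k F] (L : E →ₗ[k] F) {x y : E} {x' y' : F} (h : LinearIndependent k ![x', y'])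
    (hx : L x = x') (hy : L y = y') : LinearIndependent k ![x, y] := by
  refine LinearIndependent.of_comp L ?_
  convert h using 1
  ext j
  fin_cases j
  · exact hx
  · exact hy

/-- A right contraction killing `v` but not `b` shows that, up to a multiple of the power of `v`,
`g` begins with `v`. Dividing by `v` preserves the shape of the equation, and the descent ends in
degree 0. -/
theorem false_of_left_factor {n : ℕ} {v a b c g : Free k m} {δ : k} (hv : v ∈ homog k m 1)
    (ha : a ∈ homog k m 1) (hb : b ∈ homog k m 1) (hc : c ∈ homog k m 1) (hg : g ∈ homog k m n)
    (hv0 : v ≠ 0) (hbv : b ∉ Submodule.span k {v}) (hli : LinearIndependent k ![v ^ n, g])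
    (H : v ^ n * a + g * b = c * v ^ n + δ • (v * g)) : False := by
  obtain ⟨φ, hφ⟩ := exists_functional_eq_one (k := k) hv0
  obtain ⟨ψ, hψv, hψb⟩ := exists_functional_of_notMem_span hbv
  induction n generalizing a c g with
  | zero => exact not_linearIndependent_one_pair hg v hli
  | succ n ih =>
    have h1 : g = v * (δ • rcf ψ g) - ψ a • v ^ (n + 1) := by
      have := congrArg (rcf ψ) H
      rw [map_add, map_add, map_smul, rcf_mul ψ ha, rcf_mul ψ hb, hψb, one_smul, pow_succ,
        ← mul_assoc c, rcf_mul ψ hv, hψv, zero_smul, zero_add, rcf_mul_of_mem ψ hg,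
        ← pow_succ] at this
      rw [mul_smul_comm, ← this, add_sub_cancel_left]
    set g' := δ • rcf ψ g
    have hg' : g' ∈ homog k m n := Submodule.smul_mem _ _ (rcon_mem _ hg)
    clear_value g'
    have h2 : v * (v ^ n * (a - ψ a • b) + g' * b - δ • (v * g')) =
        (c - (δ * ψ a) • v) * v ^ (n + 1) := by
      have h3 := H
      rw [h1] at h3
      have h4 : c * v ^ (n + 1) =
        v ^ (n + 1) * a + (v * g' - ψ a • v ^ (n + 1)) * b -
          δ • (v * (v * g' - ψ a • v ^ (n + 1))) := by rw [h3]; abel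
      rw [sub_mul, h4, pow_succ']
      simp only [mul_add, mul_sub, sub_mul, smul_mul_assoc, mul_smul_comm, mul_assoc]
      module
    have hc' : c - (δ * ψ a) • v ∈ homog k m 1 := sub_mem hc (Submodule.smul_mem _ _ hv)
    have h3 := congrArg (lcf φ) h2
    rw [lcf_mul φ hv, hφ, one_smul, lcf_mul φ hc'] at h3
    refine ih (a := a - ψ a • b) (c := φ (c - (δ * ψ a) • v) • v) (g := g')
      (sub_mem ha (Submodule.smul_mem _ _ hb)) (Submodule.smul_mem _ _ hv) hg' ?_ ?_
    · exact linearIndependent_pair_of_map (LinearMap.mulLeft k v)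
        (linearIndependent_of_shear hli h1) (pow_succ' v n).symm rfl
    · rw [smul_mul_assoc, ← pow_succ', ← h3]
      abel

/-- The mirror image of `false_of_left_factor`, with a left contraction killing `v` but not `d`. -/
theorem false_of_right_factor {n : ℕ} {v a c d g : Free k m} {β : k} (hv : v ∈ homog k m 1)
    (ha : a ∈ homog k m 1) (hc : c ∈ homog k m 1) (hd : d ∈ homog k m 1) (hg : g ∈ homog k m n)
    (hv0 : v ≠ 0) (hdv : d ∉ Submodule.span k {v}) (hli : LinearIndependent k ![v ^ n, g])
    (H : v ^ n * a + β • (g * v) = c * v ^ n + d * g) : False := by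
  obtain ⟨φ, hφ⟩ := exists_functional_eq_one (k := k) hv0
  obtain ⟨ψ, hψv, hψd⟩ := exists_functional_of_notMem_span hdv
  induction n generalizing a c g with
  | zero => exact not_linearIndependent_one_pair hg v hli
  | succ n ih =>
    have h1 : g = (β • lcf ψ g) * v - ψ c • v ^ (n + 1) := by
      have := congrArg (lcf ψ) H
      rw [map_add, map_add, map_smul, lcf_mul ψ hc, lcf_mul ψ hd, hψd, one_smul, pow_succ',
        mul_assoc v, lcf_mul ψ hv, hψv, zero_smul, zero_add, lcf_mul_of_mem ψ hg,
        ← pow_succ'] at this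
      rw [smul_mul_assoc, this, add_sub_cancel_left]
    set g' := β • lcf ψ g
    have hg' : g' ∈ homog k m n := Submodule.smul_mem _ _ (lcon_mem _ hg)
    clear_value g'
    have h2 : ((c - ψ c • d) * v ^ n + d * g' - β • (g' * v)) * v =
        v ^ (n + 1) * (a - (β * ψ c) • v) := by
      have h3 := H
      rw [h1] at h3
      have h4 : v ^ (n + 1) * a = c * v ^ (n + 1) + d * (g' * v - ψ c • v ^ (n + 1)) -
          β • ((g' * v - ψ c • v ^ (n + 1)) * v) := by rw [← h3]; abel
      rw [mul_sub, h4, pow_succ]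
      simp only [add_mul, mul_sub, sub_mul, smul_mul_assoc, mul_smul_comm, mul_assoc]
      module
    have ha' : a - (β * ψ c) • v ∈ homog k m 1 := sub_mem ha (Submodule.smul_mem _ _ hv)
    have h3 := congrArg (rcf φ) h2
    rw [rcf_mul φ hv, hφ, one_smul, rcf_mul φ ha'] at h3
    refine ih (c := c - ψ c • d) (a := φ (a - (β * ψ c) • v) • v) (g := g')
      (Submodule.smul_mem _ _ hv) (sub_mem hc (Submodule.smul_mem _ _ hd)) hg' ?_ ?_
    · exact linearIndependent_pair_of_map (LinearMap.mulRight k v)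
        (linearIndependent_of_shear hli h1) (pow_succ v n).symm rfl
    · rw [mul_smul_comm, ← pow_succ, ← h3]
      abel

/-- The sums `∑ q ^ i x ^ i y x ^ (n - 1 - i)`. -/
def qsum (q : k) (x y : Free k m) : ℕ → Free k m
  | 0 => 0
  | n + 1 => q ^ n • (x ^ n * y) + qsum q x y n * x

/-- Subtracting a multiple of `v ^ n * a` makes `g` divisible by `v` on the right. The quotient
satisfies the same equation with `t` replaced by `q⁻¹ * t`, which accounts for the powers of `q`. -/
theorem eq_qsum_of_mul_eq {n : ℕ} {v a c g : Free k m} {q : k} (hq : q ≠ 0) (t : k)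
    (hv : v ∈ homog k m 1) (ha : a ∈ homog k m 1) (hg : g ∈ homog k m n)
    (hv0 : v ≠ 0) (H : g * v = q • (v * g) + c * v ^ n - t • (v ^ n * a)) :
    ∃ κ : k, g = (t * (q ^ n)⁻¹) • qsum q v a n + κ • v ^ n := by
  obtain ⟨φ, hφ⟩ := exists_functional_eq_one (k := k) hv0
  induction n generalizing g t with
  | zero =>
    obtain ⟨κ, rfl⟩ := exists_eq_smul_one hg
    exact ⟨κ, by rw [qsum, smul_zero, zero_add, pow_zero]⟩
  | succ n ih =>
    have hva : v ^ n * a ∈ homog k m (n + 1) := homog_mul (pow_mem_homog hv n) ha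
    have h1 : g - (q⁻¹ * t) • (v ^ n * a) =
        rcf φ (g - (q⁻¹ * t) • (v ^ n * a)) * v := by
      refine eq_rcf_mul (sub_mem hg (Submodule.smul_mem _ _ hva)) hv (fun ψ hψ => ?_) hφ
      have h2 := congrArg (rcf ψ) H
      rw [rcf_mul ψ hv, hψ, zero_smul, map_sub, map_add, map_smul, map_smul, rcf_mul_of_mem ψ hg,
        rcf_mul ψ ha, pow_succ, ← mul_assoc, rcf_mul ψ hv, hψ, zero_smul, add_zero,
        ← pow_succ] at h2
      rw [map_sub, map_smul, rcf_mul ψ ha]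
      have h3 : v * rcf ψ g = (q⁻¹ * t) • ψ a • v ^ (n + 1) := by
        rw [mul_smul, ← sub_eq_zero.1 h2.symm, smul_smul, inv_mul_cancel₀ hq, one_smul]
      refine mul_left_cancel₀ hv0 ?_
      rw [mul_sub, h3, mul_smul_comm, mul_smul_comm, ← pow_succ', sub_self, mul_zero]
    set g' := rcf φ (g - (q⁻¹ * t) • (v ^ n * a))
    have hg' : g' ∈ homog k m n := rcon_mem _ (sub_mem hg (Submodule.smul_mem _ _ hva))
    have h2 : g = g' * v + (q⁻¹ * t) • (v ^ n * a) := by rw [← h1, sub_add_cancel]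
    obtain ⟨κ, hκ⟩ := ih (q⁻¹ * t) hg' (mul_right_cancel₀ hv0 (by
      have h3 := H
      rw [h2] at h3
      have h4 : g' * v * v = q • (v * (g' * v + (q⁻¹ * t) • (v ^ n * a))) + c * v ^ (n + 1) -
          t • (v ^ (n + 1) * a) - (q⁻¹ * t) • (v ^ n * a) * v := by
        rw [← h3, add_mul, add_sub_cancel_right]
      have h5 : (q * (q⁻¹ * t)) • (v ^ (n + 1) * a) = t • (v ^ (n + 1) * a) := by
        rw [mul_inv_cancel_left₀ hq]
      rw [h4, mul_add, mul_smul_comm, smul_add, smul_smul, ← mul_assoc v (v ^ n), ← pow_succ', h5,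
        sub_mul, add_mul]
      simp only [smul_mul_assoc, mul_assoc, ← pow_succ]
      abel))
    refine ⟨κ, ?_⟩
    rw [h2, hκ, qsum, add_mul, smul_mul_assoc, smul_mul_assoc, ← pow_succ, smul_add, smul_smul,
      show t * (q ^ (n + 1))⁻¹ * q ^ n = q⁻¹ * t by
        rw [pow_succ]; field_simp,
      show q⁻¹ * t * (q ^ n)⁻¹ = t * (q ^ (n + 1))⁻¹ by rw [pow_succ]; field_simp]
    abel

end Words

end HomogAlg

end

noncomputable section

namespace HomogAlg

/-! ### Ladders: overlap spaces generated by powers of a matrix -/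

section Ladder

variable (k : Type u) [Field k] (m : ℕ)

/-- A row vector `e` of linear forms and a square matrix `M` of linear forms such that the entries
of the row vectors `e Mⁿ` span spaces `N n` with `N n V ∩ V N n = N (n + 1)` for `n > 0`. The
matrices `C n φ` describe the left contractions of these spaces. -/
structure Ladder (r : ℕ) where
  start : Fin r → Free k m
  M : Matrix (Fin r) (Fin r) (Free k m)
  C : ℕ → (Free k m →ₗ[k] k) → Matrix (Fin r) (Fin r) k
  start_mem : ∀ a, start a ∈ homog k m 1
  M_mem : ∀ a b, M a b ∈ homog k m 1
  li : LinearIndependent k start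
  inj : ∀ y : Fin r → k, (∀ a, ∑ b, y b • M a b = 0) → y = 0
  -- `base` and `comm` together say that the left contraction of e Mⁿ⁺¹ along `φ` is e Mⁿ times the
  -- scalar matrix `C n φ`.
  base : ∀ φ c, ∑ a, φ (start a) • M a c = ∑ a, C 0 φ a c • start a
  comm : ∀ n φ a c, ∑ b, C n φ a b • M b c = ∑ b, C (n + 1) φ b c • M a b
  -- If every `C n φ` carries the column `t` into the scalar column space of `M`, then `t` itself
  -- lies there; this excludes further overlaps.
  detect : ∀ n (t : Fin r → Free k m),
    (∀ φ, ∃ y : Fin r → k, ∀ a, ∑ c, C n φ a c • t c = ∑ b, y b • M a b) →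
      ∃ y : Fin r → k, ∀ a, t a = ∑ b, y b • M a b

variable {k m}

namespace Ladder

variable {r : ℕ} (L : Ladder k m r)

/-- The row vector `e Mⁿ`; its entries have degree `n + 1`. -/
def e : ℕ → Fin r → Free k m
  | 0 => L.start
  | n + 1 => fun c => ∑ a, e n a * L.M a c

theorem e_succ (n : ℕ) (c : Fin r) : L.e (n + 1) c = ∑ a, L.e n a * L.M a c := rfl

theorem e_mem (n : ℕ) (a : Fin r) : L.e n a ∈ homog k m (n + 1) := by
  induction n generalizing a with
  | zero => exact L.start_mem a
  | succ n ih => exact Submodule.sum_mem _ fun b _ => homog_mul (ih b) (L.M_mem b a)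

theorem sum_smul_e (n : ℕ) (y : Fin r → k) :
    ∑ c, y c • L.e (n + 1) c = ∑ a, L.e n a * ∑ b, y b • L.M a b := by
  simp only [e_succ, Finset.smul_sum, Finset.mul_sum, mul_smul_comm]
  exact Finset.sum_comm

theorem e_li (n : ℕ) : LinearIndependent k (L.e n) := by
  induction n with
  | zero => exact L.li
  | succ n ih =>
    rw [Fintype.linearIndependent_iff]
    intro y hy c
    rw [sum_smul_e] at hy
    exact congrFun (L.inj y (eq_zero_of_sum_mul_eq_zero ih (L.e_mem n) hy)) c

theorem e_add (n l : ℕ) (c : Fin r) : L.e (n + l) c = ∑ a, L.e n a * (L.M ^ l) a c := by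
  induction l generalizing c with
  | zero => simp [Matrix.one_apply]
  | succ l ih =>
    rw [← add_assoc, e_succ]
    simp only [ih, pow_succ, Matrix.mul_apply, Finset.sum_mul, Finset.mul_sum, mul_assoc]
    exact Finset.sum_comm

theorem lcf_e (φ : Free k m →ₗ[k] k) (n : ℕ) (c : Fin r) :
    lcf φ (L.e (n + 1) c) = ∑ a, L.C n φ a c • L.e n a := by
  induction n generalizing c with
  | zero =>
    rw [e_succ, map_sum]
    refine Eq.trans ?_ (L.base φ c)
    exact Finset.sum_congr rfl fun a _ => lcf_mul φ (L.start_mem a) _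
  | succ n ih =>
    rw [e_succ, map_sum, sum_smul_e]
    simp only [lcf_mul_of_mem φ (L.e_mem _ _), ih, Finset.sum_mul, smul_mul_assoc, ← L.comm,
      Finset.mul_sum, mul_smul_comm]
    exact Finset.sum_comm

/-- An element of W V is `e (n + 1)` times a column `t`. It lies in V W exactly when its left
contractions, namely `e n` times `C n φ` times `t`, lie in the span of `e (n + 1)`. Comparing
coefficients of `e n` gives the hypothesis of `detect`, which puts the element in the span of `e (n
+ 2)`. -/
theorem W_succ_eq {s : ℕ} {R : Submodule k (Free k m)} {n : ℕ} (hn : s ≤ n + 2)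
    (hW : W s R (n + 2) = Submodule.span k (Set.range (L.e (n + 1)))) :
    W s R (n + 3) = Submodule.span k (Set.range (L.e (n + 2))) := by
  rw [show n + 3 = n + 2 + 1 from rfl, W_succ hn, hW]
  apply le_antisymm
  · rintro w ⟨hw1, hw2⟩
    obtain ⟨t, -, rfl⟩ := exists_sum_of_mem_span_mul hw1
    obtain ⟨y, hy⟩ := L.detect n t fun φ => by
      obtain ⟨y, hy⟩ := (Submodule.mem_span_range_iff_exists_fun k).1
        (lcon_mem_of_mem_mul (fun i => φ (FreeAlgebra.ι k i)) hw2)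
      refine ⟨y, fun a => sub_eq_zero.1 ?_⟩
      refine eq_zero_of_sum_mul_eq_zero (L.e_li n) (L.e_mem n)
        (t := fun a => ∑ c, L.C n φ a c • t c - ∑ b, y b • L.M a b) ?_ a
      simp only [mul_sub, Finset.sum_sub_distrib]
      rw [← L.sum_smul_e, hy, map_sum, sub_eq_zero]
      simp only [lcf_mul_of_mem φ (L.e_mem _ _), lcf_e, Finset.sum_mul, smul_mul_assoc,
        Finset.mul_sum, mul_smul_comm]
      exact Finset.sum_comm
    simp only [hy, ← L.sum_smul_e]
    exact Submodule.sum_mem _ fun c _ => Submodule.smul_mem _ _ (Submodule.subset_span ⟨c, rfl⟩)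
  · rw [Submodule.span_le]
    rintro _ ⟨c, rfl⟩
    refine ⟨?_, ?_⟩
    · rw [e_succ]
      exact Submodule.sum_mem _ fun a _ =>
        Submodule.mul_mem_mul (Submodule.subset_span ⟨a, rfl⟩) (L.M_mem a c)
    · refine mem_homog_one_mul (L.e_mem _ _) fun i => ?_
      obtain ⟨φ, hφ, -⟩ := exists_lcf_eq_lcon (Pi.single i (1 : k))
      rw [lc, ← hφ, lcf_e]
      exact Submodule.sum_mem _ fun a _ => Submodule.smul_mem _ _ (Submodule.subset_span ⟨a, rfl⟩)

end Ladder

/-! ### The ladders that occur -/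

section Families

variable {x y : Free k m}

theorem exists_dual_pair {E : Type*} [AddCommGroup E] [Module k E] {x y : E}
    (h : LinearIndependent k ![x, y]) :
    ∃ φ ψ : E →ₗ[k] k, φ x = 1 ∧ φ y = 0 ∧ ψ x = 0 ∧ ψ y = 1 := by
  obtain ⟨φ, hφ⟩ := exists_dual_family h
  exact ⟨φ 0, φ 1, by simpa using hφ 0 0, by simpa using hφ 0 1, by simpa using hφ 1 0,
    by simpa using hφ 1 1⟩

/-- The ladder of the powers `xⁿ`. -/
def powLadder (hx : x ∈ homog k m 1) (hx0 : x ≠ 0) : Ladder k m 1 where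
  start := fun _ => x
  M := fun _ _ => x
  C := fun _ φ _ _ => φ x
  start_mem := fun _ => hx
  M_mem := fun _ _ => hx
  li := LinearIndependent.of_subsingleton (v := fun _ => x) 0 hx0
  inj := fun y hy => by
    ext a
    rw [Subsingleton.elim a 0]
    exact (smul_eq_zero.1 (by simpa using hy 0)).resolve_right hx0
  base := fun _ _ => rfl
  comm := fun _ _ _ _ => rfl
  detect := fun n t h => by
    obtain ⟨φ, hφ⟩ := exists_functional_eq_one (k := k) hx0
    obtain ⟨y, hy⟩ := h φ
    exact ⟨y, fun a => by rw [← hy a]; simp [hφ, Subsingleton.elim a 0]⟩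

theorem powLadder_e (hx : x ∈ homog k m 1) (hx0 : x ≠ 0) (n : ℕ) (a : Fin 1) :
    (powLadder hx hx0).e n a = x ^ (n + 1) := by
  induction n with
  | zero => rw [zero_add, pow_one]; rfl
  | succ n ih =>
    rw [Ladder.e_succ, Fin.sum_univ_one, Subsingleton.elim 0 a, ih, pow_succ x (n + 1)]
    rfl

/-- The ladder of the pairs `xⁿ, yⁿ`. -/
def diagLadder (hx : x ∈ homog k m 1) (hy : y ∈ homog k m 1) (h : LinearIndependent k ![x, y]) :
    Ladder k m 2 where
  start := ![x, y]
  M := !![x, 0; 0, y]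
  C := fun _ φ => !![φ x, 0; 0, φ y]
  start_mem := by simp [Fin.forall_fin_two, hx, hy]
  M_mem := by simp [Fin.forall_fin_two, hx, hy]
  li := h
  inj := fun z hz => by
    have hx0 : x ≠ 0 := h.ne_zero 0
    have hy0 : y ≠ 0 := h.ne_zero 1
    ext a
    fin_cases a
    · simpa [hx0] using hz 0
    · simpa [hy0] using hz 1
  base := by simp [Fin.forall_fin_two]
  comm := by simp [Fin.forall_fin_two]
  detect := fun n t ht => by
    obtain ⟨φ, ψ, h1, h2, h3, h4⟩ := exists_dual_pair h
    obtain ⟨y₁, hy₁⟩ := ht φ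
    obtain ⟨y₂, hy₂⟩ := ht ψ
    refine ⟨![y₁ 0, y₂ 1], fun a => ?_⟩
    fin_cases a
    · simpa [h1, h2] using hy₁ 0
    · simpa [h3, h4] using hy₂ 1

theorem diagLadder_e (hx : x ∈ homog k m 1) (hy : y ∈ homog k m 1)
    (h : LinearIndependent k ![x, y]) (n : ℕ) :
    (diagLadder hx hy h).e n = ![x ^ (n + 1), y ^ (n + 1)] := by
  induction n with
  | zero => simp [Ladder.e, diagLadder]
  | succ n ih =>
    ext a
    rw [Ladder.e_succ, ih]
    fin_cases a <;> simp [diagLadder, pow_succ _ (n + 1)]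

/-- The ladder of the pairs `x yⁿ, yⁿ⁺¹`. -/
def rightLadder (hx : x ∈ homog k m 1) (hy : y ∈ homog k m 1) (h : LinearIndependent k ![x, y]) :
    Ladder k m 2 where
  start := ![x, y]
  M := !![y, 0; 0, y]
  C := fun _ φ => !![0, 0; φ x, φ y]
  start_mem := by simp [Fin.forall_fin_two, hx, hy]
  M_mem := by simp [Fin.forall_fin_two, hy]
  li := h
  inj := fun z hz => by
    have hy0 : y ≠ 0 := h.ne_zero 1
    ext a
    fin_cases a
    · simpa [hy0] using hz 0
    · simpa [hy0] using hz 1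
  base := by simp [Fin.forall_fin_two]
  comm := by simp [Fin.forall_fin_two]
  detect := fun n t ht => by
    obtain ⟨φ, ψ, h1, h2, h3, h4⟩ := exists_dual_pair h
    obtain ⟨y₁, hy₁⟩ := ht φ
    obtain ⟨y₂, hy₂⟩ := ht ψ
    refine ⟨![y₁ 1, y₂ 1], fun a => ?_⟩
    fin_cases a
    · simpa [h1, h2] using hy₁ 1
    · simpa [h3, h4] using hy₂ 1

theorem rightLadder_e (hx : x ∈ homog k m 1) (hy : y ∈ homog k m 1)
    (h : LinearIndependent k ![x, y]) (n : ℕ) :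
    (rightLadder hx hy h).e n = ![x * y ^ n, y ^ (n + 1)] := by
  induction n with
  | zero => simp [Ladder.e, rightLadder]
  | succ n ih =>
    ext a
    rw [Ladder.e_succ, ih]
    fin_cases a
    · simp [rightLadder, pow_succ, mul_assoc]
    · simp [rightLadder, pow_succ _ (n + 1)]

/-- The ladder of the pairs `xⁿ⁺¹, xⁿ y`. -/
def leftLadder (hx : x ∈ homog k m 1) (hy : y ∈ homog k m 1) (h : LinearIndependent k ![x, y]) :
    Ladder k m 2 where
  start := ![x, y]
  M := !![x, y; 0, 0]
  C := fun _ φ => !![φ x, 0; 0, φ x]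
  start_mem := by simp [Fin.forall_fin_two, hx, hy]
  M_mem := by simp [Fin.forall_fin_two, hx, hy]
  li := h
  inj := fun z hz => by
    have h0 := LinearIndependent.pair_iff.1 h (z 0) (z 1) (by simpa using hz 0)
    ext a
    fin_cases a
    · exact h0.1
    · exact h0.2
  base := by simp [Fin.forall_fin_two]
  comm := by simp [Fin.forall_fin_two]
  detect := fun n t ht => by
    obtain ⟨φ, ψ, h1, h2, h3, h4⟩ := exists_dual_pair h
    obtain ⟨y₁, hy₁⟩ := ht φ
    refine ⟨y₁, fun a => ?_⟩
    fin_cases a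
    · simpa [h1] using hy₁ 0
    · simpa [h1] using hy₁ 1

theorem leftLadder_e (hx : x ∈ homog k m 1) (hy : y ∈ homog k m 1)
    (h : LinearIndependent k ![x, y]) (n : ℕ) :
    (leftLadder hx hy h).e n = ![x ^ (n + 1), x ^ n * y] := by
  induction n with
  | zero => simp [Ladder.e, leftLadder]
  | succ n ih =>
    ext a
    rw [Ladder.e_succ, ih]
    fin_cases a
    · simp [leftLadder, pow_succ _ (n + 1)]
    · simp [leftLadder]

/-- The pair of alternating words of length `n`, ending in `x` and in `y`. -/
def altPair (x y : Free k m) : ℕ → Fin 2 → Free k m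
  | 0 => ![1, 1]
  | n + 1 => ![altPair x y n 1 * x, altPair x y n 0 * y]

/-- The ladder of the alternating words. -/
def altLadder (hx : x ∈ homog k m 1) (hy : y ∈ homog k m 1) (h : LinearIndependent k ![x, y]) :
    Ladder k m 2 where
  start := ![x, y]
  M := !![0, y; x, 0]
  -- The last letter and the parity of the length determine the first letter of an alternating word.
  C := fun n φ => if Even n then !![φ y, 0; 0, φ x] else !![φ x, 0; 0, φ y]
  start_mem := by simp [Fin.forall_fin_two, hx, hy]
  M_mem := by simp [Fin.forall_fin_two, hx, hy]
  li := h
  inj := fun z hz => by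
    have hx0 : x ≠ 0 := h.ne_zero 0
    have hy0 : y ≠ 0 := h.ne_zero 1
    ext a
    fin_cases a
    · simpa [hx0] using hz 1
    · simpa [hy0] using hz 0
  base := by simp [Fin.forall_fin_two]
  comm := fun n φ => by
    by_cases hn : Even n
    · have : ¬ Even (n + 1) := by simpa [Nat.even_add_one] using hn
      simp [Fin.forall_fin_two, hn, this]
    · have : Even (n + 1) := by simpa [Nat.even_add_one] using hn
      simp [Fin.forall_fin_two, hn, this]
  detect := fun n t ht => by
    obtain ⟨φ, ψ, h1, h2, h3, h4⟩ := exists_dual_pair h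
    obtain ⟨y₁, hy₁⟩ := ht φ
    obtain ⟨y₂, hy₂⟩ := ht ψ
    by_cases hn : Even n
    · refine ⟨![y₁ 0, y₂ 1], fun a => ?_⟩
      fin_cases a
      · simpa [h3, h4, hn] using hy₂ 0
      · simpa [h1, h2, hn] using hy₁ 1
    · refine ⟨![y₂ 0, y₁ 1], fun a => ?_⟩
      fin_cases a
      · simpa [h1, h2, hn] using hy₁ 0
      · simpa [h3, h4, hn] using hy₂ 1

theorem altLadder_e (hx : x ∈ homog k m 1) (hy : y ∈ homog k m 1)
    (h : LinearIndependent k ![x, y]) (n : ℕ) :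
    (altLadder hx hy h).e n = altPair x y (n + 1) := by
  induction n with
  | zero => simp [Ladder.e, altLadder, altPair]
  | succ n ih =>
    ext a
    rw [Ladder.e_succ, ih, altPair.eq_2 x y (n + 1)]
    fin_cases a <;> simp [altLadder]

/-- The ladder of the pairs `qⁿ xⁿ, ∑ qⁱ xⁱ y xⁿ⁻¹⁻ⁱ`. -/
def qLadder (hx : x ∈ homog k m 1) (hy : y ∈ homog k m 1) (h : LinearIndependent k ![x, y])
    {q : k} (hq : q ≠ 0) : Ladder k m 2 where
  start := ![q • x, y]
  M := !![q • x, y; 0, x]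
  -- Contracting the q-sum along `y` leaves a bare power of `x`, whereas the ladder carries that
  -- power with the factor q^(n+1); hence the inverse.
  C := fun n φ => !![q * φ x, (q ^ (n + 1))⁻¹ * φ y; 0, q * φ x]
  start_mem := by simp [Fin.forall_fin_two, hy, Submodule.smul_mem _ _ hx]
  M_mem := by simp [Fin.forall_fin_two, hx, hy, Submodule.smul_mem _ _ hx]
  li := by
    rw [LinearIndependent.pair_iff] at h ⊢
    intro a b hab
    have := h (a * q) b (by rw [mul_smul]; exact hab)
    exact ⟨(mul_eq_zero.1 this.1).resolve_right hq, this.2⟩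
  inj := fun z hz => by
    have hx0 : x ≠ 0 := h.ne_zero 0
    have h1 : z 1 = 0 := by simpa [hx0] using hz 1
    have h0 : z 0 = 0 := by simpa [hx0, h1, hq] using hz 0
    ext a
    fin_cases a
    · exact h0
    · exact h1
  base := fun φ => by
    simp only [Fin.forall_fin_two, Fin.sum_univ_two]
    simp [smul_smul, hq, mul_comm, add_comm]
  comm := fun n φ => by
    simp only [Fin.forall_fin_two, Fin.sum_univ_two]
    have h1 : q * φ x * q = q * (q * φ x) := by ring
    have h2 : (q ^ (n + 1))⁻¹ * φ y = (q ^ (n + 1 + 1))⁻¹ * φ y * q := by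
      rw [pow_succ q (n + 1)]; field_simp
    simp [smul_smul, h1, h2, add_comm]
  detect := fun n t ht => by
    obtain ⟨φ, ψ, h1, h2, h3, h4⟩ := exists_dual_pair h
    obtain ⟨z, hz⟩ := ht φ
    -- For `φ x = 1` and `φ y = 0` the contraction matrix is `q` times the identity.
    refine ⟨q⁻¹ • z, fun a => smul_right_injective _ hq ?_⟩
    fin_cases a
    · have := hz 0
      simp only [Fin.sum_univ_two] at this ⊢
      simp [h1, h2] at this
      simp [smul_smul, hq, this]
      congr 1
      field_simp
    · have := hz 1
      simp only [Fin.sum_univ_two] at this ⊢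
      simp [h1, h2] at this
      simp [smul_smul, hq, this]

theorem qLadder_e (hx : x ∈ homog k m 1) (hy : y ∈ homog k m 1)
    (h : LinearIndependent k ![x, y]) {q : k} (hq : q ≠ 0) (n : ℕ) :
    (qLadder hx hy h hq).e n = ![q ^ (n + 1) • x ^ (n + 1), qsum q x y (n + 1)] := by
  induction n with
  | zero => simp [Ladder.e, qLadder, qsum]
  | succ n ih =>
    ext a
    rw [Ladder.e_succ, ih]
    fin_cases a
    · simp [qLadder, smul_smul, pow_succ _ (n + 1), mul_comm]
    · simp [qLadder, qsum.eq_2 q x y (n + 1)]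

end Families

end Ladder

end HomogAlg

end

noncomputable section

namespace HomogAlg

/-! ### Relations containing a pure power -/

section PowerRelation

variable {k : Type u} [Field k] {m : ℕ}

theorem linearIndependent_pair_of_notMem {E : Type*} [AddCommGroup E] [Module k E] {x y : E}
    (hx : x ≠ 0) (h : y ∉ Submodule.span k {x}) : LinearIndependent k ![x, y] := by
  rw [LinearIndependent.pair_iff' hx]
  exact fun a ha => h (Submodule.mem_span_singleton.2 ⟨a, ha⟩)

theorem linearIndependent_pair_swap {E : Type*} [AddCommGroup E] [Module k E] {x y : E}
    (h : LinearIndependent k ![x, y]) : LinearIndependent k ![y, x] := by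
  rw [LinearIndependent.pair_iff] at h ⊢
  exact fun s t hst => (h t s (by rw [add_comm]; exact hst)).symm

theorem qsum_smul_self (q c : k) (v : Free k m) (n : ℕ) :
    ∃ κ : k, qsum q v (c • v) n = κ • v ^ n := by
  induction n with
  | zero => exact ⟨0, by rw [qsum, zero_smul]⟩
  | succ n ih =>
    obtain ⟨κ, hκ⟩ := ih
    refine ⟨q ^ n * c + κ, ?_⟩
    rw [qsum, hκ, mul_smul_comm, smul_mul_assoc, ← pow_succ, smul_smul, add_smul]

/-- A second overlap beside the power of `v` determines R. The cases are `b = 0`, giving v^(n+1) and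
v^n a; `d = 0`, giving c v^n and v^(n+1); `b` and `d` both nonzero multiples of `v`, giving a power
and a q-sum; exactly one of them a multiple of `v`, impossible by descent; and neither, giving two
pure powers. -/
theorem exists_ladder_of_pow {n : ℕ} (hn : n ≠ 0) {v g a b c d : Free k m}
    (hv : v ∈ homog k m 1) (ha : a ∈ homog k m 1) (hb : b ∈ homog k m 1) (hc : c ∈ homog k m 1)
    (hd : d ∈ homog k m 1) (hg : g ∈ homog k m (n + 1))
    (hli : LinearIndependent k ![v ^ (n + 1), g])
    (H : v ^ (n + 1) * a + g * b = c * v ^ (n + 1) + d * g)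
    (hE : v ^ (n + 1) * a + g * b ∉ Submodule.span k {v ^ (n + 2)}) :
    ∃ L : Ladder k m 2, ∀ j, L.e n j ∈ Submodule.span k {v ^ (n + 1), g} := by
  have hv0 : v ≠ 0 := by
    rintro rfl
    exact hli.ne_zero 0 (by simp)
  have hpair := LinearIndependent.pair_iff.1 hli
  have hpow : v ^ (n + 1) ∈ Submodule.span k {v ^ (n + 1), g} := Submodule.subset_span (by simp)
  have hE' : ∀ κ : k, v ^ (n + 1) * a + g * b ≠ κ • v ^ (n + 2) := fun κ h =>
    hE (Submodule.mem_span_singleton.2 ⟨κ, h.symm⟩)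
  have hlcf : ∀ φ : Free k m →ₗ[k] k, φ v = 0 → ∀ t, lcf φ (v ^ (n + 1) * t) = 0 :=
    fun φ hφ t => by rw [pow_succ', mul_assoc, lcf_mul φ hv, hφ, zero_smul]
  have hrcf : ∀ φ : Free k m →ₗ[k] k, φ v = 0 → ∀ t, rcf φ (t * v ^ (n + 1)) = 0 :=
    fun φ hφ t => by rw [pow_succ, ← mul_assoc, rcf_mul φ hv, hφ, zero_smul]
  by_cases hb0 : b = 0
  · rw [hb0, mul_zero, add_zero] at H hE'
    have h1 : ∀ φ : Free k m →ₗ[k] k, φ v = 0 → φ c = 0 ∧ φ d = 0 := fun φ hφ => by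
      have := congrArg (lcf φ) H
      rw [hlcf φ hφ, map_add, lcf_mul φ hc, lcf_mul φ hd] at this
      exact hpair _ _ this.symm
    obtain ⟨γ, rfl⟩ := mem_span_singleton_of_forall fun φ hφ => (h1 φ hφ).1
    obtain ⟨δ, rfl⟩ := mem_span_singleton_of_forall fun φ hφ => (h1 φ hφ).2
    have h2 : v ^ n * a = γ • v ^ (n + 1) + δ • g := by
      refine mul_left_cancel₀ hv0 ?_
      rw [← mul_assoc, ← pow_succ', H, mul_add, mul_smul_comm, mul_smul_comm, smul_mul_assoc,
        smul_mul_assoc]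
    have hva : LinearIndependent k ![v, a] := by
      refine linearIndependent_pair_of_notMem hv0 fun h => ?_
      obtain ⟨α, rfl⟩ := Submodule.mem_span_singleton.1 h
      exact hE' α (by rw [mul_smul_comm, ← pow_succ])
    refine ⟨leftLadder hv ha hva, fun j => ?_⟩
    rw [leftLadder_e]
    fin_cases j
    · exact hpow
    · exact h2 ▸ Submodule.mem_span_pair.2 ⟨γ, δ, rfl⟩
  by_cases hd0 : d = 0
  · rw [hd0, zero_mul, add_zero] at H
    rw [H] at hE'
    have h1 : ∀ φ : Free k m →ₗ[k] k, φ v = 0 → φ a = 0 ∧ φ b = 0 := fun φ hφ => by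
      have := congrArg (rcf φ) H
      rw [hrcf φ hφ, map_add, rcf_mul φ ha, rcf_mul φ hb] at this
      exact hpair _ _ this
    obtain ⟨α, rfl⟩ := mem_span_singleton_of_forall fun φ hφ => (h1 φ hφ).1
    obtain ⟨β, rfl⟩ := mem_span_singleton_of_forall fun φ hφ => (h1 φ hφ).2
    have h2 : c * v ^ n = α • v ^ (n + 1) + β • g := by
      refine mul_right_cancel₀ hv0 ?_
      rw [mul_assoc, ← pow_succ, ← H, add_mul, mul_smul_comm, mul_smul_comm, smul_mul_assoc,
        smul_mul_assoc]
    have hcv : LinearIndependent k ![c, v] := by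
      refine linearIndependent_pair_swap (linearIndependent_pair_of_notMem hv0 fun h => ?_)
      obtain ⟨γ, rfl⟩ := Submodule.mem_span_singleton.1 h
      exact hE' γ (by rw [smul_mul_assoc, ← pow_succ'])
    refine ⟨rightLadder hc hv hcv, fun j => ?_⟩
    rw [rightLadder_e]
    fin_cases j
    · exact h2 ▸ Submodule.mem_span_pair.2 ⟨α, β, rfl⟩
    · exact hpow
  by_cases hbv : b ∈ Submodule.span k {v}
  · obtain ⟨β, rfl⟩ := Submodule.mem_span_singleton.1 hbv
    rw [mul_smul_comm] at H
    by_cases hdv : d ∈ Submodule.span k {v}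
    · obtain ⟨δ, rfl⟩ := Submodule.mem_span_singleton.1 hdv
      have hβ : β ≠ 0 := fun h => hb0 (by rw [h, zero_smul])
      have hδ : δ ≠ 0 := fun h => hd0 (by rw [h, zero_smul])
      have hq : β⁻¹ * δ ≠ 0 := mul_ne_zero (inv_ne_zero hβ) hδ
      -- Dividing by `β` puts the overlap equation in q-commutation form with `q = β⁻¹ δ`.
      obtain ⟨κ, hκ⟩ := eq_qsum_of_mul_eq (c := β⁻¹ • c) hq β⁻¹ hv ha hg hv0 (by
        have h1 : β • (g * v) = c * v ^ (n + 1) + δ • (v * g) - v ^ (n + 1) * a := by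
          rw [← smul_mul_assoc δ, ← H, add_sub_cancel_left]
        have h2 : g * v = β⁻¹ • β • (g * v) := by rw [smul_smul, inv_mul_cancel₀ hβ, one_smul]
        rw [h2, h1, smul_mul_assoc]
        module)
      have hva : LinearIndependent k ![v, a] := by
        refine linearIndependent_pair_of_notMem hv0 fun h => ?_
        obtain ⟨α, rfl⟩ := Submodule.mem_span_singleton.1 h
        obtain ⟨κ', hκ'⟩ := qsum_smul_self (β⁻¹ * δ) α v (n + 1)
        rw [hκ', smul_smul, ← add_smul] at hκ
        have := hpair (-(β⁻¹ * ((β⁻¹ * δ) ^ (n + 1))⁻¹ * κ' + κ)) 1 (by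
          conv_lhs => rw [hκ]
          module)
        exact one_ne_zero this.2
      refine ⟨qLadder hv ha hva hq, fun j => ?_⟩
      rw [qLadder_e]
      fin_cases j
      · exact Submodule.smul_mem _ _ hpow
      · have ht : β⁻¹ * ((β⁻¹ * δ) ^ (n + 1))⁻¹ ≠ 0 :=
          mul_ne_zero (inv_ne_zero hβ) (inv_ne_zero (pow_ne_zero _ hq))
        refine (Submodule.smul_mem_iff _ ht).1 ?_
        change (β⁻¹ * ((β⁻¹ * δ) ^ (n + 1))⁻¹) • qsum (β⁻¹ * δ) v a (n + 1) ∈ _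
        rw [← sub_eq_of_eq_add hκ]
        exact sub_mem (Submodule.subset_span (by simp)) (Submodule.smul_mem _ _ hpow)
    · exact (false_of_right_factor hv ha hc hd hg hv0 hdv hli H).elim
  by_cases hdv : d ∈ Submodule.span k {v}
  · obtain ⟨δ, rfl⟩ := Submodule.mem_span_singleton.1 hdv
    rw [smul_mul_assoc] at H
    exact (false_of_left_factor hv ha hb hc hg hv0 hbv hli H).elim
  · obtain ⟨n, rfl⟩ := Nat.exists_eq_succ_of_ne_zero hn
    simp only [Nat.succ_eq_add_one] at *
    obtain ⟨ψ, hψv, hψb⟩ := exists_functional_of_notMem_span hbv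
    have hvd : LinearIndependent k ![v, d] := linearIndependent_pair_of_notMem hv0 hdv
    obtain ⟨φ', φ, h'v, h'd, hφv, hφd⟩ := exists_dual_pair hvd
    have hd0 : d ≠ 0 := hvd.ne_zero 1
    have h1 : g = d * rcf ψ g - ψ a • v ^ (n + 1 + 1) := by
      have := congrArg (rcf ψ) H
      rw [map_add, map_add, hrcf ψ hψv, rcf_mul ψ ha, rcf_mul ψ hb, hψb, one_smul, zero_add,
        rcf_mul_of_mem ψ hg] at this
      rw [← this, add_sub_cancel_left]
    have hk : rcf ψ g ∈ homog k m (n + 1) := rcon_mem _ hg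
    set h := rcf ψ g
    clear_value h
    have hh0 : h ≠ 0 := by
      rintro rfl
      have := hpair (ψ a) 1 (by rw [one_smul]; conv_lhs => rw [h1]
                                rw [mul_zero, zero_sub, add_neg_cancel])
      exact one_ne_zero this.2
    have hc' : c - ψ a • d ∈ homog k m 1 := sub_mem hc (Submodule.smul_mem _ _ hd)
    have h2 : v ^ (n + 1 + 1) * (a - ψ a • b) + d * h * b =
        (c - ψ a • d) * v ^ (n + 1 + 1) + d * (d * h) := by
      have h3 := H
      rw [h1] at h3
      have h4 : v ^ (n + 1 + 1) * a = c * v ^ (n + 1 + 1) + d * (d * h - ψ a • v ^ (n + 1 + 1)) -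
          (d * h - ψ a • v ^ (n + 1 + 1)) * b := by rw [← h3]; abel
      rw [mul_sub, h4]
      simp only [mul_sub, sub_mul, smul_mul_assoc, mul_smul_comm, mul_assoc]
      module
    -- Up to a multiple of the power of `v`, `g` equals `d * h`. Contracting `d` away and then
    -- testing against `φ'` removes the power of `v`, leaving `h * b = d * h`, so `h` is a multiple
    -- of a power of `d`.
    have h3 : h * b = φ (c - ψ a • d) • v ^ (n + 1 + 1) + d * h := by
      have := congrArg (lcf φ) h2
      rwa [map_add, map_add, hlcf φ hφv, zero_add, mul_assoc, lcf_mul φ hd, lcf_mul φ hd, hφd,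
        one_smul, one_smul, lcf_mul φ hc'] at this
    have h4 : h = d * rcf ψ h := by
      have := congrArg (rcf ψ) h3
      rwa [rcf_mul ψ hb, hψb, one_smul, map_add, map_smul, ← one_mul (v ^ (n + 1 + 1)),
        hrcf ψ hψv, smul_zero, zero_add, rcf_mul_of_mem ψ hk] at this
    have h5 : φ (c - ψ a • d) = 0 := by
      have := congrArg (lcf φ') h3
      rw [lcf_mul_of_mem φ' hk, h4, lcf_mul φ' hd, h'd, zero_smul, zero_mul, map_add, map_smul,
        lcf_mul φ' hd, h'd, zero_smul, add_zero, pow_succ', lcf_mul φ' hv, h'v, one_smul] at this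
      exact (smul_eq_zero.1 this.symm).resolve_right (pow_ne_zero _ hv0)
    rw [h5, zero_smul, zero_add] at h3
    obtain ⟨-, κ, hκ⟩ := eq_pow_of_mul_eq_mul hd hd0 hk hh0 h3.symm
    refine ⟨diagLadder hv hd hvd, fun j => ?_⟩
    rw [diagLadder_e]
    fin_cases j
    · exact hpow
    · have hκ0 : κ ≠ 0 := fun h0 => hh0 (by rw [hκ, h0, zero_smul])
      refine (Submodule.smul_mem_iff _ hκ0).1 ?_
      change κ • d ^ (n + 1 + 1) ∈ _
      rw [pow_succ' d, ← mul_smul_comm, ← hκ, ← add_eq_of_eq_sub h1]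
      exact add_mem (Submodule.subset_span (by simp)) (Submodule.smul_mem _ _ hpow)

end PowerRelation

/-! ### Relations of the form vh, hu -/

section Alternating

variable {k : Type u} [Field k] {m : ℕ}

/-- Functionals killing `v` leave only the term with `u * b`, so they kill `h`; thus `h` begins with
`v`, and dividing by `v` keeps the equation. -/
theorem eq_pow_of_left_factor {n : ℕ} {v u h a b : Free k m} {γ δ : k} (hv : v ∈ homog k m 1)
    (hv0 : v ≠ 0) (hu0 : u ≠ 0) (hb0 : b ≠ 0) (hh : h ∈ homog k m n)
    (H : v * h * a + h * u * b = γ • (v * (v * h)) + δ • (v * (h * u))) :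
    ∃ κ : k, h = κ • v ^ n := by
  obtain ⟨φ, hφ⟩ := exists_functional_eq_one (k := k) hv0
  induction n generalizing h with
  | zero =>
    obtain ⟨κ, hκ⟩ := exists_eq_smul_one hh
    exact ⟨κ, by rw [hκ, pow_zero]⟩
  | succ n ih =>
    have h1 : h = v * lcf φ h := by
      refine eq_mul_lcf hh hv (fun ψ hψ => ?_) hφ
      have := congrArg (lcf ψ) H
      rw [map_add, map_add, map_smul, map_smul, mul_assoc, mul_assoc, lcf_mul ψ hv, lcf_mul ψ hv,
        lcf_mul ψ hv, hψ, lcf_mul_of_mem ψ hh] at this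
      simpa [hu0, hb0] using this
    have hh' : lcf φ h ∈ homog k m n := lcon_mem _ hh
    set h' := lcf φ h
    clear_value h'
    obtain ⟨κ, hκ⟩ := ih hh' (mul_left_cancel₀ hv0 (by
      have h2 := H
      rw [h1] at h2
      simp only [mul_add, mul_smul_comm, mul_assoc] at h2 ⊢
      exact h2))
    exact ⟨κ, by rw [h1, hκ, mul_smul_comm, ← pow_succ']⟩

/-- The equation passes from `h` to its contraction, while `h` is that contraction times `u` up to a
scalar. -/
theorem eq_pow_of_eq_lcf_mul {n : ℕ} {u h : Free k m} {κ : k} (ξ : Free k m →ₗ[k] k)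
    (hh : h ∈ homog k m n) (H : h = κ • (lcf ξ h * u)) : ∃ c : k, h = c • u ^ n := by
  induction n generalizing h with
  | zero =>
    obtain ⟨κ, hκ⟩ := exists_eq_smul_one hh
    exact ⟨κ, by rw [hκ, pow_zero]⟩
  | succ n ih =>
    have h1 : lcf ξ h ∈ homog k m n := lcon_mem _ hh
    have h2 : ∃ c : k, lcf ξ h = c • u ^ n := by
      cases n with
      | zero =>
        obtain ⟨κ, hκ⟩ := exists_eq_smul_one h1
        exact ⟨κ, by rw [hκ, pow_zero]⟩
      | succ n =>
        refine ih h1 ?_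
        conv_lhs => rw [H, map_smul, lcf_mul_of_mem ξ h1]
    obtain ⟨c, hc⟩ := h2
    exact ⟨κ * c, by rw [H, hc, smul_mul_assoc, smul_smul, pow_succ]⟩

theorem eq_pow_of_mul_eq_lcf {n : ℕ} {u v h : Free k m} {A B β : k} (hA : A ≠ 0)
    (ξ : Free k m →ₗ[k] k) (hu : u ∈ homog k m 1) (hu0 : u ≠ 0) (hv0 : v ≠ 0)
    (hh : h ∈ homog k m n) (H : A • (v * h) = β • (lcf ξ h * u * u) - B • (h * u)) :
    ∃ c : k, h = c • u ^ n := by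
  obtain ⟨φ, hφ⟩ := exists_functional_eq_one (k := k) hu0
  induction n generalizing h with
  | zero =>
    obtain ⟨κ, hκ⟩ := exists_eq_smul_one hh
    exact ⟨κ, by rw [hκ, pow_zero]⟩
  | succ n ih =>
    have h1 : h = rcf φ h * u := by
      refine eq_rcf_mul hh hu (fun ψ hψ => ?_) hφ
      have := congrArg (rcf ψ) H
      rw [map_sub, map_smul, map_smul, map_smul, rcf_mul ψ hu, rcf_mul ψ hu, hψ,
        rcf_mul_of_mem ψ hh] at this
      simpa [hA, hv0] using this
    have hh' : rcf φ h ∈ homog k m n := rcon_mem _ hh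
    set h' := rcf φ h
    clear_value h'
    cases n with
    | zero =>
      obtain ⟨κ, hκ⟩ := exists_eq_smul_one hh'
      exact ⟨κ, by rw [h1, hκ, smul_mul_assoc, one_mul, zero_add, pow_one]⟩
    | succ n =>
      obtain ⟨κ, hκ⟩ := ih hh' (mul_right_cancel₀ hu0 (by
        have h2 := H
        rw [h1, lcf_mul_of_mem ξ hh'] at h2
        simp only [sub_mul, smul_mul_assoc, mul_assoc] at h2 ⊢
        exact h2))
      exact ⟨κ, by rw [h1, hκ, smul_mul_assoc, ← pow_succ]⟩

/-- Contracting on the right along `ζ` and on the left along `φ` shows that `lcf ξ h` begins with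
`v`. Contracting once more along `ξ`, which kills `v`, isolates the term with coefficient `B`. -/
theorem exists_factor_of_lcf_mul_eq {n : ℕ} {u v b h : Free k m} {A B : k}
    {ξ ζ φ : Free k m →ₗ[k] k} (hξ : ξ v = 0) (hζu : ζ u = 0) (hζb : ζ b = 1) (hφ : φ v = 1)
    (hv : v ∈ homog k m 1) (hu : u ∈ homog k m 1) (hb : b ∈ homog k m 1) (hu0 : u ≠ 0)
    (hh : h ∈ homog k m (n + 2)) (hh0 : lcf ξ h ≠ 0 ∨ B = 0)
    (H : lcf ξ h * u * b = A • (v * h) + B • (h * u)) :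
    ∃ h' ∈ homog k m n, lcf ξ h = v * h' ∧ h' * u * b = A • h ∧ B = 0 := by
  have hv0 : v ≠ 0 := by
    rintro rfl
    rw [map_zero] at hφ
    exact zero_ne_one hφ
  have hξh : lcf ξ h ∈ homog k m (n + 1) := lcon_mem _ hh
  have h1 : lcf ξ h * u = A • (v * rcf ζ h) := by
    have := congrArg (rcf ζ) H
    rwa [rcf_mul ζ hb, hζb, one_smul, map_add, map_smul, map_smul, rcf_mul ζ hu, hζu, zero_smul,
      smul_zero, add_zero, rcf_mul_of_mem ζ hh] at this
  have h2 : lcf φ (lcf ξ h) * u = A • rcf ζ h := by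
    have := congrArg (lcf φ) h1
    rwa [lcf_mul_of_mem φ hξh, map_smul, lcf_mul φ hv, hφ, one_smul] at this
  have h3 : lcf ξ h = v * lcf φ (lcf ξ h) := mul_right_cancel₀ hu0 (by
    rw [h1, mul_assoc, h2, mul_smul_comm])
  have hB : B = 0 := by
    rcases hh0 with hh0 | hB
    · have := congrArg (lcf ξ) H
      rw [h3, mul_assoc, mul_assoc, lcf_mul ξ hv, hξ, zero_smul, map_add, map_smul, map_smul,
        lcf_mul ξ hv, hξ, zero_smul, smul_zero, zero_add, lcf_mul_of_mem ξ hh] at this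
      exact (smul_eq_zero.1 this.symm).resolve_right (mul_ne_zero hh0 hu0)
    · exact hB
  refine ⟨lcf φ (lcf ξ h), lcon_mem _ hξh, h3, mul_left_cancel₀ hv0 ?_, hB⟩
  rw [hB, zero_smul, add_zero, h3] at H
  rw [← mul_assoc, ← mul_assoc, H, mul_smul_comm]

/-- The factorization makes `h` a scalar multiple of `h' * u * b` with `h'` subject to the same
equation: each round removes the two letters `u`, `b`, down to degree 1 or 2. -/
theorem eq_altPair_of_lcf_mul_eq {n : ℕ} {u v b h : Free k m} {A : k} (hA : A ≠ 0)
    {ξ ζ φ : Free k m →ₗ[k] k} (hξ : ξ v = 0) (hζu : ζ u = 0) (hζb : ζ b = 1) (hφ : φ v = 1)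
    (hv : v ∈ homog k m 1) (hu : u ∈ homog k m 1) (hb : b ∈ homog k m 1) (hu0 : u ≠ 0)
    (hh : h ∈ homog k m (n + 1)) (H : lcf ξ h * u * b = A • (v * h)) :
    (∃ κ : k, h = κ • altPair u b (n + 1) 1) ∧ ∃ κ : k, v * h = κ • altPair u b (n + 2) 1 := by
  have halt : ∀ n, altPair u b (n + 2) 1 = altPair u b n 1 * u * b := fun n => rfl
  have hdiv : ∀ {x y : Free k m}, x = A • y → y = A⁻¹ • x := fun h => by
    rw [h, smul_smul, inv_mul_cancel₀ hA, one_smul]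
  induction n using Nat.twoStepInduction generalizing h with
  | zero =>
    obtain ⟨c, hc⟩ := exists_eq_smul_one (lcon_mem (fun i => ξ (FreeAlgebra.ι k i)) hh)
    have h1 : v * h = (A⁻¹ * c) • (u * b) := by
      rw [hdiv H, hc, smul_mul_assoc, smul_mul_assoc, one_mul, smul_smul]
    refine ⟨⟨A⁻¹ * c * φ u, ?_⟩, A⁻¹ * c, ?_⟩
    · have := congrArg (lcf φ) h1
      rw [lcf_mul φ hv, hφ, one_smul, map_smul, lcf_mul φ hu, smul_smul] at this
      rw [this, altPair]
      simp [altPair]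
    · rw [h1, halt]
      simp [altPair]
  | one =>
    obtain ⟨h', hh', h1, h2, -⟩ := exists_factor_of_lcf_mul_eq (A := A) (B := 0) hξ hζu hζb hφ hv hu
      hb hu0 hh (Or.inr rfl) (by rw [zero_smul, add_zero]; exact H)
    obtain ⟨c, rfl⟩ := exists_eq_smul_one hh'
    have h3 : h = (A⁻¹ * c) • (u * b) := by
      rw [hdiv h2, smul_mul_assoc, smul_mul_assoc, one_mul, smul_smul]
    refine ⟨⟨A⁻¹ * c, by rw [h3, halt]; simp [altPair]⟩, A⁻¹ * (A⁻¹ * c * ξ u), ?_⟩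
    have h4 : lcf ξ h = (A⁻¹ * c * ξ u) • b := by
      rw [h3, map_smul, lcf_mul ξ hu, smul_smul]
    rw [hdiv H, h4, halt, smul_mul_assoc, smul_mul_assoc, smul_smul]
    simp [altPair]
  | more n ih _ =>
    obtain ⟨h', hh', h1, h2, -⟩ := exists_factor_of_lcf_mul_eq (A := A) (B := 0) hξ hζu hζb hφ hv hu
      hb hu0 hh (Or.inr rfl) (by rw [zero_smul, add_zero]; exact H)
    have h3 := hdiv h2
    obtain ⟨⟨κ, hκ⟩, κ', hκ'⟩ := ih hh' (by
      have := h1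
      rw [h3, map_smul, mul_assoc, lcf_mul_of_mem ξ hh', ← mul_assoc] at this
      rw [← this, smul_smul, mul_inv_cancel₀ hA, one_smul])
    refine ⟨⟨A⁻¹ * κ, ?_⟩, A⁻¹ * κ', ?_⟩
    · rw [h3, hκ, halt, smul_mul_assoc, smul_mul_assoc, smul_smul]
    · rw [h3, mul_smul_comm, ← mul_assoc, ← mul_assoc, hκ', smul_mul_assoc, smul_mul_assoc,
        smul_smul]
      rfl

/-- A second overlap is contracted along a functional `ξ` killing `v`. Every degenerate possibility
makes `h` a multiple of a power of `v` or `u` and so puts a pure power in R, against `hpow`, or else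
contradicts `hE`. What survives makes `h` an alternating word in `u` and `b`. -/
theorem exists_ladder_of_mul {n : ℕ} {v u h a b c d : Free k m}
    (hv : v ∈ homog k m 1) (hu : u ∈ homog k m 1) (hb : b ∈ homog k m 1)
    (hc : c ∈ homog k m 1) (hd : d ∈ homog k m 1) (hh : h ∈ homog k m (n + 2))
    (hli : LinearIndependent k ![v * h, h * u])
    (hpow : ∀ w ∈ homog k m 1, w ≠ 0 → w ^ (n + 3) ∉ Submodule.span k {v * h, h * u})
    (H : v * h * a + h * u * b = c * (v * h) + d * (h * u))
    (hE : v * h * a + h * u * b ∉ Submodule.span k {v * h * u}) :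
    ∃ L : Ladder k m 2, ∀ j, L.e (n + 2) j ∈ Submodule.span k {v * h, h * u} := by
  have hpair := LinearIndependent.pair_iff.1 hli
  have hmem1 : v * h ∈ Submodule.span k {v * h, h * u} := Submodule.subset_span (by simp)
  have hmem2 : h * u ∈ Submodule.span k {v * h, h * u} := Submodule.subset_span (by simp)
  have hv0 : v ≠ 0 := left_ne_zero_of_mul (hli.ne_zero 0)
  have hh0 : h ≠ 0 := right_ne_zero_of_mul (hli.ne_zero 0)
  have hu0 : u ≠ 0 := right_ne_zero_of_mul (hli.ne_zero 1)
  have hhv : ∀ κ : k, h ≠ κ • v ^ (n + 2) := fun κ hκ => hpow v hv hv0 (by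
    have hκ0 : κ ≠ 0 := fun h0 => hh0 (by rw [hκ, h0, zero_smul])
    refine (Submodule.smul_mem_iff _ hκ0).1 ?_
    rwa [pow_succ', ← mul_smul_comm, ← hκ])
  have hhu : ∀ κ : k, h ≠ κ • u ^ (n + 2) := fun κ hκ => hpow u hu hu0 (by
    have hκ0 : κ ≠ 0 := fun h0 => hh0 (by rw [hκ, h0, zero_smul])
    refine (Submodule.smul_mem_iff _ hκ0).1 ?_
    rwa [pow_succ, ← smul_mul_assoc, ← hκ])
  have hlcf : ∀ φ : Free k m →ₗ[k] k, φ v = 0 →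
      lcf φ h * u * b = φ c • (v * h) + φ d • (h * u) := fun φ hφ => by
    have := congrArg (lcf φ) H
    rwa [map_add, map_add, mul_assoc v, lcf_mul φ hv, hφ, zero_smul, zero_add, mul_assoc h,
      lcf_mul_of_mem φ hh, lcf_mul φ hc, lcf_mul φ hd, ← mul_assoc] at this
  have hb0 : b ≠ 0 := by
    rintro rfl
    have h1 : ∀ φ : Free k m →ₗ[k] k, φ v = 0 → φ c = 0 ∧ φ d = 0 := fun φ hφ =>
      hpair _ _ (by rw [← hlcf φ hφ, mul_zero])
    obtain ⟨γ, rfl⟩ := mem_span_singleton_of_forall fun φ hφ => (h1 φ hφ).1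
    obtain ⟨δ, rfl⟩ := mem_span_singleton_of_forall fun φ hφ => (h1 φ hφ).2
    have h2 : h * a = γ • (v * h) + δ • (h * u) := by
      refine mul_left_cancel₀ hv0 ?_
      rw [mul_zero, add_zero] at H
      rw [← mul_assoc, H, mul_add, mul_smul_comm, mul_smul_comm, smul_mul_assoc, smul_mul_assoc]
    by_cases hγ : γ = 0
    · rw [hγ, zero_smul, zero_add] at h2
      exact hE (Submodule.mem_span_singleton.2 ⟨δ, by
        rw [mul_zero, add_zero, mul_assoc, mul_assoc, h2, mul_smul_comm]⟩)
    · obtain ⟨-, κ, hκ⟩ := eq_pow_of_mul_eq_mul (u := γ⁻¹ • (a - δ • u)) hv hv0 hh hh0 (by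
        rw [mul_smul_comm, mul_sub, h2, mul_smul_comm, add_sub_cancel_right, smul_smul,
          inv_mul_cancel₀ hγ, one_smul])
      exact hhv κ hκ
  -- Otherwise `c` and `d` would both be multiples of `v`, and `eq_pow_of_left_factor` would make
  -- `h` a multiple of a power of `v`.
  obtain ⟨ξ, hξ, hξh⟩ : ∃ ξ : Free k m →ₗ[k] k, ξ v = 0 ∧ lcf ξ h ≠ 0 := by
    by_contra! hcon
    have h1 : ∀ φ : Free k m →ₗ[k] k, φ v = 0 → φ c = 0 ∧ φ d = 0 := fun φ hφ =>
      hpair _ _ (by rw [← hlcf φ hφ, hcon φ hφ, zero_mul, zero_mul])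
    obtain ⟨γ, rfl⟩ := mem_span_singleton_of_forall fun φ hφ => (h1 φ hφ).1
    obtain ⟨δ, rfl⟩ := mem_span_singleton_of_forall fun φ hφ => (h1 φ hφ).2
    rw [smul_mul_assoc, smul_mul_assoc] at H
    obtain ⟨κ, hκ⟩ := eq_pow_of_left_factor hv hv0 hu0 hb0 hh H
    exact hhv κ hκ
  have hstar := hlcf ξ hξ
  -- If `ξ c = 0`, then `b` is a multiple of `u`, and `h` is its contraction times `u` up to a
  -- scalar, hence a multiple of a power of `u`.
  have hA : ξ c ≠ 0 := by
    intro hA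
    rw [hA, zero_smul, zero_add] at hstar
    have hne : lcf ξ h * u ≠ 0 := mul_ne_zero hξh hu0
    have hB : ξ d ≠ 0 := fun hB => by
      rw [hB, zero_smul] at hstar
      exact mul_ne_zero hne hb0 hstar
    obtain ⟨β, rfl⟩ := mem_span_singleton_of_forall (v := u) (b := b) fun φ hφ => by
      have := congrArg (rcf φ) hstar
      rw [rcf_mul φ hb, map_smul, rcf_mul φ hu, hφ, zero_smul, smul_zero] at this
      exact (smul_eq_zero.1 this).resolve_right hne
    obtain ⟨κ, hκ⟩ := eq_pow_of_eq_lcf_mul (u := u) (κ := (ξ d)⁻¹ * β) ξ hh (by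
      refine mul_right_cancel₀ hu0 ?_
      rw [mul_smul, smul_mul_assoc, smul_mul_assoc, ← mul_smul_comm β, hstar, smul_smul,
        inv_mul_cancel₀ hB, one_smul])
    exact hhu κ hκ
  have hbu : b ∉ Submodule.span k {u} := fun hbu => by
    obtain ⟨β, rfl⟩ := Submodule.mem_span_singleton.1 hbu
    obtain ⟨κ, hκ⟩ := eq_pow_of_mul_eq_lcf (B := ξ d) (β := β) hA ξ hu hu0 hv0 hh (by
      rw [← mul_smul_comm β, hstar, add_sub_cancel_right])
    exact hhu κ hκ
  obtain ⟨ζ, hζu, hζb⟩ := exists_functional_of_notMem_span hbu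
  obtain ⟨φ, hφ⟩ := exists_functional_eq_one (k := k) hv0
  obtain ⟨-, -, -, -, hB⟩ := exists_factor_of_lcf_mul_eq hξ hζu hζb hφ hv hu hb hu0 hh
    (Or.inl hξh) hstar
  rw [hB, zero_smul, add_zero] at hstar
  obtain ⟨⟨κ, hκ⟩, κ', hκ'⟩ := eq_altPair_of_lcf_mul_eq hA hξ hζu hζb hφ hv hu hb hu0 hh hstar
  have hκ0 : κ ≠ 0 := fun h0 => hh0 (by rw [hκ, h0, zero_smul])
  have hκ0' : κ' ≠ 0 := fun h0 => hli.ne_zero 0 (by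
    change v * h = 0
    rw [hκ', h0, zero_smul])
  refine ⟨altLadder hu hb (linearIndependent_pair_of_notMem hu0 hbu), fun j => ?_⟩
  rw [altLadder_e]
  fin_cases j
  · refine (Submodule.smul_mem_iff _ hκ0).1 ?_
    change κ • (altPair u b (n + 2) 1 * u) ∈ _
    rwa [← smul_mul_assoc, ← hκ]
  · refine (Submodule.smul_mem_iff _ hκ0').1 ?_
    change κ' • altPair u b (n + 2 + 1) 1 ∈ _
    rwa [← hκ']

end Alternating

end HomogAlg

end

noncomputable section

namespace HomogAlg

/-! ### Classification by first overlaps -/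

section Classification

variable {k : Type u} [Field k] {m : ℕ}

theorem exists_sum_of_mem_mul_span {r : ℕ} {b : Fin r → Free k m} {N : Submodule k (Free k m)}
    {a : Free k m} (ha : a ∈ N * Submodule.span k (Set.range b)) :
    ∃ t : Fin r → Free k m, (∀ i, t i ∈ N) ∧ a = ∑ i, t i * b i := by
  induction ha using Submodule.mul_induction_on' with
  | mem_mul_mem n hn x hx =>
    obtain ⟨c, rfl⟩ := (Submodule.mem_span_range_iff_exists_fun k).1 hx
    refine ⟨fun i => c i • n, fun i => Submodule.smul_mem _ _ hn, ?_⟩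
    rw [Finset.mul_sum]
    exact Finset.sum_congr rfl fun i _ => by rw [mul_smul_comm, smul_mul_assoc]
  | add x _ y _ hx hy =>
    obtain ⟨t, ht, rfl⟩ := hx
    obtain ⟨t', ht', rfl⟩ := hy
    exact ⟨t + t', fun i => add_mem (ht i) (ht' i), by
      rw [← Finset.sum_add_distrib]
      exact Finset.sum_congr rfl fun i _ => by rw [Pi.add_apply, add_mul]⟩

theorem span_eq_of_forall_mem {E : Type*} [AddCommGroup E] [Module k E] {f e : Fin 2 → E}
    (he : LinearIndependent k e) (h : ∀ j, e j ∈ Submodule.span k (Set.range f)) :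
    Submodule.span k (Set.range e) = Submodule.span k (Set.range f) := by
  have : FiniteDimensional k (Submodule.span k (Set.range f)) :=
    FiniteDimensional.span_of_finite k (Set.finite_range f)
  refine Submodule.eq_of_le_of_finrank_le (Submodule.span_le.2 ?_) ?_
  · rintro _ ⟨j, rfl⟩
    exact h j
  · rw [finrank_span_eq_card he]
    exact finrank_range_le_card f

theorem exists_notMem_span_singleton {E : Type*} [AddCommGroup E] [Module k E] {f : Fin 2 → E}
    (hf : LinearIndependent k f) (x : E) : ∃ j, f j ∉ Submodule.span k {x} := by
  by_contra! h
  have h1 : Submodule.span k (Set.range f) ≤ Submodule.span k (Set.range fun _ : Fin 1 => x) := by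
    rw [Submodule.span_le]
    rintro _ ⟨j, rfl⟩
    rw [Set.range_const]
    exact h j
  have : FiniteDimensional k (Submodule.span k (Set.range fun _ : Fin 1 => x)) :=
    FiniteDimensional.span_of_finite k (Set.finite_range _)
  have h2 := Submodule.finrank_mono h1
  rw [finrank_span_eq_card hf] at h2
  have h3 := finrank_range_le_card (R := k) (fun _ : Fin 1 => x)
  simp only [Fintype.card_fin, Set.finrank] at h2 h3
  omega

theorem span_range_pair (x y : Free k m) :
    Submodule.span k (Set.range ![x, y]) = Submodule.span k {x, y} := by
  rw [Matrix.range_cons, Matrix.range_cons, Matrix.range_empty, Set.union_empty]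
  rfl

/-- The relations all of whose first overlaps have full rank involve only two linear forms. -/
theorem eq_sum_lcf_mul {s : ℕ} {f u v : Fin 2 → Free k m} (hfs : ∀ j, f j ∈ homog k m (s + 1))
    (hv : ∀ j, v j ∈ homog k m 1) {φ : Fin 2 → Free k m →ₗ[k] k}
    (hφ : ∀ i j, φ i (v j) = if i = j then 1 else 0)
    (H : ∑ j, f j * u j = ∑ j, v j * f j) (l : Fin 2) :
    f l = ∑ j, lcf (φ l) (f j) * u j := by
  have := congrArg (lcf (φ l)) H
  rw [map_sum, map_sum, Finset.sum_congr rfl fun j _ => lcf_mul (φ l) (hv j) (f j),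
    Finset.sum_congr rfl fun j _ => lcf_mul_of_mem (φ l) (hfs j) (u j)] at this
  rw [this]
  simp [hφ]

/-- The second overlap differs from the first by a 2 × 2 scalar matrix; subtracting an eigenvalue
multiple of the first lowers the rank. Algebraic closedness enters only here. -/
theorem exists_rank_one [IsAlgClosed k] {s : ℕ} {f u v a c : Fin 2 → Free k m}
    (hf : LinearIndependent k f) (hfs : ∀ j, f j ∈ homog k m (s + 1))
    (hu : ∀ j, u j ∈ homog k m 1) (hv : ∀ j, v j ∈ homog k m 1) (ha : ∀ j, a j ∈ homog k m 1)
    (hvli : LinearIndependent k v) (H : ∑ j, f j * u j = ∑ j, v j * f j)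
    (H' : ∑ j, f j * a j = ∑ j, c j * f j) :
    ∃ l : k, ∃ t : Fin 2 → k, ∃ w ∈ homog k m 1,
      ∑ j, f j * a j - l • ∑ j, f j * u j = (∑ j, t j • f j) * w := by
  obtain ⟨φ, hφ⟩ := exists_dual_family hvli
  have h1 := eq_sum_lcf_mul hfs hv hφ H
  have h2 : ∀ j, a j ∈ Submodule.span k (Set.range u) := by
    intro j
    by_contra hj
    obtain ⟨ψ, hψ, hψj⟩ := exists_functional_of_notMem hj
    have h3 : ∀ i, rcf ψ (f i) = 0 := fun i => by
      rw [h1 i, map_sum]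
      exact Finset.sum_eq_zero fun j _ => by
        rw [rcf_mul ψ (hu j), hψ _ (Submodule.subset_span ⟨j, rfl⟩), zero_smul]
    have h4 := congrArg (rcf ψ) H'
    rw [map_sum, map_sum, Finset.sum_congr rfl fun j _ => rcf_mul ψ (ha j) (f j),
      Finset.sum_congr rfl fun j _ => rcf_mul_of_mem ψ (hfs j) (c j)] at h4
    simp only [h3, mul_zero, Finset.sum_const_zero] at h4
    have := Fintype.linearIndependent_iff.1 hf _ h4 j
    rw [hψj] at this
    exact one_ne_zero this
  choose P hP using fun j => (Submodule.mem_span_range_iff_exists_fun k).1 (h2 j)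
  obtain ⟨l, hl⟩ := Module.End.exists_eigenvalue (Matrix.toLin' (Matrix.of fun i j => P j i))
  obtain ⟨y, hy⟩ := hl.exists_hasEigenvector
  have hy1 := hy.apply_eq_smul
  -- The eigenvector of the transposed matrix is a linear dependence.
  have hli : ¬ LinearIndependent k fun j => a j - l • u j := by
    intro hli
    refine hy.2 (funext fun j => Fintype.linearIndependent_iff.1 hli y ?_ j)
    have h5 : ∑ j, y j • a j = ∑ i, (∑ j, y j * P j i) • u i := by
      simp only [← hP, Finset.smul_sum, Finset.sum_smul, smul_smul]
      exact Finset.sum_comm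
    have h6 : ∀ i, ∑ j, y j * P j i = l * y i := fun i => by
      have := congrFun hy1 i
      rw [Matrix.toLin'_apply] at this
      simp only [Matrix.mulVec, dotProduct, Matrix.of_apply, Pi.smul_apply, smul_eq_mul] at this
      rw [← this]
      exact Finset.sum_congr rfl fun j _ => mul_comm _ _
    simp only [smul_sub, Finset.sum_sub_distrib]
    rw [h5, sub_eq_zero]
    exact Finset.sum_congr rfl fun i _ => by rw [h6, smul_smul, mul_comm]
  obtain ⟨w, hw, t, ht⟩ := exists_common_of_not_linearIndependent (N := homog k m 1)
    (fun j => sub_mem (ha j) (Submodule.smul_mem _ l (hu j))) hli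
  refine ⟨l, t, w, hw, ?_⟩
  rw [Finset.smul_sum, ← Finset.sum_sub_distrib, Finset.sum_mul]
  refine Finset.sum_congr rfl fun j _ => ?_
  rw [← mul_smul_comm, ← mul_sub, ht j, mul_smul_comm, smul_mul_assoc]

/-- The possible shapes of a pair of relations, in terms of their first overlaps `R V ∩ V R`. -/
theorem classification [IsAlgClosed k] {n : ℕ} {f : Fin 2 → Free k m} (hf : LinearIndependent k f)
    (hfs : ∀ j, f j ∈ homog k m (n + 3)) {R : Submodule k (Free k m)}
    (hR : Submodule.span k (Set.range f) = R) :
    W (n + 3) R (n + 4) = ⊥ ∨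
    (∃ v h u, v ∈ homog k m 1 ∧ h ∈ homog k m (n + 2) ∧ u ∈ homog k m 1 ∧
      LinearIndependent k ![v * h, h * u] ∧ Submodule.span k (Set.range ![v * h, h * u]) = R ∧
      W (n + 3) R (n + 4) = Submodule.span k {v * h * u}) ∨
    (∃ u v : Fin 2 → Free k m, (∀ j, u j ∈ homog k m 1) ∧ (∀ j, v j ∈ homog k m 1) ∧
      LinearIndependent k u ∧ LinearIndependent k v ∧ ∑ j, f j * u j = ∑ j, v j * f j ∧
      W (n + 3) R (n + 4) = Submodule.span k {∑ j, f j * u j}) ∨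
    (∃ v g, v ∈ homog k m 1 ∧ v ≠ 0 ∧ LinearIndependent k ![v ^ (n + 3), g] ∧
      Submodule.span k (Set.range ![v ^ (n + 3), g]) = R ∧
      W (n + 3) R (n + 4) = Submodule.span k {v ^ (n + 4)}) ∨
    ∃ L : Ladder k m 2, Submodule.span k (Set.range (L.e (n + 2))) = R := by
  subst hR
  set R := Submodule.span k (Set.range f) with hR
  have hRh : R ≤ homog k m (n + 3) := by
    rw [hR, Submodule.span_le]
    rintro _ ⟨j, rfl⟩
    exact hfs j
  have hW : W (n + 3) R (n + 4) = R * homog k m 1 ⊓ homog k m 1 * R := by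
    rw [show n + 4 = n + 3 + 1 from rfl, W_succ le_rfl, W_self]
  rw [hW]
  have hle : ∀ {E}, E ∈ R * homog k m 1 ⊓ homog k m 1 * R →
      ¬ R * homog k m 1 ⊓ homog k m 1 * R = Submodule.span k {E} →
      ∃ E' ∈ R * homog k m 1 ⊓ homog k m 1 * R, E' ∉ Submodule.span k {E} := by
    intro E hE h
    by_contra! hcon
    exact h (le_antisymm hcon (by rwa [Submodule.span_singleton_le_iff_mem]))
  -- First distinction: whether R contains a pure power.
  by_cases hA : ∃ v ∈ homog k m 1, v ≠ 0 ∧ v ^ (n + 3) ∈ R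
  · obtain ⟨v, hv, hv0, hvR⟩ := hA
    obtain ⟨j, hj⟩ := exists_notMem_span_singleton hf (v ^ (n + 3))
    have hli : LinearIndependent k ![v ^ (n + 3), f j] :=
      linearIndependent_pair_of_notMem (pow_ne_zero _ hv0) hj
    have hspan : Submodule.span k (Set.range ![v ^ (n + 3), f j]) = R :=
      span_eq_of_forall_mem hli (by
        rw [Fin.forall_fin_two]
        exact ⟨hvR, Submodule.subset_span ⟨j, rfl⟩⟩)
    by_cases hD : R * homog k m 1 ⊓ homog k m 1 * R = Submodule.span k {v ^ (n + 4)}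
    · exact Or.inr (Or.inr (Or.inr (Or.inl ⟨v, f j, hv, hv0, hli, hspan, hD⟩)))
    · obtain ⟨E, ⟨hE1, hE2⟩, hE⟩ := hle ⟨by
        rw [pow_succ]; exact Submodule.mul_mem_mul hvR hv, by
        rw [pow_succ']; exact Submodule.mul_mem_mul hv hvR⟩ hD
      rw [← hspan] at hE1 hE2
      obtain ⟨a, ha, hEa⟩ := exists_sum_of_mem_span_mul hE1
      obtain ⟨c, hc, hEc⟩ := exists_sum_of_mem_mul_span hE2
      rw [Fin.sum_univ_two] at hEa hEc
      obtain ⟨L, hL⟩ := exists_ladder_of_pow (n := n + 2) (by omega) hv (ha 0) (ha 1) (hc 0) (hc 1)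
        (hfs j) hli (hEa.symm.trans hEc) (by
          intro h
          exact hE (hEa ▸ h))
      refine Or.inr (Or.inr (Or.inr (Or.inr ⟨L, ?_⟩)))
      rw [← hspan]
      refine span_eq_of_forall_mem (L.e_li _) fun j => ?_
      rw [span_range_pair]
      exact hL j
  push Not at hA
  -- Second distinction, without pure powers: whether some overlap has rank one. It then has rank
  -- one on both sides, which writes it as `v * h * u`.
  by_cases hB : ∃ E ∈ R * homog k m 1 ⊓ homog k m 1 * R, E ≠ 0 ∧
      ∃ t : Fin 2 → k, ∃ u ∈ homog k m 1, E = (∑ j, t j • f j) * u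
  · obtain ⟨E, hE, hE0, t, u, hu, hEt⟩ := hB
    obtain ⟨c, hc, hEc⟩ := exists_sum_of_mem_mul_span hE.2
    have hcli : ¬ LinearIndependent k c := fun hcli =>
      not_sum_mul_of_linearIndependent hf hfs hcli hc t (hEt.symm.trans hEc)
    obtain ⟨v, hv, l, hl⟩ := exists_common_of_not_linearIndependent hc hcli
    set F := ∑ j, t j • f j with hF
    have hFR : F ∈ R := Submodule.sum_mem _ fun j _ =>
      Submodule.smul_mem _ _ (Submodule.subset_span ⟨j, rfl⟩)
    have hgR : ∑ j, l j • f j ∈ R := Submodule.sum_mem _ fun j _ =>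
      Submodule.smul_mem _ _ (Submodule.subset_span ⟨j, rfl⟩)
    have h1 : F * u = v * ∑ j, l j • f j := by
      rw [← hEt, hEc, Finset.mul_sum]
      exact Finset.sum_congr rfl fun j _ => by rw [hl, smul_mul_assoc, mul_smul_comm]
    have hv0 : v ≠ 0 := by
      rintro rfl
      exact hE0 (by rw [hEt, h1, zero_mul])
    have hu0 : u ≠ 0 := by
      rintro rfl
      exact hE0 (by rw [hEt, mul_zero])
    obtain ⟨φ, hφ⟩ := exists_functional_eq_one (k := k) hv0
    have h2 : lcf φ F * u = ∑ j, l j • f j := by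
      have := congrArg (lcf φ) h1
      rwa [lcf_mul_of_mem φ (hRh hFR), lcf_mul φ hv, hφ, one_smul] at this
    have h3 : F = v * lcf φ F := mul_right_cancel₀ hu0 (by rw [h1, mul_assoc, h2])
    have hh : lcf φ F ∈ homog k m (n + 2) := lcon_mem _ (hRh hFR)
    set h := lcf φ F
    have hE' : E = v * h * u := by rw [hEt, ← h3]
    have hvhR : v * h ∈ R := h3 ▸ hFR
    have hhuR : h * u ∈ R := h2 ▸ hgR
    have hvh0 : v * h ≠ 0 := fun h0 => hE0 (by rw [hE', h0, zero_mul])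
    have hh0 : h ≠ 0 := right_ne_zero_of_mul hvh0
    have hli : LinearIndependent k ![v * h, h * u] := by
      rw [LinearIndependent.pair_iff' hvh0]
      intro a ha
      have ha0 : a ≠ 0 := by
        rintro rfl
        rw [zero_smul] at ha
        exact mul_ne_zero hh0 hu0 ha.symm
      -- Dependence of `v * h` and `h * u` would make `h` a multiple of a power of `v`, so R would
      -- contain a pure power.
      obtain ⟨-, κ, hκ⟩ := eq_pow_of_mul_eq_mul (u := a⁻¹ • u) hv hv0 hh hh0 (by
        rw [mul_smul_comm, ← ha, smul_smul, inv_mul_cancel₀ ha0, one_smul])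
      have hκ0 : κ ≠ 0 := fun h0 => hh0 (by rw [hκ, h0, zero_smul])
      refine hA v hv hv0 ((Submodule.smul_mem_iff _ hκ0).1 ?_)
      rwa [pow_succ', ← mul_smul_comm, ← hκ]
    have hspan : Submodule.span k (Set.range ![v * h, h * u]) = R :=
      span_eq_of_forall_mem hli (by
        rw [Fin.forall_fin_two]
        exact ⟨hvhR, hhuR⟩)
    by_cases hD : R * homog k m 1 ⊓ homog k m 1 * R = Submodule.span k {v * h * u}
    · exact Or.inr (Or.inl ⟨v, h, u, hv, hh, hu, hli, hspan, hD⟩)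
    · obtain ⟨E', ⟨hE1, hE2⟩, hE'2⟩ := hle (hE' ▸ hE) hD
      rw [← hspan] at hE1 hE2
      obtain ⟨a, ha, hEa⟩ := exists_sum_of_mem_span_mul hE1
      obtain ⟨c, hc, hEc⟩ := exists_sum_of_mem_mul_span hE2
      rw [Fin.sum_univ_two] at hEa hEc
      obtain ⟨L, hL⟩ := exists_ladder_of_mul hv hu (ha 1) (hc 0) (hc 1) hh hli (fun w hw hw0 => by
        rw [← span_range_pair, hspan]
        exact hA w hw hw0) (hEa.symm.trans hEc) (by
          intro h
          exact hE'2 (hEa ▸ h))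
      refine Or.inr (Or.inr (Or.inr (Or.inr ⟨L, ?_⟩)))
      rw [← hspan]
      refine span_eq_of_forall_mem (L.e_li _) fun j => ?_
      rw [span_range_pair]
      exact hL j
  · by_cases hD : R * homog k m 1 ⊓ homog k m 1 * R = ⊥
    · exact Or.inl hD
    obtain ⟨E, hE, hE0⟩ := Submodule.exists_mem_ne_zero_of_ne_bot hD
    obtain ⟨u, hu, hEu⟩ := exists_sum_of_mem_span_mul hE.1
    obtain ⟨v, hv, hEv⟩ := exists_sum_of_mem_mul_span hE.2
    have huli : LinearIndependent k u := by
      by_contra h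
      obtain ⟨w, hw, l, hl⟩ := exists_common_of_not_linearIndependent hu h
      refine hB ⟨E, hE, hE0, l, w, hw, ?_⟩
      rw [hEu, Finset.sum_mul]
      exact Finset.sum_congr rfl fun j _ => by rw [hl, smul_mul_assoc, mul_smul_comm]
    have hvli : LinearIndependent k v := by
      by_contra h
      obtain ⟨w, hw, l, hl⟩ := exists_common_of_not_linearIndependent hv h
      refine not_mul_sum_of_linearIndependent hf hfs huli hu (u := w) l ?_
      rw [← hEu, hEv, Finset.mul_sum]
      exact Finset.sum_congr rfl fun j _ => by rw [hl, smul_mul_assoc, mul_smul_comm]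
    by_cases hD2 : R * homog k m 1 ⊓ homog k m 1 * R = Submodule.span k {E}
    · exact Or.inr (Or.inr (Or.inl ⟨u, v, hu, hv, huli, hvli, hEu.symm.trans hEv, hEu ▸ hD2⟩))
    · obtain ⟨E', hE', hEE'⟩ := hle hE hD2
      obtain ⟨a, ha, hEa⟩ := exists_sum_of_mem_span_mul hE'.1
      obtain ⟨c, hc, hEc⟩ := exists_sum_of_mem_mul_span hE'.2
      -- Two independent overlaps of full rank combine to a nonzero one of rank one, which is
      -- excluded here.
      obtain ⟨l, t, w, hw, h⟩ := exists_rank_one hf hfs hu hv ha hvli (hEu.symm.trans hEv)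
        (hEa.symm.trans hEc)
      rw [← hEu, ← hEa] at h
      refine (hB ⟨E' - l • E, sub_mem hE' (Submodule.smul_mem _ _ hE), fun h0 => ?_, t, w, hw,
        h⟩).elim
      exact hEE' (Submodule.mem_span_singleton.2 ⟨l, (sub_eq_zero.1 h0).symm⟩)

end Classification

end HomogAlg

end

noncomputable section

namespace HomogAlg

/-! ### Propagation of exactness: short complexes and ladders -/

section Determined

variable {k : Type u} [Field k] {m s : ℕ} {R : Submodule k (Free k m)}

theorem W_eq_bot_of_le {p q : ℕ} (hp : s ≤ p) (hpq : p ≤ q) (h : W s R p = ⊥) : W s R q = ⊥ := by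
  induction q, hpq using Nat.le_induction with
  | base => exact h
  | succ q hq ih => rw [W_succ (hp.trans hq), ih, Submodule.bot_mul, bot_inf_eq]

theorem succ_le_chi (hs : 2 ≤ s) (n : ℕ) : s + 1 ≤ chi s (n + 3) := by
  rw [chi_add_two]
  have := le_chi hs (n + 1)
  omega

theorem add_two_le_chi (hs : 2 ≤ s) (n : ℕ) : s + 2 ≤ chi s (n + 4) := by
  rw [chi_add_two]
  have := le_chi hs (n + 2)
  omega

section NoOverlap

/-- The data of the Koszul complex of length two. -/
def emptyData (hs : 2 ≤ s) {f : Fin 2 → Free k m} (hf : LinearIndependent k f)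
    (hfR : Submodule.span k (Set.range f) = R) (hW : W s R (s + 1) = ⊥) : KData s R where
  f := f
  f_li := hf
  f_span := hfR
  ρ := fun _ => 0
  e := fun _ => Fin.elim0
  e_li := fun _ => linearIndependent_empty_type
  e_span := fun n => by
    rw [W_eq_bot_of_le (Nat.le_succ s) (succ_le_chi hs n) hW, Set.range_eq_empty,
      Submodule.span_empty]

theorem emptyData_determined (hs : 2 ≤ s) (hR : R ≤ homog k m s) {f : Fin 2 → Free k m}
    (hf : LinearIndependent k f) (hfR : Submodule.span k (Set.range f) = R)
    (hW : W s R (s + 1) = ⊥) : (emptyData hs hf hfR hW).Determined hs hR := by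
  intro n _ i hi x _ _
  obtain ⟨i, rfl⟩ : ∃ j, i = j + 2 := ⟨i - 2, by omega⟩
  refine ⟨0, zero_mem _, ?_⟩
  rw [map_zero]
  exact funext fun a : Fin 0 => a.elim0

end NoOverlap

section OneOverlap

/-- The ranks of the terms beyond the second of a Koszul complex of length three. -/
def oneRank : ℕ → ℕ
  | 0 => 1
  | _ + 1 => 0

/-- The data of a Koszul complex of length three with last term of rank one. -/
def oneData (hs : 2 ≤ s) {f : Fin 2 → Free k m} (hf : LinearIndependent k f)
    (hfR : Submodule.span k (Set.range f) = R) {E : Free k m} (hE : E ≠ 0)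
    (hW : W s R (s + 1) = Submodule.span k {E}) (hW' : W s R (s + 2) = ⊥) : KData s R where
  f := f
  f_li := hf
  f_span := hfR
  ρ := oneRank
  e := fun n => match n with
    | 0 => fun _ => E
    | _ + 1 => Fin.elim0
  e_li := fun n => match n with
    | 0 => LinearIndependent.of_subsingleton (ι := Fin 1) (v := fun _ => E) 0 hE
    | n + 1 => linearIndependent_empty_type (ι := Fin 0)
  e_span := fun n => match n with
    | 0 => by
      rw [chi_three, hW]
      change Submodule.span k (Set.range fun _ : Fin 1 => E) = _
      rw [Set.range_const]
    | n + 1 => by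
      rw [W_eq_bot_of_le (by omega) (add_two_le_chi hs n) hW']
      change Submodule.span k (Set.range (Fin.elim0 : Fin 0 → Free k m)) = _
      rw [Set.range_eq_empty, Submodule.span_empty]

variable (hs : 2 ≤ s) (hR : R ≤ homog k m s) {f : Fin 2 → Free k m} (hf : LinearIndependent k f)
  (hfR : Submodule.span k (Set.range f) = R) {E : Free k m} (hE : E ≠ 0)
  (hW : W s R (s + 1) = Submodule.span k {E}) (hW' : W s R (s + 2) = ⊥)

theorem oneData_d_two {t : Fin 2 → Free k m} (hEt : E = ∑ j, f j * t j)
    (x : Fin 1 → QuotAlg R) (j : Fin 2) :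
    (oneData hs hf hfR hE hW hW').d hs hR 2 x j = proj R (t j) * x 0 := by
  have h1 := (oneData hs hf hfR hE hW hW').μ_unique hs hR (i := 2) (c := (0 : Fin 1)) (t := t) hEt j
  refine ((oneData hs hf hfR hE hW hW').d_apply hs hR 2 x j).trans ?_
  refine (Fin.sum_univ_one (fun c : Fin 1 => proj R ((oneData hs hf hfR hE hW hW').μ hs hR 2 j c) *
    x c)).trans ?_
  exact congrArg (fun z => proj R z * x 0) h1

theorem oneData_exactAt_one_iff {t : Fin 2 → Free k m} (hEt : E = ∑ j, f j * t j)
    (n : ℤ) : (oneData hs hf hfR hE hW hW').ExactAt hs hR 1 n ↔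
    ∀ c : Fin 2 → QuotAlg R, (∀ j, c j ∈ cz R (n - s)) →
      (∀ i, ∑ j, proj R (lc i (f j)) * c j = 0) →
      ∃ a ∈ cz R (n - s - 1), ∀ j, c j = proj R (t j) * a := by
  constructor
  · intro h c hc hc0
    obtain ⟨y, hy, hyc⟩ := h c (KData.mem_gr _ |>.2 fun a => by
      rw [chi_two]; exact hc a) (by
      ext (i : Fin m)
      exact (KData.d_one_apply _ hs hR c i).trans (hc0 i))
    refine ⟨y (0 : Fin 1), ?_, fun j => ?_⟩
    · have := KData.mem_gr _ |>.1 hy (0 : Fin 1)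
      rw [chi_three] at this
      convert this using 2
      push_cast; ring
    · exact (congrFun hyc j).symm.trans (oneData_d_two hs hR hf hfR hE hW hW' hEt y j)
  · intro h x hx hx0
    obtain ⟨a, ha, hax⟩ := h x (fun j => by
      have := KData.mem_gr _ |>.1 hx j
      rwa [chi_two] at this) (fun i =>
        (KData.d_one_apply _ hs hR x i).symm.trans (congrFun hx0 i))
    refine ⟨fun _ : Fin 1 => a, KData.mem_gr _ |>.2 fun _ => ?_, ?_⟩
    · rw [chi_three]
      convert ha using 2
      push_cast; ring
    · ext (j : Fin 2)
      exact (oneData_d_two hs hR hf hfR hE hW hW' hEt _ j).trans (hax j).symm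

theorem oneData_exactAt_two_iff {t : Fin 2 → Free k m} (hEt : E = ∑ j, f j * t j)
    (n : ℤ) : (oneData hs hf hfR hE hW hW').ExactAt hs hR 2 n ↔
    ∀ a ∈ cz R (n - s - 1), (∀ j, proj R (t j) * a = 0) → a = 0 := by
  constructor
  · intro h a ha ha0
    obtain ⟨y, -, hy⟩ := h (fun _ : Fin 1 => a) (KData.mem_gr _ |>.2 fun _ => by
      rw [chi_three]
      convert ha using 2
      push_cast; ring) (by
      ext (j : Fin 2)
      exact (oneData_d_two hs hR hf hfR hE hW hW' hEt _ j).trans (ha0 j))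
    have h0 : y = 0 := funext fun z : Fin 0 => z.elim0
    rw [h0, map_zero] at hy
    exact (congrFun hy (0 : Fin 1)).symm
  · intro h x hx hx0
    refine ⟨0, zero_mem _, ?_⟩
    rw [map_zero]
    ext (z : Fin 1)
    rw [Subsingleton.elim z 0]
    refine (h _ ?_ fun j => ?_).symm
    · have := KData.mem_gr _ |>.1 hx (0 : Fin 1)
      rw [chi_three] at this
      convert this using 2
      push_cast; ring
    · exact (oneData_d_two hs hR hf hfR hE hW hW' hEt x j).symm.trans (congrFun hx0 j)

theorem oneData_exactAt_add_three (i : ℕ) (n : ℤ) :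
    (oneData hs hf hfR hE hW hW').ExactAt hs hR (i + 3) n := by
  intro x _ _
  refine ⟨0, zero_mem _, ?_⟩
  rw [map_zero]
  exact funext fun a : Fin 0 => a.elim0

/-- Induction on the degree allows injectivity of K_3 → K_2 to be assumed in lower degrees as well;
beyond K_3 the complex is zero. -/
theorem oneData_determined (h : ∀ n, (∀ n' < n, (oneData hs hf hfR hE hW hW').ExactAt hs hR 1 n') →
    (∀ n' < n, (oneData hs hf hfR hE hW hW').ExactAt hs hR 2 n') →
    (oneData hs hf hfR hE hW hW').ExactAt hs hR 2 n) :
    (oneData hs hf hfR hE hW hW').Determined hs hR := by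
  have key : ∀ N : ℕ, ∀ n : ℤ, n ≤ N → (∀ n' < n, (oneData hs hf hfR hE hW hW').ExactAt hs hR 1 n') →
      (oneData hs hf hfR hE hW hW').ExactAt hs hR 2 n := by
    intro N
    induction N with
    | zero =>
      intro n hn _ x hx _
      rw [KData.gr_eq_bot _ (by rw [chi_three]; push_cast at hn ⊢; omega), Submodule.mem_bot] at hx
      exact ⟨0, zero_mem _, by rw [map_zero, hx]⟩
    | succ N ih =>
      intro n hn h1
      exact h n h1 fun n' hn' => ih n' (by push_cast at hn; omega) fun n'' hn'' =>
        h1 n'' (by omega)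
  intro n hn i hi
  match i, hi with
  | 2, _ => exact key n.toNat n (Int.self_le_toNat n) hn
  | i + 3, _ => exact oneData_exactAt_add_three hs hR hf hfR hE hW hW' i n

end OneOverlap

/-- Stripping `v` from an element `v * h * u * t` of the next overlap leaves `h * u * t`, which must
be a multiple of `v * h * u`; right independence of `v * h` and `h * u` forces `t = 0`. -/
theorem W_add_two_eq_bot_of_mul (hs : 2 ≤ s) {v h u : Free k m} (hv : v ∈ homog k m 1)
    (hh : h ∈ homog k m (s - 1)) (hu : u ∈ homog k m 1) (hli : LinearIndependent k ![v * h, h * u])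
    (hW : W s R (s + 1) = Submodule.span k {v * h * u}) : W s R (s + 2) = ⊥ := by
  have hv0 : v ≠ 0 := left_ne_zero_of_mul (hli.ne_zero 0)
  have hh0 : h ≠ 0 := right_ne_zero_of_mul (hli.ne_zero 0)
  have hu0 : u ≠ 0 := right_ne_zero_of_mul (hli.ne_zero 1)
  rw [show s + 2 = s + 1 + 1 from rfl, W_succ (by omega), hW, eq_bot_iff]
  rintro w ⟨hw1, hw2⟩
  obtain ⟨t, -, rfl⟩ := Submodule.mem_span_singleton_mul.1 hw1
  obtain ⟨φ, hφ⟩ := exists_functional_eq_one (k := k) hv0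
  have h1 := lcon_mem_of_mem_mul (fun i => φ (FreeAlgebra.ι k i)) hw2
  obtain ⟨c, hc⟩ := Submodule.mem_span_singleton.1 h1
  rw [mul_assoc, mul_assoc, lcf_mul φ hv, hφ, one_smul] at hc
  have h2 : ∑ j, ![v * h, h * u] j * ![c • u, -t] j = 0 := by
    rw [Fin.sum_univ_two]
    simp only [Matrix.cons_val_zero, Matrix.cons_val_one]
    rw [mul_smul_comm, mul_assoc v, hc, mul_neg, mul_assoc, add_neg_cancel]
  have h3 := eq_zero_of_sum_mul_eq_zero (p := s) hli (by
    rw [Fin.forall_fin_two]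
    have h4 := homog_mul hv hh
    have h5 := homog_mul hh hu
    rw [show 1 + (s - 1) = s by omega] at h4
    rw [show s - 1 + 1 = s by omega] at h5
    exact ⟨h4, h5⟩) h2 1
  have ht : t = 0 := by simpa using h3
  rw [ht, mul_zero]
  exact zero_mem _

/-- Here K_3 → K_2 is `a ↦ (u a, 0)`. If `u a = 0`, then `(0, a)` is a cycle of K_2 one degree
lower, because the second relation ends in `u`; it is a boundary, so its second coordinate is zero.
-/
theorem mulData_determined (hs : 3 ≤ s) (hR : R ≤ homog k m s) {v h u : Free k m}
    (hv : v ∈ homog k m 1) (hh : h ∈ homog k m (s - 1)) (hu : u ∈ homog k m 1)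
    (hli : LinearIndependent k ![v * h, h * u])
    (hfR : Submodule.span k (Set.range ![v * h, h * u]) = R)
    (hW : W s R (s + 1) = Submodule.span k {v * h * u}) :
    ∃ K : KData s R, K.Determined (by omega) hR := by
  have hu0 : u ≠ 0 := right_ne_zero_of_mul (hli.ne_zero 1)
  have hE : v * h * u ≠ 0 := mul_ne_zero (hli.ne_zero 0) hu0
  have hEt : v * h * u = ∑ j, ![v * h, h * u] j * ![u, 0] j := by simp
  have hW' := W_add_two_eq_bot_of_mul (by omega) hv hh hu hli hW
  refine ⟨oneData (by omega) hli hfR hE hW hW', oneData_determined _ _ _ _ _ _ _ ?_⟩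
  intro n h1 _
  rw [oneData_exactAt_two_iff _ _ _ _ _ _ _ hEt]
  intro a ha ha0
  have hua : proj R u * a = 0 := ha0 0
  obtain ⟨b, -, hb⟩ := (oneData_exactAt_one_iff _ hR _ _ _ _ _ hEt _).1 (h1 (n - 1) (by omega))
    ![0, a] (by
      rw [Fin.forall_fin_two]
      refine ⟨zero_mem _, ?_⟩
      rw [sub_right_comm]
      exact ha) (fun i => by
      rw [Fin.sum_univ_two]
      simp only [Matrix.cons_val_zero, Matrix.cons_val_one]
      rw [mul_zero, zero_add, lcon_mul,
        aug_eq_zero_of_mem (by omega) hh, zero_smul, add_zero, map_mul, mul_assoc, hua, mul_zero])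
  have := hb 1
  simpa using this

section LadderData

variable {r : ℕ} (L : Ladder k m r)

/-- The data of the Koszul complex of an algebra with overlaps forming a ladder. -/
def ladderData (hs : 2 ≤ s) {f : Fin 2 → Free k m} (hf : LinearIndependent k f)
    (hfR : Submodule.span k (Set.range f) = R)
    (hW : W s R (s + 1) = Submodule.span k (Set.range (L.e s))) : KData s R where
  f := f
  f_li := hf
  f_span := hfR
  ρ := fun _ => r
  -- `L.e n` consists of elements of degree `n + 1`.
  e := fun n => L.e (chi s (n + 3) - 1)
  e_li := fun n => L.e_li _
  e_span := fun n => by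
    have key : ∀ l, W s R (s + 1 + l) = Submodule.span k (Set.range (L.e (s + l))) := by
      intro l
      induction l with
      | zero => exact hW
      | succ l ih =>
        have := L.W_succ_eq (s := s) (R := R) (n := s + l - 1) (by omega) (by
          rw [show s + l - 1 + 2 = s + 1 + l by omega, show s + l - 1 + 1 = s + l by omega]
          exact ih)
        rwa [show s + l - 1 + 3 = s + 1 + (l + 1) by omega,
          show s + l - 1 + 2 = s + (l + 1) by omega] at this
    obtain ⟨l, hl⟩ := Nat.exists_eq_add_of_le (succ_le_chi hs n)
    rw [hl, key, show s + 1 + l - 1 = s + l by omega]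

variable (hs : 2 ≤ s) (hR : R ≤ homog k m s) {f : Fin 2 → Free k m} (hf : LinearIndependent k f)
  (hfR : Submodule.span k (Set.range f) = R)
  (hW : W s R (s + 1) = Submodule.span k (Set.range (L.e s)))

theorem ladderData_d_add_three (i : ℕ) (x : Fin r → QuotAlg R) :
    (ladderData L hs hf hfR hW).d hs hR (i + 3) x =
      ((proj R).mapMatrix L.M ^ (chi s (i + 4) - chi s (i + 3))).mulVec x := by
  have h1 : ∀ a c : Fin r, (ladderData L hs hf hfR hW).μ hs hR (i + 3) a c =
      (L.M ^ (chi s (i + 4) - chi s (i + 3))) a c := by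
    intro a c
    refine (ladderData L hs hf hfR hW).μ_unique hs hR (i := i + 3) (c := c)
      (t := fun a => (L.M ^ (chi s (i + 4) - chi s (i + 3))) a c) ?_ a
    change L.e (chi s (i + 4) - 1) c =
      ∑ a : Fin r, L.e (chi s (i + 3) - 1) a * (L.M ^ (chi s (i + 4) - chi s (i + 3))) a c
    rw [← L.e_add]
    congr 1
    have := chi_lt_succ hs (i + 3)
    have := succ_le_chi hs i
    rw [show i + 4 = i + 3 + 1 from rfl]
    omega
  rw [← map_pow]
  ext (a : Fin r)
  refine ((ladderData L hs hf hfR hW).d_apply hs hR (i + 3) x a).trans ?_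
  exact Finset.sum_congr (s₁ := (Finset.univ : Finset (Fin r))) rfl fun c _ =>
    congrArg (fun z => proj R z * x c) (h1 a c)

variable {ι : Fin r → Fin 2}

/-- The map `ι` records which relations belong to the ladder: both of them, or only the pure power.
-/
theorem ladderData_d_two (hι : ∀ a, f (ι a) = L.e (s - 1) a) (x : Fin r → QuotAlg R)
    (j : Fin 2) : (ladderData L hs hf hfR hW).d hs hR 2 x j =
      ∑ a, if ι a = j then ((proj R).mapMatrix L.M).mulVec x a else 0 := by
  have h1 : ∀ c : Fin r, (ladderData L hs hf hfR hW).μ hs hR 2 j c =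
      ∑ a, if ι a = j then L.M a c else 0 := by
    intro c
    refine (ladderData L hs hf hfR hW).μ_unique hs hR (i := 2) (c := c)
      (t := fun j : Fin 2 => ∑ a, if ι a = j then L.M a c else 0) ?_ j
    change L.e (chi s 3 - 1) c = ∑ j : Fin 2, f j * ∑ a, if ι a = j then L.M a c else 0
    rw [chi_three, show s + 1 - 1 = s - 1 + 1 by omega, L.e_succ]
    simp only [Finset.mul_sum, mul_ite, mul_zero]
    rw [Finset.sum_comm]
    refine Finset.sum_congr rfl fun a _ => ?_
    rw [Finset.sum_ite_eq, if_pos (Finset.mem_univ _), hι]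
  refine ((ladderData L hs hf hfR hW).d_apply hs hR 2 x j).trans ?_
  refine (Finset.sum_congr (s₁ := (Finset.univ : Finset (Fin r))) rfl fun c _ =>
    congrArg (fun z => proj R z * x c) (h1 c)).trans ?_
  simp only [map_sum, Finset.sum_mul]
  rw [Finset.sum_comm]
  refine Finset.sum_congr rfl fun a _ => ?_
  split_ifs with h
  · rfl
  · simp

theorem ladderData_d_two_apply (hι : ∀ a, f (ι a) = L.e (s - 1) a)
    (hinj : Function.Injective ι) {x : Fin r → QuotAlg R} (a : Fin r) :
    (ladderData L hs hf hfR hW).d hs hR 2 x (ι a) = ((proj R).mapMatrix L.M).mulVec x a := by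
  rw [ladderData_d_two L hs hR hf hfR hW hι]
  simp only [hinj.eq_iff, Finset.sum_ite_eq', Finset.mem_univ, if_true]

/-- With N the image of `L.M`, the kernel of N^(s-1) is the image of N. The ladder relations are `e
0` times M^(s-1), so such a `c`, completed by zero, is a cycle of K_2, and K_3 → K_2 is N on the
ladder coordinates. -/
theorem exists_mulVec_of_exactAt (hι : ∀ a, f (ι a) = L.e (s - 1) a)
    (hinj : Function.Injective ι) {j : ℤ}
    (hex : (ladderData L hs hf hfR hW).ExactAt hs hR 1 (s + j)) {c : Fin r → QuotAlg R}
    (hc : ∀ a, c a ∈ cz R j) (h0 : ((proj R).mapMatrix L.M ^ (s - 1)).mulVec c = 0) :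
    ∃ y : Fin r → QuotAlg R, (∀ a, y a ∈ cz R (j - 1)) ∧ ((proj R).mapMatrix L.M).mulVec y = c := by
  let x : Fin 2 → QuotAlg R := fun j => ∑ a, if ι a = j then c a else 0
  have hx : ∀ a, x (ι a) = c a := fun a => by
    simp only [x, hinj.eq_iff, Finset.sum_ite_eq', Finset.mem_univ, if_true]
  obtain ⟨y, hy, hyx⟩ := hex x (KData.mem_gr _ |>.2 fun j' => by
    rw [chi_two, add_sub_cancel_left]
    refine Submodule.sum_mem _ fun a _ => ?_
    split_ifs
    · exact hc a
    · exact zero_mem _) (by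
    ext (i : Fin m)
    refine (KData.d_one_apply _ hs hR x i).trans ?_
    change ∑ j : Fin 2, proj R (lc i (f j)) * (∑ a, if ι a = j then c a else 0) = 0
    have h1 : ∀ a, lc i (L.e (s - 1) a) = ∑ b, lc i (L.e 0 b) * (L.M ^ (s - 1)) b a := fun a => by
      conv_lhs => rw [show s - 1 = 0 + (s - 1) by omega, L.e_add, map_sum]
      exact Finset.sum_congr rfl fun b _ => by
        rw [lcon_mul, aug_eq_zero_of_mem (Nat.succ_ne_zero 0) (L.e_mem 0 b), zero_smul, add_zero]
    simp only [Finset.mul_sum, mul_ite, mul_zero]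
    rw [Finset.sum_comm]
    have h2 : ∀ b, ∑ a, proj R ((L.M ^ (s - 1)) b a) * c a = 0 := fun b => by
      rw [← map_pow] at h0
      exact congrFun h0 b
    calc ∑ a, ∑ j : Fin 2, (if ι a = j then proj R (lc i (f j)) * c a else 0)
        = ∑ a, ∑ b, proj R (lc i (L.e 0 b)) * (proj R ((L.M ^ (s - 1)) b a) * c a) := by
          refine Finset.sum_congr rfl fun a _ => ?_
          rw [Finset.sum_ite_eq, if_pos (Finset.mem_univ _), hι, h1, map_sum, Finset.sum_mul]
          exact Finset.sum_congr rfl fun b _ => by rw [map_mul, mul_assoc]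
      _ = 0 := by
          rw [Finset.sum_comm]
          refine Finset.sum_eq_zero fun b _ => ?_
          rw [← Finset.mul_sum, h2, mul_zero])
  refine ⟨y, fun a => ?_, ?_⟩
  · have := KData.mem_gr _ |>.1 hy a
    rw [chi_three] at this
    convert this using 2
    push_cast; ring
  · ext (a : Fin r)
    rw [← hx, ← hyx]
    exact (ladderData_d_two_apply L hs hR hf hfR hW hι hinj a).symm

/-- If N c = 0 and c = N^l y with l < s - 1, then N^(s-1) y = 0, so y is again in the image of N.
Iterating gives c = N^(s-1) y. -/
theorem exists_mulVec_pow_of_exactAt (hs3 : 3 ≤ s) (hι : ∀ a, f (ι a) = L.e (s - 1) a)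
    (hinj : Function.Injective ι) {j : ℤ}
    (hex : ∀ j' ≤ j, (ladderData L hs hf hfR hW).ExactAt hs hR 1 (s + j')) {c : Fin r → QuotAlg R}
    (hc : ∀ a, c a ∈ cz R j) (h0 : ((proj R).mapMatrix L.M).mulVec c = 0) :
    ∃ y : Fin r → QuotAlg R, (∀ a, y a ∈ cz R (j - (s - 1 : ℕ))) ∧
      ((proj R).mapMatrix L.M ^ (s - 1)).mulVec y = c := by
  set N := (proj R).mapMatrix L.M
  have key : ∀ l ≤ s - 1, ∃ y : Fin r → QuotAlg R, (∀ a, y a ∈ cz R (j - l)) ∧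
      (N ^ l).mulVec y = c := by
    intro l
    induction l with
    | zero => exact fun _ => ⟨c, by simpa using hc, by simp⟩
    | succ l ih =>
      intro hl
      obtain ⟨y, hy, hyc⟩ := ih (by omega)
      obtain ⟨z, hz, hzy⟩ := exists_mulVec_of_exactAt L hs hR hf hfR hW hι hinj
        (hex (j - l) (by omega)) hy (by
          rw [show s - 1 = (s - 2 - l) + (1 + l) by omega, pow_add, ← Matrix.mulVec_mulVec, pow_add,
            ← Matrix.mulVec_mulVec, hyc, pow_one, h0, Matrix.mulVec_zero])
      refine ⟨z, fun a => ?_, ?_⟩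
      · convert hz a using 2
        push_cast; ring
      · rw [pow_succ, ← Matrix.mulVec_mulVec, hzy, hyc]
  exact key _ le_rfl

theorem chi_succ_sub (hs : 2 ≤ s) (i : ℕ) :
    (chi s (i + 1) = chi s i + 1 ∧ chi s (i + 2) = chi s (i + 1) + (s - 1)) ∨
      (chi s (i + 1) = chi s i + (s - 1) ∧ chi s (i + 2) = chi s (i + 1) + 1) := by
  rw [chi_add_two]
  obtain ⟨j, rfl | rfl⟩ := Nat.even_or_odd' i
  · rw [chi_even, chi_odd]
    omega
  · rw [show 2 * j + 1 + 1 = 2 * (j + 1) by ring, chi_even, chi_odd, mul_add]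
    omega

/-- The maps into and out of each later term are N and N^(s-1) in one order or the other; the two
preceding lemmas are the two kernel–image equalities needed. -/
theorem ladderData_determined (hs3 : 3 ≤ s) (hι : ∀ a, f (ι a) = L.e (s - 1) a)
    (hinj : Function.Injective ι) : (ladderData L hs hf hfR hW).Determined hs hR := by
  intro n hn i hi x hx hx0
  -- Later generators have degree at least `s + 1`, so only exactness at K_2 in degrees strictly
  -- below `n` is used.
  have hj : ∀ j' ≤ n - chi s (i + 1), (ladderData L hs hf hfR hW).ExactAt hs hR 1 (s + j') :=
    fun j' hj' => hn _ (by
      have : s + 1 ≤ chi s (i + 1) := by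
        obtain ⟨i, rfl⟩ : ∃ i', i = i' + 2 := ⟨i - 2, by omega⟩
        exact succ_le_chi hs i
      omega)
  obtain ⟨i, rfl⟩ : ∃ i', i = i' + 2 := ⟨i - 2, by omega⟩
  have hx' : ∀ a : Fin r, x a ∈ cz R (n - chi s (i + 3)) := KData.mem_gr _ |>.1 hx
  have hd : ((proj R).mapMatrix L.M ^ (chi s (i + 3) - chi s (i + 2))).mulVec x =
      (0 : Fin r → QuotAlg R) := by
    cases i with
    | zero =>
      rw [chi_three, chi_two, Nat.add_sub_cancel_left, pow_one]
      ext (a : Fin r)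
      exact (ladderData_d_two_apply L hs hR hf hfR hW hι hinj a).symm.trans
        (congrFun hx0 (ι a))
    | succ i =>
      rw [← ladderData_d_add_three L hs hR hf hfR hW i x]
      exact hx0
  suffices h : ∃ y : Fin r → QuotAlg R, (∀ a, y a ∈ cz R (n - chi s (i + 4))) ∧
      ((proj R).mapMatrix L.M ^ (chi s (i + 4) - chi s (i + 3))).mulVec y = x by
    obtain ⟨y, hy, hyx⟩ := h
    exact ⟨y, KData.mem_gr _ |>.2 hy, (ladderData_d_add_three L hs hR hf hfR hW i y).trans hyx⟩
  rcases chi_succ_sub hs (i + 2) with ⟨h1, h2⟩ | ⟨h1, h2⟩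
  · simp only [add_assoc, Nat.reduceAdd] at h1 h2
    rw [h1, Nat.add_sub_cancel_left, pow_one] at hd
    obtain ⟨y, hy, hyx⟩ := exists_mulVec_pow_of_exactAt L hs hR hf hfR hW hs3 hι hinj hj hx' hd
    refine ⟨y, fun a => ?_, by rw [h2, Nat.add_sub_cancel_left, hyx]⟩
    convert hy a using 2
    rw [h2]; push_cast; ring
  · simp only [add_assoc, Nat.reduceAdd] at h1 h2
    rw [h1, Nat.add_sub_cancel_left] at hd
    obtain ⟨y, hy, hyx⟩ := exists_mulVec_of_exactAt L hs hR hf hfR hW hι hinj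
      (hj _ le_rfl) hx' hd
    refine ⟨y, fun a => ?_, by rw [h2, Nat.add_sub_cancel_left, pow_one, hyx]⟩
    convert hy a using 2
    rw [h2]; push_cast; ring

end LadderData

end Determined

end HomogAlg

end

noncomputable section

namespace HomogAlg

/-! ### Change of generators -/

section Transfer

variable {k : Type u} [Field k] {m m' : ℕ} (g : Free k m' →ₐ[k] Free k m)

theorem map_mem_homog (hg : ∀ i, g (FreeAlgebra.ι k i) ∈ homog k m 1) {n : ℕ} {a : Free k m'}
    (ha : a ∈ homog k m' n) : g a ∈ homog k m n := by
  have key : ∀ w : Fin n → Fin m', g (mono k w) ∈ homog k m n := by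
    clear ha
    induction n with
    | zero =>
      intro w
      rw [mono_zero, map_one]
      exact one_mem_homog
    | succ n ih =>
      intro w
      rw [mono_succ, map_mul]
      have := homog_mul (hg (w 0)) (ih fun i => w i.succ)
      rwa [add_comm 1 n] at this
  have h : homog k m' n ≤ (homog k m n).comap g.toLinearMap := by
    conv_lhs => unfold homog
    rw [Submodule.span_le]
    rintro _ ⟨w, rfl⟩
    exact key w
  exact h ha

variable {R' : Submodule k (Free k m')} {R : Submodule k (Free k m)}

theorem map_mem_W (hg : ∀ i, g (FreeAlgebra.ι k i) ∈ homog k m 1) (hR : ∀ f ∈ R', g f ∈ R)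
    {s n : ℕ} {a : Free k m'} (ha : a ∈ W s R' n) : g a ∈ W s R n := by
  rcases lt_or_ge n s with h | h
  · rw [W_of_lt h] at ha ⊢
    exact map_mem_homog g hg ha
  · induction n, h using Nat.le_induction generalizing a with
    | base =>
      rw [W_self] at ha ⊢
      exact hR a ha
    | succ n hn ih =>
      rw [W_succ hn] at ha ⊢
      have h1 : (W s R' n).map g.toLinearMap ≤ W s R n := Submodule.map_le_iff_le_comap.2 fun a => ih
      have h2 : (homog k m' 1).map g.toLinearMap ≤ homog k m 1 :=
        Submodule.map_le_iff_le_comap.2 fun a => map_mem_homog g hg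
      refine ⟨?_, ?_⟩
      · have := Submodule.mem_map_of_mem (f := g.toLinearMap) ha.1
        rw [Submodule.map_mul] at this
        exact mul_le_mul' h1 h2 this
      · have := Submodule.mem_map_of_mem (f := g.toLinearMap) ha.2
        rw [Submodule.map_mul] at this
        exact mul_le_mul' h2 h1 this

/-- The map of quotient algebras induced by a map of free algebras. -/
def mapQ (hR : ∀ f ∈ R', g f ∈ R) : QuotAlg R' →ₐ[k] QuotAlg R :=
  liftQ ((proj R).comp g) fun f hf => proj_eq_zero_of_mem (hR f hf)

theorem mapQ_mem_cz (hg : ∀ i, g (FreeAlgebra.ι k i) ∈ homog k m 1) (hR : ∀ f ∈ R', g f ∈ R)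
    {j : ℤ} {x : QuotAlg R'} (hx : x ∈ cz R' j) : mapQ g hR x ∈ cz R j := by
  rcases lt_or_ge j 0 with h | h
  · rw [cz_of_neg h, Submodule.mem_bot] at hx
    rw [hx, map_zero]
    exact zero_mem _
  · lift j to ℕ using h
    rw [cz_natCast] at hx
    obtain ⟨a, ha, rfl⟩ := hx
    exact proj_mem_cz (map_mem_homog g hg ha)

end Transfer

/-! ### Socle elements and Hilbert functions -/

section Socle

variable {k : Type u} [Field k] {m s : ℕ}

theorem map_mul_of_forall_ι {R' : Submodule k (Free k 2)} {R : Submodule k (Free k m)}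
    (T : QuotAlg R' →ₐ[k] QuotAlg R) (Φ : QuotAlg R' →ₗ[k] QuotAlg R) {n : ℤ}
    (h : ∀ n' ≥ n, ∀ e ∈ cz R' n', ∀ p, Φ (proj R' (FreeAlgebra.ι k p) * e) =
      T (proj R' (FreeAlgebra.ι k p)) * Φ e) {q : ℕ} {x : Free k 2} (hx : x ∈ homog k 2 q)
    {n' : ℤ} (hn : n' ≥ n) {e : QuotAlg R'} (he : e ∈ cz R' n') :
    Φ (proj R' x * e) = T (proj R' x) * Φ e := by
  induction q generalizing x with
  | zero =>
    obtain ⟨c, rfl⟩ := exists_eq_smul_one hx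
    rw [map_smul, map_smul, map_one, map_one, smul_mul_assoc, smul_mul_assoc, one_mul, one_mul,
      map_smul]
  | succ q ih =>
    rw [eq_sum_lc_of_mem hx, map_sum, map_sum, Finset.sum_mul, Finset.sum_mul, map_sum]
    refine Finset.sum_congr rfl fun p _ => ?_
    have hx' : lc p x ∈ homog k 2 q := lcon_mem _ hx
    rw [map_mul (proj R'), map_mul T, mul_assoc, mul_assoc, ← ih hx',
      h (q + n') (by omega) _ (mul_mem_cz (proj_mem_cz hx') he)]

/-- If a nonzero element of degree `d` is annihilated by the generators, then every linear form on a
component of degree `j` extends, by exactness, to a module map of degree `d - j`. -/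
theorem cz_eq_bot_of_socle {R' : Submodule k (Free k 2)} (hR' : R' ≤ homog k 2 (s + 1))
    {R : Submodule k (Free k m)} (T : QuotAlg R' →ₐ[k] QuotAlg R) {f' : Fin 2 → Free k 2}
    (hf's : ∀ j, f' j ∈ homog k 2 (s + 1))
    (hover : ∀ l, ∑ j, lc l (f' j) * FreeAlgebra.ι k j ∈ R') {d : ℤ}
    (hex : ∀ j ≤ d, ∀ c : Fin 2 → QuotAlg R, (∀ l, c l ∈ cz R j) →
      (∀ l, ∑ j, T (proj R' (lc l (f' j))) * c j = 0) →
      ∃ a ∈ cz R (j - 1), ∀ l, c l = T (proj R' (FreeAlgebra.ι k l)) * a)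
    {a : QuotAlg R} (ha : a ∈ cz R d) (ha0 : a ≠ 0)
    (hsoc : ∀ p, T (proj R' (FreeAlgebra.ι k p)) * a = 0) {j : ℕ} (hj : d < j) :
    cz R' (j : ℤ) = ⊥ := by
  rw [eq_bot_iff]
  intro b hb
  rw [Submodule.mem_bot]
  by_contra hb0
  obtain ⟨ψ, hψ⟩ := exists_functional_eq_one (k := k) hb0
  have key : ∀ i : ℕ, ∃ Φ : QuotAlg R' →ₗ[k] QuotAlg R,
      (∀ n' e, e ∈ cz R' n' → Φ e ∈ cz R (d - j + n')) ∧
      (∀ e ∈ cz R' (j : ℤ), Φ e = ψ e • a) ∧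
      ∀ n' ≥ (j : ℤ) - i, ∀ e ∈ cz R' n', ∀ p, Φ (proj R' (FreeAlgebra.ι k p) * e) =
        T (proj R' (FreeAlgebra.ι k p)) * Φ e := by
    intro i
    induction i with
    | zero =>
      -- Linearity in degrees at least `j` holds because generators annihilate `a` and products of
      -- degree above `j` are sent to zero.
      refine ⟨(ψ.comp (hz hR' j)).smulRight a, fun n' e he => ?_, fun e he => ?_,
        fun n' hn' e he p => ?_⟩
      · rw [LinearMap.smulRight_apply, LinearMap.comp_apply, hz_of_mem hR' he]
        split_ifs with h
        · rw [h, sub_add_cancel]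
          exact Submodule.smul_mem _ _ ha
        · rw [map_zero, zero_smul]
          exact zero_mem _
      · rw [LinearMap.smulRight_apply, LinearMap.comp_apply, hz_of_mem_self hR' he]
      · rw [LinearMap.smulRight_apply, LinearMap.smulRight_apply, LinearMap.comp_apply,
          hz_of_mem hR' (mul_mem_cz (proj_mem_cz (ι_mem p)) he), if_neg (by push_cast at hn' ⊢; omega),
          map_zero, zero_smul, mul_smul_comm, hsoc, smul_zero]
    | succ i ih =>
      obtain ⟨Φ, h1, h2, h3⟩ := ih
      set n : ℤ := (j : ℤ) - i with hn
      let F : cz R (d - j + (n - 1)) →ₗ[k] (Fin 2 → QuotAlg R) := LinearMap.pi fun p =>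
        (LinearMap.mulLeft k (T (proj R' (FreeAlgebra.ι k p)))).comp (Submodule.subtype _)
      let G : cz R' (n - 1) →ₗ[k] (Fin 2 → QuotAlg R) := LinearMap.pi fun p =>
        Φ.comp ((LinearMap.mulLeft k (proj R' (FreeAlgebra.ι k p))).comp (Submodule.subtype _))
      obtain ⟨t, ht⟩ := exists_lift_of_range_le F G fun e => by
        have hmem : ∀ p, proj R' (FreeAlgebra.ι k p) * e.1 ∈ cz R' n := fun p => by
          have := mul_mem_cz (proj_mem_cz (R := R') (ι_mem p)) e.2
          rwa [Nat.cast_one, add_sub_cancel] at this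
        -- To extend `Φ` to degree `n - 1`, one needs an element whose products with the generators
        -- are the values `Φ (x_p e)`. These values form a cycle because the first overlap also lies
        -- in VR', so the cycle is a boundary.
        obtain ⟨a', ha', h⟩ := hex (d - j + n) (by omega) (G e) (fun l => h1 n _ (hmem l))
          (fun l => by
            have h4 : ∀ j, T (proj R' (lc l (f' j))) * G e j =
                Φ (proj R' (lc l (f' j) * FreeAlgebra.ι k j) * e.1) := fun j => by
              rw [map_mul (proj R'), mul_assoc]
              exact (map_mul_of_forall_ι T Φ h3 (lcon_mem _ (hf's j)) (le_refl n) (hmem j)).symm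
            rw [Finset.sum_congr rfl fun j _ => h4 j, ← map_sum, ← Finset.sum_mul, ← map_sum,
              proj_eq_zero_of_mem (hover l), zero_mul, map_zero])
        refine ⟨⟨a', by rwa [← add_sub_assoc]⟩, funext fun l => (h l).symm⟩
      let pr : QuotAlg R' →ₗ[k] cz R' (n - 1) :=
        (hz hR' (n - 1)).codRestrict _ fun x => hz_mem hR' _ _
      have hpr : ∀ n' e, e ∈ cz R' n' → n' ≠ n - 1 → pr e = 0 := fun n' e he hne =>
        Subtype.ext (by
          change hz hR' (n - 1) e = 0
          rw [hz_of_mem hR' he, if_neg hne])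
      have hpr' : ∀ e (he : e ∈ cz R' (n - 1)), pr e = ⟨e, he⟩ := fun e he =>
        Subtype.ext (hz_of_mem_self hR' he)
      let Φ' : QuotAlg R' →ₗ[k] QuotAlg R :=
        Φ - Φ.comp ((Submodule.subtype _).comp pr) + (Submodule.subtype _).comp (t.comp pr)
      have hΦ : ∀ n' e, e ∈ cz R' n' → n' ≠ n - 1 → Φ' e = Φ e := fun n' e he hne => by
        simp only [Φ', LinearMap.add_apply, LinearMap.sub_apply, LinearMap.comp_apply,
          hpr n' e he hne, map_zero, sub_zero, add_zero]
      have hΦ' : ∀ e (he : e ∈ cz R' (n - 1)), Φ' e = t ⟨e, he⟩ := fun e he => by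
        simp only [Φ', LinearMap.add_apply, LinearMap.sub_apply, LinearMap.comp_apply, hpr' e he,
          Submodule.subtype_apply, sub_self, zero_add]
      refine ⟨Φ', fun n' e he => ?_, fun e he => ?_, fun n' hn' e he p => ?_⟩
      · by_cases h : n' = n - 1
        · subst h
          rw [hΦ' e he]
          exact (t ⟨e, he⟩).2
        · rw [hΦ n' e he h]
          exact h1 n' e he
      · rw [hΦ j e he (by omega), h2 e he]
      · have hmem := mul_mem_cz (proj_mem_cz (R := R') (ι_mem p)) he
        rw [hΦ _ _ hmem (by push_cast at hn' ⊢; omega)]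
        by_cases h : n' = n - 1
        · subst h
          rw [hΦ' e he]
          exact (congrFun (ht ⟨e, he⟩) p).symm
        · rw [hΦ n' e he h]
          exact h3 n' (by push_cast at hn'; omega) e he p
  obtain ⟨Φ, h1, h2, h3⟩ := key j
  -- In degree 0 the map lands in degree `d - j < 0`. Linearity then gives `a = Φ b = b Φ(1) = 0`.
  have hΦ1 : Φ 1 = 0 := by
    have := h1 0 1 one_mem_cz
    rwa [cz_of_neg (by omega), Submodule.mem_bot] at this
  have hb' := hb
  rw [cz_natCast] at hb'
  obtain ⟨x, hx, rfl⟩ := hb'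
  change proj R' x ∈ cz R' (j : ℤ) at hb
  have h4 := map_mul_of_forall_ι T Φ h3 hx (n' := 0) (by omega) one_mem_cz
  rw [mul_one, hΦ1, mul_zero, h2 _ hb] at h4
  have h5 : ψ (proj R' x) = 1 := hψ
  rw [h5, one_smul] at h4
  exact ha0 h4

/-- The Hilbert function of an algebra with two generators, two relations of degree `s > 2` and one
overlap cannot be that of a finite-dimensional algebra. -/
theorem false_of_hilbert (hs : 3 ≤ s) (d : ℕ) (β : ℤ → ℕ) (hneg : ∀ j < 0, β j = 0)
    (hbig : ∀ j > (d : ℤ), β j = 0)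
    (h : ∀ n : ℕ, n ≤ s + d → (β n : ℤ) - 2 * β (n - 1) + 2 * β (n - s) - β (n - s - 1) =
      if n = 0 then 1 else 0) : False := by
  classical
  let P : Polynomial ℤ :=
    ∑ j ∈ Finset.range (d + 1), Polynomial.C (β j : ℤ) * Polynomial.X ^ j
  have hP : ∀ n : ℕ, P.coeff n = β n := fun n => by
    simp only [P, Polynomial.finsetSum_coeff, Polynomial.coeff_C_mul_X_pow]
    rw [Finset.sum_ite_eq]
    split_ifs with hn
    · rfl
    · rw [Finset.mem_range] at hn
      rw [hbig n (by omega), Nat.cast_zero]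
  have hPX : ∀ l n : ℕ, (P * Polynomial.X ^ l).coeff n = ((β (n - l) : ℕ) : ℤ) := fun l n => by
    rw [Polynomial.coeff_mul_X_pow', hP]
    split_ifs with hn
    · rw [Nat.cast_sub hn]
    · rw [hneg _ (by omega), Nat.cast_zero]
  -- The recurrence is given only up to degree `s + d`; in degree `s + 1 + d` a single term
  -- survives, and above it everything is zero.
  have hid : P - 2 * (P * Polynomial.X ^ 1) + 2 * (P * Polynomial.X ^ s) -
      P * Polynomial.X ^ (s + 1) = 1 - Polynomial.C (β d : ℤ) * Polynomial.X ^ (s + 1 + d) := by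
    ext n
    have h2 : ∀ Q : Polynomial ℤ, (2 * Q).coeff n = 2 * Q.coeff n := fun Q =>
      Polynomial.coeff_ofNat_mul
    rw [Polynomial.coeff_sub, Polynomial.coeff_add, Polynomial.coeff_sub, Polynomial.coeff_sub,
      h2, h2, hPX, hPX, hPX, hP, Polynomial.coeff_one, Polynomial.coeff_C_mul_X_pow]
    rcases lt_trichotomy n (s + 1 + d) with hn | rfl | hn
    · have := h n (by omega)
      rw [if_neg hn.ne, sub_zero]
      push_cast
      rw [← sub_sub]
      exact this
    · push_cast
      rw [hbig _ (by omega), hbig _ (by omega), hbig _ (by omega), if_neg (by omega), if_pos rfl,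
        show (s : ℤ) + 1 + d - (s + 1) = d by ring]
      simp
    · rw [hbig _ (by omega), hbig _ (by omega), hbig _ (by omega), hbig _ (by omega),
        if_neg (by omega), if_neg (by omega)]
      simp
  have h1 := congrArg (Polynomial.eval 1) hid
  have h2 := congrArg (fun Q => Polynomial.eval 1 (Polynomial.derivative Q)) hid
  have hpos : 0 ≤ P.eval 1 := by
    simp only [P, Polynomial.eval_finsetSum, Polynomial.eval_mul, Polynomial.eval_C,
      Polynomial.eval_pow, Polynomial.eval_X, one_pow, mul_one]
    exact Finset.sum_nonneg fun j _ => Int.natCast_nonneg _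
  -- At 1 the factor `1 - 2t + 2t^s - t^(s+1)` vanishes, so β_d = 1; the derivative yields (s - 3)
  -- P(1) = -(s + 1 + d), impossible as P(1) ≥ 0 and s ≥ 3.
  simp [Polynomial.derivative_X_pow] at h1 h2
  have hd1 : (β d : ℤ) = 1 := by linarith
  rw [hd1] at h2
  have hs' : (3 : ℤ) ≤ s := by exact_mod_cast hs
  nlinarith [mul_nonneg (sub_nonneg.2 hs') hpos, Int.natCast_nonneg d]

end Socle

end HomogAlg

end

noncomputable section

namespace HomogAlg

/-! ### Overlaps of rank two -/

section TwoVariables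

variable {k : Type u} [Field k] {m s : ℕ} {R : Submodule k (Free k m)}

theorem lcf_mem_homog_mul (φ : Free k m →ₗ[k] k) {n : ℕ} {N : Submodule k (Free k m)}
    {x : Free k m} (hx : x ∈ homog k m (n + 1) * N) : lcf φ x ∈ homog k m n * N := by
  induction hx using Submodule.mul_induction_on' with
  | mem_mul_mem a ha b hb =>
    rw [lcf_mul_of_mem φ ha]
    exact Submodule.mul_mem_mul (lcon_mem _ ha) hb
  | add x _ y _ hx hy => rw [map_add]; exact add_mem hx hy

/-- By `eq_sum_lcf_mul` a last factor from the span of `u` can be split off; the contractions left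
over still have this property, so all factors can be moved there one by one. -/
theorem mem_span_pow {f u v : Fin 2 → Free k m} (hfs : ∀ j, f j ∈ homog k m (s + 1))
    (hv : ∀ j, v j ∈ homog k m 1) (hvli : LinearIndependent k v)
    (H : ∑ j, f j * u j = ∑ j, v j * f j) (l : Fin 2) :
    f l ∈ Submodule.span k (Set.range u) ^ (s + 1) := by
  obtain ⟨φ, hφ⟩ := exists_dual_family hvli
  have key : ∀ p ≤ s + 1, ∀ l, f l ∈ homog k m (s + 1 - p) * Submodule.span k (Set.range u) ^ p := by
    intro p
    induction p with
    | zero =>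
      intro _ l
      rw [pow_zero, mul_one]
      exact hfs l
    | succ p ih =>
      intro hp l
      rw [eq_sum_lcf_mul hfs hv hφ H l, pow_succ, ← mul_assoc]
      refine Submodule.sum_mem _ fun j _ =>
        Submodule.mul_mem_mul ?_ (Submodule.subset_span ⟨j, rfl⟩)
      refine lcf_mem_homog_mul (φ l) ?_
      rw [show s + 1 - (p + 1) + 1 = s + 1 - p by omega]
      exact ih (by omega) j
  have := key (s + 1) le_rfl l
  rwa [Nat.sub_self, homog_zero, ← Submodule.one_eq_span, one_mul] at this

/-- Contracting `E * t`, an element of V E, along a functional dual to `v 0` gives `f 0 * t = c •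
E`; comparing coefficients of `f 1` gives `c = 0`, and then `t = 0`. -/
theorem W_add_two_eq_bot_of_sum {f u v : Fin 2 → Free k m} (hf : LinearIndependent k f)
    (hfs : ∀ j, f j ∈ homog k m s) (hu : ∀ j, u j ∈ homog k m 1) (hv : ∀ j, v j ∈ homog k m 1)
    (huli : LinearIndependent k u)
    (hvli : LinearIndependent k v) (H : ∑ j, f j * u j = ∑ j, v j * f j)
    (hW : W s R (s + 1) = Submodule.span k {∑ j, f j * u j}) : W s R (s + 2) = ⊥ := by
  rw [show s + 2 = s + 1 + 1 from rfl, W_succ (by omega), hW, eq_bot_iff]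
  rintro w ⟨hw1, hw2⟩
  obtain ⟨t, -, rfl⟩ := Submodule.mem_span_singleton_mul.1 hw1
  obtain ⟨φ, hφ⟩ := exists_dual_family hvli
  have hE : ∑ j, f j * u j ∈ homog k m (s + 1) :=
    Submodule.sum_mem _ fun j _ => homog_mul (hfs j) (hu j)
  have h1 : lcf (φ 0) ((∑ j, f j * u j) * t) = f 0 * t := by
    rw [lcf_mul_of_mem _ hE, H, map_sum,
      Finset.sum_congr rfl fun j _ => lcf_mul (φ 0) (hv j) (f j)]
    simp [hφ]
  have h2 := lcon_mem_of_mem_mul (fun i => φ 0 (FreeAlgebra.ι k i)) hw2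
  obtain ⟨c, hc⟩ := Submodule.mem_span_singleton.1 h2
  rw [h1] at hc
  have h3 : ∑ j, f j * ![c • u 0 - t, c • u 1] j = 0 := by
    rw [Fin.sum_univ_two] at hc ⊢
    simp only [Matrix.cons_val_zero, Matrix.cons_val_one]
    rw [mul_sub, ← hc, mul_smul_comm, mul_smul_comm, smul_add]
    abel
  have h4 := eq_zero_of_sum_mul_eq_zero hf hfs h3 1
  have h5 := eq_zero_of_sum_mul_eq_zero hf hfs h3 0
  simp only [Matrix.cons_val_zero, Matrix.cons_val_one] at h4 h5
  have hc0 : c = 0 := (smul_eq_zero.1 h4).resolve_right (huli.ne_zero 1)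
  rw [hc0, zero_smul, zero_sub, neg_eq_zero] at h5
  rw [h5, mul_zero]
  exact zero_mem _

theorem euler_oneData {R' : Submodule k (Free k 2)} (hs : 2 ≤ s) {f : Fin 2 → Free k 2}
    (hf : LinearIndependent k f) (hfR : Submodule.span k (Set.range f) = R') {E : Free k 2}
    (hE : E ≠ 0) (hW : W s R' (s + 1) = Submodule.span k {E}) (hW' : W s R' (s + 2) = ⊥) (n : ℕ) :
    (oneData hs hf hfR hE hW hW').euler n = (Module.finrank k (cz R' n) : ℤ) -
      2 * Module.finrank k (cz R' (n - 1)) + 2 * Module.finrank k (cz R' (n - s)) -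
        Module.finrank k (cz R' (n - s - 1)) := by
  rw [KData.euler, Finset.sum_range_succ', Finset.sum_range_succ', Finset.sum_range_succ']
  have hr : ∀ i, (oneData hs hf hfR hE hW hW').r (i + 3) = oneRank i := fun _ => rfl
  have h3 : ∑ i ∈ Finset.range n, (-1 : ℤ) ^ (i + 1 + 1 + 1) *
      (((oneData hs hf hfR hE hW hW').r (i + 1 + 1 + 1) : ℤ) *
        Module.finrank k (cz R' ((n : ℤ) - chi s (i + 1 + 1 + 1)))) =
      - Module.finrank k (cz R' ((n : ℤ) - s - 1)) := by
    cases n with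
    | zero =>
      rw [Finset.sum_range_zero, cz_of_neg (by push_cast; omega), finrank_bot]
      simp
    | succ n =>
      rw [Finset.sum_range_succ', Finset.sum_eq_zero fun i _ => ?_, zero_add]
      · change (-1 : ℤ) ^ 3 * (((1 : ℕ) : ℤ) *
          Module.finrank k (cz R' (((n + 1 : ℕ) : ℤ) - chi s 3))) = _
        rw [chi_three, show ((n + 1 : ℕ) : ℤ) - ((s + 1 : ℕ) : ℤ) = ((n + 1 : ℕ) : ℤ) - s - 1 by
          push_cast; ring]
        ring
      · change _ * (((0 : ℕ) : ℤ) * _) = 0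
        simp
  rw [h3]
  change _ + (-1 : ℤ) ^ 2 * (((2 : ℕ) : ℤ) * Module.finrank k (cz R' ((n : ℤ) - chi s 2))) +
    (-1 : ℤ) ^ 1 * (((2 : ℕ) : ℤ) * Module.finrank k (cz R' ((n : ℤ) - chi s 1))) +
    (-1 : ℤ) ^ 0 * (((1 : ℕ) : ℤ) * Module.finrank k (cz R' ((n : ℤ) - chi s 0))) = _
  rw [chi_two, chi_one, chi_zero, Nat.cast_zero, sub_zero, Nat.cast_one]
  push_cast
  ring

/-- K_3 → K_2 is `a ↦ (u_0 a, u_1 a)`, so its kernel consists of elements annihilated by the `u_j`.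
The relations involve only these two forms, which gives an algebra on two generators that is a
retract of the given one. A nonzero kernel element would make it finite-dimensional, against its
Hilbert function. -/
theorem sumData_determined (hs : 3 ≤ s) (hR : R ≤ homog k m s) {f u v : Fin 2 → Free k m}
    (hf : LinearIndependent k f) (hfR : Submodule.span k (Set.range f) = R)
    (hu : ∀ j, u j ∈ homog k m 1) (hv : ∀ j, v j ∈ homog k m 1) (huli : LinearIndependent k u)
    (hvli : LinearIndependent k v) (H : ∑ j, f j * u j = ∑ j, v j * f j)
    (hW : W s R (s + 1) = Submodule.span k {∑ j, f j * u j}) :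
    ∃ K : KData s R, K.Determined (by omega) hR := by
  have hs2 : 2 ≤ s := by omega
  have hfmem : ∀ j, f j ∈ R := fun j => hfR ▸ Submodule.subset_span ⟨j, rfl⟩
  have hfs : ∀ j, f j ∈ homog k m s := fun j => hR (hfmem j)
  have hW' := W_add_two_eq_bot_of_sum hf hfs hu hv huli hvli H hW
  have hE : ∑ j, f j * u j ≠ 0 := fun h =>
    huli.ne_zero 0 (eq_zero_of_sum_mul_eq_zero hf hfs h 0)
  obtain ⟨χ, hχ⟩ := exists_dual_family huli
  -- `θ` includes the two-generator free algebra by `u`, and `ϱ` retracts onto it. Both preserve the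
  -- relations, so they induce maps of the quotients.
  let θ : Free k 2 →ₐ[k] Free k m := FreeAlgebra.lift k u
  let ϱ : Free k m →ₐ[k] Free k 2 :=
    FreeAlgebra.lift k fun i => ∑ l, χ l (FreeAlgebra.ι k i) • FreeAlgebra.ι k l
  have hθι : ∀ l, θ (FreeAlgebra.ι k l) = u l := fun l => FreeAlgebra.lift_ι_apply _ _
  have hϱV : ∀ w ∈ homog k m 1, ϱ w = ∑ l, χ l w • FreeAlgebra.ι k l := by
    intro w hw
    rw [homog_one] at hw
    induction hw using Submodule.span_induction with
    | mem _ h => obtain ⟨i, rfl⟩ := h; exact FreeAlgebra.lift_ι_apply _ _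
    | zero => simp
    | add x y _ _ hx hy => simp only [map_add, hx, hy, add_smul, Finset.sum_add_distrib]
    | smul c x _ hx => simp only [map_smul, hx, Finset.smul_sum, smul_smul, smul_eq_mul]
  have hϱu : ∀ l, ϱ (u l) = FreeAlgebra.ι k l := fun l => by
    rw [hϱV _ (hu l)]
    simp [hχ]
  have hϱθ : ∀ x, ϱ (θ x) = x := fun x => by
    have : ϱ.comp θ = AlgHom.id k _ := FreeAlgebra.hom_ext (funext fun l => by
      change ϱ (θ (FreeAlgebra.ι k l)) = FreeAlgebra.ι k l
      rw [hθι, hϱu])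
    exact DFunLike.congr_fun this x
  have hθmem : ∀ i, θ (FreeAlgebra.ι k i) ∈ homog k m 1 := fun i => hθι i ▸ hu i
  have hϱmem : ∀ i, ϱ (FreeAlgebra.ι k i) ∈ homog k 2 1 := fun i => by
    rw [hϱV _ (ι_mem i)]
    exact Submodule.sum_mem _ fun l _ => Submodule.smul_mem _ _ (ι_mem l)
  have hfix : ∀ j, θ (ϱ (f j)) = f j := by
    obtain ⟨l, rfl⟩ : ∃ l, s = l + 1 := ⟨s - 1, by omega⟩
    intro j
    have h1 : ∀ p, Submodule.span k (Set.range u) ^ p ≤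
        LinearMap.eqLocus (θ.comp ϱ).toLinearMap LinearMap.id := by
      intro p
      induction p with
      | zero =>
        rw [pow_zero, Submodule.one_eq_span, Submodule.span_le, Set.singleton_subset_iff]
        exact map_one (θ.comp ϱ)
      | succ p ih =>
        rw [pow_succ, Submodule.mul_le]
        intro a ha b hb
        have hb' : (θ.comp ϱ) b = b := by
          have : Submodule.span k (Set.range u) ≤
              LinearMap.eqLocus (θ.comp ϱ).toLinearMap LinearMap.id := by
            rw [Submodule.span_le]
            rintro _ ⟨j, rfl⟩
            change θ (ϱ (u j)) = u j
            rw [hϱu, hθι]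
          exact this hb
        have ha' : (θ.comp ϱ) a = a := ih ha
        change (θ.comp ϱ) (a * b) = a * b
        rw [map_mul, ha', hb']
    exact h1 _ (mem_span_pow hfs hv hvli H j)
  set f' : Fin 2 → Free k 2 := fun j => ϱ (f j) with hf'
  have hθf : ∀ j, θ (f' j) = f j := hfix
  have hf'li : LinearIndependent k f' := by
    have h1 : θ.toLinearMap ∘ f' = f := funext hθf
    exact LinearIndependent.of_comp θ.toLinearMap (by rw [h1]; exact hf)
  have hf's : ∀ j, f' j ∈ homog k 2 s := fun j => map_mem_homog ϱ hϱmem (hfs j)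
  set R' := Submodule.span k (Set.range f') with hR'def
  have hR' : R' ≤ homog k 2 s := by
    rw [Submodule.span_le]
    rintro _ ⟨j, rfl⟩
    exact hf's j
  have hθR : ∀ x ∈ R', θ x ∈ R := by
    have : R' ≤ R.comap θ.toLinearMap := by
      rw [Submodule.span_le]
      rintro _ ⟨j, rfl⟩
      change θ (f' j) ∈ R
      rw [hθf]
      exact hfmem j
    exact this
  have hϱR : ∀ x ∈ R, ϱ x ∈ R' := by
    have : R ≤ R'.comap ϱ.toLinearMap := by
      rw [← hfR, Submodule.span_le]
      rintro _ ⟨j, rfl⟩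
      exact Submodule.subset_span ⟨j, rfl⟩
    exact this
  have hϱE : ϱ (∑ j, f j * u j) = ∑ j, f' j * FreeAlgebra.ι k j := by
    rw [map_sum]
    exact Finset.sum_congr rfl fun j _ => by rw [map_mul, hϱu]
  have hEmem : ∑ j, f' j * FreeAlgebra.ι k j ∈ W s R' (s + 1) := by
    rw [← hϱE]
    refine map_mem_W ϱ hϱmem hϱR ?_
    rw [hW]
    exact Submodule.mem_span_singleton_self _
  have hW1 : W s R' (s + 1) = Submodule.span k {∑ j, f' j * FreeAlgebra.ι k j} := by
    refine le_antisymm (fun w hw => ?_) (by rwa [Submodule.span_singleton_le_iff_mem])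
    have := map_mem_W θ hθmem hθR hw
    rw [hW] at this
    obtain ⟨c, hc⟩ := Submodule.mem_span_singleton.1 this
    rw [← hϱθ w, ← hc, map_smul, hϱE]
    exact Submodule.smul_mem _ _ (Submodule.mem_span_singleton_self _)
  have hW2 : W s R' (s + 2) = ⊥ := by
    rw [eq_bot_iff]
    intro w hw
    have := map_mem_W θ hθmem hθR hw
    rw [hW', Submodule.mem_bot] at this
    rw [Submodule.mem_bot, ← hϱθ w, this, map_zero]
  have hE' : ∑ j, f' j * FreeAlgebra.ι k j ≠ 0 := fun h =>
    linearIndependent_ι.ne_zero 0 (eq_zero_of_sum_mul_eq_zero hf'li hf's h 0)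
  let T := mapQ θ hθR
  let P := mapQ ϱ hϱR
  have hPT : ∀ x, P (T x) = x := fun x => by
    obtain ⟨x, rfl⟩ := proj_surjective R' x
    change proj R' (ϱ (θ x)) = proj R' x
    rw [hϱθ]
  have hTι : ∀ l, T (proj R' (FreeAlgebra.ι k l)) = proj R (u l) := fun l => by
    change proj R (θ _) = _
    rw [hθι]
  have hPu : ∀ l, P (proj R (u l)) = proj R' (FreeAlgebra.ι k l) := fun l => by
    change proj R' (ϱ _) = _
    rw [hϱu]
  -- Contractions of the `f j` by letters are scalar combinations of the images of the contractions
  -- of the `f' j`, so the cycle conditions can be checked in two variables.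
  have hlc : ∀ (c : Fin 2 → QuotAlg R), (∀ l, ∑ j, T (proj R' (lc l (f' j))) * c j = 0) →
      ∀ i, ∑ j, proj R (lc i (f j)) * c j = 0 := by
    intro c hc i
    obtain ⟨φ, hφ, -⟩ := exists_lcf_eq_lcon (Pi.single i (1 : k))
    have h1 : ∀ j, lc i (f j) = ∑ l, φ (u l) • θ (lc l (f' j)) := fun j => by
      obtain ⟨l, rfl⟩ : ∃ l, s = l + 1 := ⟨s - 1, by omega⟩
      rw [lc, ← hφ, ← hθf j]
      conv_lhs => rw [eq_sum_lc_of_mem (hf's j), map_sum, map_sum]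
      exact Finset.sum_congr rfl fun l _ => by rw [map_mul, hθι, lcf_mul φ (hu l)]
    simp only [h1, map_sum, map_smul, Finset.sum_mul, smul_mul_assoc]
    rw [Finset.sum_comm]
    refine Finset.sum_eq_zero fun l _ => ?_
    rw [← Finset.smul_sum]
    exact (congrArg _ (hc l)).trans (smul_zero _)
  refine ⟨oneData hs2 hf hfR hE hW hW', oneData_determined _ _ _ _ _ _ _ ?_⟩
  intro n h1 h2
  rw [oneData_exactAt_two_iff _ _ _ _ _ _ _ rfl]
  intro a ha hsoc
  by_contra ha0
  have hd0 : 0 ≤ n - s - 1 := by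
    by_contra hneg
    rw [cz_of_neg (by omega), Submodule.mem_bot] at ha
    exact ha0 ha
  obtain ⟨d, hd⟩ := Int.eq_ofNat_of_zero_le hd0
  rw [hd] at ha
  -- Exactness in lower degrees descends to the retract.
  have hone : ∀ n' < n, (oneData hs2 hf'li rfl hE' hW1 hW2).ExactAt hs2 hR' 1 n' := by
    intro n' hn'
    rw [oneData_exactAt_one_iff _ _ _ _ _ _ _ rfl]
    intro c hc hc0
    obtain ⟨b, hb, hbc⟩ := (oneData_exactAt_one_iff _ _ _ _ _ _ _ rfl _).1 (h1 n' hn')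
      (fun j => T (c j)) (fun j => mapQ_mem_cz θ hθmem hθR (hc j))
      (hlc _ fun l => by
        simp only [← map_mul, ← map_sum]
        rw [hc0 l, map_zero])
    refine ⟨P b, mapQ_mem_cz ϱ hϱmem hϱR hb, fun j => ?_⟩
    rw [← hPT (c j), hbc j, map_mul, hPu]
  have htwo : ∀ n' < n, (oneData hs2 hf'li rfl hE' hW1 hW2).ExactAt hs2 hR' 2 n' := by
    intro n' hn'
    rw [oneData_exactAt_two_iff _ _ _ _ _ _ _ rfl]
    intro b hb hb0
    have := (oneData_exactAt_two_iff _ _ _ _ _ _ _ rfl _).1 (h2 n' hn') (T b)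
      (mapQ_mem_cz θ hθmem hθR hb) fun j => by rw [← hTι, ← map_mul, hb0 j, map_zero]
    rw [← hPT b, this, map_zero]
  -- Since `n = s + 1 + d`, the degrees `n' ≤ s + d` are those below `n`, where the two-variable
  -- complex is exact and its Euler characteristic known.
  refine false_of_hilbert hs d (fun j => Module.finrank k (cz R' j)) (fun j hj => ?_)
    (fun j hj => ?_) fun n' hn' => ?_
  · rw [cz_of_neg hj, finrank_bot]
  · obtain ⟨j, rfl⟩ := Int.eq_ofNat_of_zero_le (by omega : 0 ≤ j)
    obtain ⟨l, rfl⟩ : ∃ l, s = l + 1 := ⟨s - 1, by omega⟩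
    rw [cz_eq_bot_of_socle hR' T hf's ?_ (d := d) ?_ ha ha0 ?_ hj, finrank_bot]
    · intro p
      have h3 := hEmem
      rw [W_succ le_rfl, W_self] at h3
      have h4 := lcon_mem_of_mem_mul (Pi.single p (1 : k)) h3.2
      rw [map_sum] at h4
      convert h4 using 1
      exact Finset.sum_congr rfl fun j _ => by
        rw [lcon_mul, aug_eq_zero_of_mem (by omega) (hf's j), zero_smul, add_zero]
    · intro j' hj' c hc hc0
      obtain ⟨b, hb, hbc⟩ := (oneData_exactAt_one_iff _ _ _ _ _ _ _ rfl _).1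
        (h1 (j' + ((l + 1 : ℕ) : ℤ)) (by omega)) c (fun p => by rw [add_sub_cancel_right]; exact hc p)
        (hlc c hc0)
      rw [add_sub_cancel_right] at hb
      exact ⟨b, hb, fun p => by rw [hTι]; exact hbc p⟩
    · intro p
      rw [hTι]
      exact hsoc p
  · rw [← euler_oneData hs2 hf'li rfl hE' hW1 hW2, KData.euler_eq _ hs2 hR',
      (KData.exactAt_iff _ hs2 hR' 1 n').1 (hone n' (by omega)), sub_self, add_zero]
    intro i hi
    match i, hi with
    | 2, _ => exact htwo n' (by omega)
    | i + 3, _ => exact oneData_exactAt_add_three _ _ _ _ _ _ _ i n'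

end TwoVariables

/-! ### Assembling the cases -/

section Main

variable {k : Type u} [Field k] {m s : ℕ} {R : Submodule k (Free k m)}

theorem powData_determined (hs : 3 ≤ s) (hR : R ≤ homog k m s) {v g : Free k m}
    (hv : v ∈ homog k m 1) (hv0 : v ≠ 0) (hli : LinearIndependent k ![v ^ s, g])
    (hfR : Submodule.span k (Set.range ![v ^ s, g]) = R)
    (hW : W s R (s + 1) = Submodule.span k {v ^ (s + 1)}) :
    ∃ K : KData s R, K.Determined (by omega) hR := by
  have hW1 : W s R (s + 1) = Submodule.span k (Set.range ((powLadder hv hv0).e s)) := by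
    rw [hW, show (powLadder hv hv0).e s = fun _ => v ^ (s + 1) from funext (powLadder_e hv hv0 s),
      Set.range_const]
  refine ⟨ladderData (powLadder hv hv0) (by omega) hli hfR hW1,
    ladderData_determined _ _ _ _ _ _ hs (ι := fun _ => 0) (fun a => ?_)
      fun a b _ => Subsingleton.elim a b⟩
  rw [powLadder_e, Nat.sub_add_cancel (by omega)]
  rfl

theorem pairData_determined (hs : 3 ≤ s) (hR : R ≤ homog k m s) (L : Ladder k m 2)
    (hL : Submodule.span k (Set.range (L.e (s - 1))) = R) :
    ∃ K : KData s R, K.Determined (by omega) hR := by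
  obtain ⟨n, rfl⟩ : ∃ n, s = n + 2 := ⟨s - 2, by omega⟩
  have hW := L.W_succ_eq (s := n + 2) (R := R) (n := n) le_rfl (W_self.trans hL.symm)
  exact ⟨ladderData L (by omega) (L.e_li _) hL hW,
    ladderData_determined _ _ _ _ _ _ hs (ι := id) (fun a => rfl) Function.injective_id⟩

theorem exists_determined [IsAlgClosed k] (hs : 3 ≤ s) (hR : R ≤ homog k m s)
    {f : Fin 2 → Free k m} (hf : LinearIndependent k f)
    (hfR : Submodule.span k (Set.range f) = R) :
    ∃ K : KData s R, K.Determined (by omega) hR := by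
  obtain ⟨n, rfl⟩ : ∃ n, s = n + 3 := ⟨s - 3, by omega⟩
  have hfs : ∀ j, f j ∈ homog k m (n + 3) := fun j =>
    hR (hfR ▸ Submodule.subset_span ⟨j, rfl⟩)
  rcases classification hf hfs hfR with h | ⟨v, h, u, hv, hh, hu, hli, hspan, hW⟩ |
    ⟨u, v, hu, hv, huli, hvli, H, hW⟩ | ⟨v, g, hv, hv0, hli, hspan, hW⟩ | ⟨L, hL⟩
  · exact ⟨_, emptyData_determined (by omega) hR hf hfR h⟩
  · exact mulData_determined hs hR hv hh hu hli hspan hW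
  · exact sumData_determined hs hR hf hfR hu hv huli hvli H hW
  · exact powData_determined hs hR hv hv0 hli hspan hW
  · exact pairData_determined hs hR L hL

end Main

end HomogAlg

end

theorem mainTheorem2 {k : Type u} [Field k] [IsAlgClosed k] (m s : ℕ) (hs : 2 < s)
    (f₁ f₂ : HomogAlg.Free k m)
    (hf₁ : f₁ ∈ HomogAlg.homog k m s) (hf₂ : f₂ ∈ HomogAlg.homog k m s)
    (hf : LinearIndependent k ![f₁, f₂])
    (R : Submodule k (HomogAlg.Free k m)) (hR : R = Submodule.span k {f₁, f₂}) :
    (HomogAlg.IsSKoszul R s ↔ HomogAlg.KoszulExactAtTwo R (s := s) (by omega)) ∧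
    (HomogAlg.IsSKoszul R s ↔
      (PowerSeries.expand s (by omega) (HomogAlg.hilbertSeries (HomogAlg.A s R))
          - PowerSeries.X *
            PowerSeries.expand s (by omega) (HomogAlg.hilbertSeries (HomogAlg.M s R)))
        * HomogAlg.hilbertSeries (HomogAlg.comp R) = 1) := by
  have hspan : Submodule.span k (Set.range ![f₁, f₂]) = R := by
    rw [hR, HomogAlg.span_range_pair]
  have hRh : R ≤ HomogAlg.homog k m s := by
    rw [hR, Submodule.span_le]
    rintro _ (rfl | rfl) <;> assumption
  obtain ⟨K, hK⟩ := HomogAlg.exists_determined hs hRh hf hspan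
  exact K.main_of_determined _ _ hK (by omega) (by omega)
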